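/- For a positive integer $n$, let the fan $F_n$ be the graph on $2n+1$ vertices consisting of $n$ triangles that share exactly one common vertex, that is, the graph obtained from $n$ pairwise disjoint edges by adding one new vertex adjacent to all of their $2n$ endpoints. For a finite simple graph $H$, let the diagonal Ramsey number $R_2(H)$ be the minimum integer $N$ such that every colouring of the edges of the complete graph $K_N$ with the two colours red and blue contains a monochromatic copy of $H$ (as a subgraph, not necessarily induced). Then $$R_2(F_3)=14.$$ -/

import Mathlib

open scoped SimpleGraph

/-- The join of two graphs on disjoint vertex sets (written additively in the literature): the
disjoint union, together with all edges between the two vertex sets. -/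
def SimpleGraph.graphJoin {V W : Type*} (G : SimpleGraph V) (H : SimpleGraph W) :
    SimpleGraph (V ⊕ W) :=
  (G ⊕g H) ⊔ completeBipartiteGraph V W

/-- The disjoint union of `n` copies of `G`: the vertex `(i, v)` is the vertex `v` of the
copy number `i`. -/
def SimpleGraph.disjointCopies (n : ℕ) {V : Type*} (G : SimpleGraph V) :
    SimpleGraph (Fin n × V) where
  Adj x y := x.1 = y.1 ∧ G.Adj x.2 y.2
  symm := ⟨fun _ _ h => ⟨h.1.symm, h.2.symm⟩⟩
  loopless := ⟨fun _ h => G.irrefl h.2⟩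

/-- The fan with `2 * n + 1` vertices: the join of one vertex (the center) and of `n` disjoint
edges, that is, `n` triangles sharing exactly one common vertex. -/
def fanGraph (n : ℕ) : SimpleGraph (Fin 1 ⊕ (Fin n × Fin 2)) :=
  SimpleGraph.graphJoin (⊤ : SimpleGraph (Fin 1))
    (SimpleGraph.disjointCopies n (⊤ : SimpleGraph (Fin 2)))

/-- Every colouring of the edges of the complete graph on `N` vertices with the colours red
(`0`) and blue (`1`) yields a red copy of `F` or a blue copy of `H`. Copies are subgraphs, not
necessarily induced. -/
def RamseyArrows {V W : Type*} (N : ℕ) (F : SimpleGraph V) (H : SimpleGraph W) : Prop :=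
  ∀ C : SimpleGraph.TopEdgeLabeling (Fin N) (Fin 2),
    F ⊑ C.labelGraph 0 ∨ H ⊑ C.labelGraph 1

/-- The Ramsey number of two finite graphs: the minimum `N` such that every red-blue edge colouring
of the complete graph on `N` vertices yields a red `F` or a blue `H`. (The infimum of the empty
set is `0`, so a positive value is attained and is a genuine minimum.) -/
noncomputable def graphRamseyNumber {V W : Type*} (F : SimpleGraph V) (H : SimpleGraph W) : ℕ :=
  sInf {N : ℕ | RamseyArrows N F H}

/-- The diagonal Ramsey number of a finite graph. -/
noncomputable def diagonalRamseyNumber {V : Type*} (H : SimpleGraph V) : ℕ :=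
  graphRamseyNumber H H

/-! Upper bound. Suppose the edges of `K_14` split into graphs `B` and `R`, neither containing
`F_3`. The two colours play symmetric roles (`FanFreePair.swap`), so every lemma is available twice.

A basic tool concerns sets in which `R` has maximum degree two. Four vertices of such a set carry a
perfect `B`-matching or an `R`-triangle (`matching_four`), hence no vertex is `B`-joined to six
vertices of the set (`false_of_six`). This rules out `K_6` in either colour (`cliqueFree_six`).

The `R`-neighbourhood of a vertex has no three disjoint `R`-edges. Sets of at least seven vertices
with this property are described by `hasLargeJoin`, in the spirit of the Tutte–Berge formula. A
neighbourhood of eight vertices is thereby impossible (`card_red_le_seven`), so every vertex has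
degree 6 or 7 in each colour. As the two degrees add up to 13, it suffices to exclude degree 7. By
`large_red_neighborhood`, an `R`-neighbourhood of seven vertices produces a `B`-clique of order
five, an `R`-clique of order four (which the centre extends to order five), or a `Join`: an
`R`-triangle completely `B`-joined to a `B`-triangle. It remains to exclude two configurations.

Joins (`Join.elim`): the eight other vertices are near or far, according to whether they have a
`B`-neighbour in the `B`-triangle `Q`. There are between one and three near vertices, and each
number leads to a fan.

Cliques of order five (`cliqueFree_five`): each vertex of an `R`-clique `s` has two or three
`R`-neighbours outside. If it is always three, three of these triples are disjoint
(`StarLike.exists_disjoint`) and force a fan. If some vertex has only two, its seven outer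
`B`-neighbours are analysed with the colours exchanged: they yield a second, disjoint `R`-clique of
order five, a `B`-clique of order five crossing `s` in one vertex, or a join.

Lower bound. An explicit graph on 13 vertices is checked by kernel evaluation, and its colouring is
restricted to fewer vertices. -/

open Finset

/-! ### Fans and fan-free pairs of complementary graphs. -/

/-- Six vertices `a, a', b, b', c, c'` adjacent to `v` and carrying three disjoint edges. -/
def SimpleGraph.IsFan {V : Type*} (G : SimpleGraph V) (v a a' b b' c c' : V) : Prop :=
  (G.Adj v a ∧ G.Adj v a' ∧ G.Adj v b ∧ G.Adj v b' ∧ G.Adj v c ∧ G.Adj v c') ∧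
  (G.Adj a a' ∧ G.Adj b b' ∧ G.Adj c c') ∧
  (a ≠ b ∧ a ≠ b' ∧ a' ≠ b ∧ a' ≠ b') ∧ (a ≠ c ∧ a ≠ c' ∧ a' ≠ c ∧ a' ≠ c') ∧
  (b ≠ c ∧ b ≠ c' ∧ b' ≠ c ∧ b' ≠ c')

namespace SimpleGraph

variable {V : Type*} {G : SimpleGraph V}

theorem IsFan.swap {v a a' b b' c c' : V} (h : G.IsFan v a a' b b' c c') :
    G.IsFan v a' a b b' c c' := by
  obtain ⟨⟨h1, h2, h3⟩, ⟨e1, e2⟩, ⟨n1, n2, n3, n4⟩, ⟨n5, n6, n7, n8⟩, n⟩ := h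
  exact ⟨⟨h2, h1, h3⟩, ⟨e1.symm, e2⟩, ⟨n3, n4, n1, n2⟩, ⟨n7, n8, n5, n6⟩, n⟩

theorem IsFan.rotate {v a a' b b' c c' : V} (h : G.IsFan v a a' b b' c c') :
    G.IsFan v b b' c c' a a' := by
  obtain ⟨⟨h1, h2, h3, h4, h5⟩, ⟨e1, e2, e3⟩, ⟨n1, n2, n3, n4⟩, ⟨n5, n6, n7, n8⟩, n⟩ := h
  exact ⟨⟨h3, h4, h5.1, h5.2, h1, h2⟩, ⟨e2, e3, e1⟩, n,
    ⟨n1.symm, n3.symm, n2.symm, n4.symm⟩, n5.symm, n7.symm, n6.symm, n8.symm⟩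

end SimpleGraph

/-- Two complementary graphs, neither of which contains a fan with three blades. -/
structure FanFreePair {V : Type*} (B R : SimpleGraph V) : Prop where
  total : ∀ {x y}, x ≠ y → B.Adj x y ∨ R.Adj x y
  disj : ∀ {x y}, B.Adj x y → ¬ R.Adj x y
  fanB : ∀ v a a' b b' c c', ¬ B.IsFan v a a' b b' c c'
  fanR : ∀ v a a' b b' c c', ¬ R.IsFan v a a' b b' c c'

section Picking

variable {V : Type*} {s : Finset V}

theorem exists_three (hs : 3 ≤ #s) :
    ∃ a ∈ s, ∃ b ∈ s, ∃ c ∈ s, a ≠ b ∧ a ≠ c ∧ b ≠ c := by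
  obtain ⟨a, b, c, ha, hb, hc, h⟩ := Finset.two_lt_card_iff.1 hs
  exact ⟨a, ha, b, hb, c, hc, h⟩

open scoped Classical in
theorem exists_four (hs : 4 ≤ #s) :
    ∃ a ∈ s, ∃ b ∈ s, ∃ c ∈ s, ∃ d ∈ s, a ≠ b ∧ a ≠ c ∧ b ≠ c ∧ a ≠ d ∧ b ≠ d ∧ c ≠ d := by
  obtain ⟨d, hd⟩ := Finset.card_pos.1 (by omega : 0 < #s)
  obtain ⟨a, ha, b, hb, c, hc, h⟩ := exists_three (s := s.erase d)
    (by rw [Finset.card_erase_of_mem hd]; omega)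
  rw [Finset.mem_erase] at ha hb hc
  exact ⟨a, ha.2, b, hb.2, c, hc.2, d, hd, h.1, h.2.1, h.2.2, ha.1, hb.1, hc.1⟩

end Picking

/-! ### Neighbourhoods in which `R` has maximum degree two. -/

namespace FanFreePair

variable {V : Type*} {B R : SimpleGraph V}

theorem swap (h : FanFreePair B R) : FanFreePair R B :=
  ⟨fun hx => (h.total hx).symm, fun hx hy => h.disj hy hx, h.fanR, h.fanB⟩

/-- If none of the three perfect matchings of `K_4` lies in `B`, each contains an `R`-edge. Three
edges, one from each matching, form a triangle or a star, and the hypotheses exclude the stars. -/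
theorem matching_four (h : FanFreePair B R) {w x y z : V} (hd : [w, x, y, z].Nodup)
    (hw : ¬ (R.Adj w x ∧ R.Adj w y ∧ R.Adj w z)) (hx : ¬ (R.Adj x w ∧ R.Adj x y ∧ R.Adj x z))
    (hy : ¬ (R.Adj y w ∧ R.Adj y x ∧ R.Adj y z)) (hz : ¬ (R.Adj z w ∧ R.Adj z x ∧ R.Adj z y)) :
    (B.Adj w x ∧ B.Adj y z) ∨ (B.Adj w y ∧ B.Adj x z) ∨ (B.Adj w z ∧ B.Adj x y) ∨
    (R.Adj w x ∧ R.Adj w y ∧ R.Adj x y) ∨ (R.Adj w x ∧ R.Adj w z ∧ R.Adj x z) ∨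
    (R.Adj w y ∧ R.Adj w z ∧ R.Adj y z) ∨ (R.Adj x y ∧ R.Adj x z ∧ R.Adj y z) := by
  have := @h.total
  simp at hd
  grind [SimpleGraph.adj_comm]

/-- Every vertex of `s` has at most two neighbours in `s`. -/
def MaxDegTwo (G : SimpleGraph V) (s : Finset V) : Prop :=
  ∀ w ∈ s, ∀ a ∈ s, ∀ b ∈ s, ∀ c ∈ s, a ≠ b → a ≠ c → b ≠ c →
    G.Adj w a → G.Adj w b → G.Adj w c → False

theorem MaxDegTwo.mono {G : SimpleGraph V} {s t : Finset V} (h : MaxDegTwo G t) (hst : s ⊆ t) :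
    MaxDegTwo G s := fun w hw a ha b hb c hc =>
  h w (hst hw) a (hst ha) b (hst hb) c (hst hc)

open scoped Classical in
-- The edge `ab` and a perfect `B`-matching of the other four vertices of `s` are the blades of a
-- fan at `v`. If those four contain an `R`-triangle instead, the degree bound makes it completely
-- `B`-joined to `b` and to the fourth vertex `w`. By `htri` some triangle vertex is a `B`-neighbour
-- of `a`, and the other two are matched to `b` and `w`.
theorem false_of_five_add_one (h : FanFreePair B R) {v a : V} {s : Finset V} (hs : #s = 5)
    (hd : MaxDegTwo R s) (hvs : ∀ w ∈ s, B.Adj v w) (hva : B.Adj v a) (has : a ∉ s)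
    (hab : ∃ b ∈ s, B.Adj a b)
    (htri : ∀ x ∈ s, ∀ y ∈ s, ∀ z ∈ s, R.Adj x y → R.Adj x z → R.Adj y z →
      R.Adj a x → R.Adj a y → R.Adj a z → False) : False := by
  obtain ⟨b, hb, hab⟩ := hab
  obtain ⟨w, hw, x, hx, y, hy, z, hz, hne⟩ := exists_four (s := s.erase b)
    (by rw [Finset.card_erase_of_mem hb]; omega)
  rw [Finset.mem_erase] at hw hx hy hz
  have key : ∀ x ∈ s, ∀ y ∈ s, ∀ z ∈ s, ∀ w ∈ s, [x, y, z, w, b].Nodup →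
      ¬ (R.Adj x y ∧ R.Adj x z ∧ R.Adj y z) := by
    intro x hx y hy z hz w hw hn hR
    have hax : ∀ x ∈ s, a ≠ x := fun x hx hax => has (hax ▸ hx)
    simp at hn
    have h1 : ∀ x' ∈ s, ∀ y' ∈ s, ∀ z' ∈ s, R.Adj x' y' → R.Adj x' z' → y' ≠ z' → ∀ u ∈ s, u ≠ x' →
       u ≠ y' → u ≠ z' → B.Adj x' u := by
      intro x' hx' y' hy' z' hz' h1 h2 h3 u hu h4 h5 h6
      refine (h.total h4.symm).resolve_right fun h7 => ?_
      exact hd x' hx' y' hy' z' hz' u hu h3 h5.symm h6.symm h1 h2 h7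
    have hxw : B.Adj x w := h1 x hx y hy z hz hR.1 hR.2.1 (by grind) w hw (by grind) (by grind) (by grind)
    have hyw : B.Adj y w := h1 y hy x hx z hz hR.1.symm hR.2.2 (by grind) w hw (by grind) (by grind) (by grind)
    have hzw : B.Adj z w := h1 z hz x hx y hy hR.2.1.symm hR.2.2.symm (by grind) w hw (by grind) (by grind) (by grind)
    have hxb : B.Adj x b := h1 x hx y hy z hz hR.1 hR.2.1 (by grind) b hb (by grind) (by grind) (by grind)
    have hyb : B.Adj y b := h1 y hy x hx z hz hR.1.symm hR.2.2 (by grind) b hb (by grind) (by grind) (by grind)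
    have hzb : B.Adj z b := h1 z hz x hx y hy hR.2.1.symm hR.2.2.symm (by grind) b hb (by grind) (by grind) (by grind)
    have := htri x hx y hy z hz hR.1 hR.2.1 hR.2.2
    rcases h.total (hax x hx) with h2 | h2
    · exact h.fanB v a x y b z w ⟨by simp_all, ⟨h2, hyb, hzw⟩, by grind⟩
    rcases h.total (hax y hy) with h3 | h3
    · exact h.fanB v a y x b z w ⟨by simp_all, ⟨h3, hxb, hzw⟩, by grind⟩
    rcases h.total (hax z hz) with h4 | h4
    · exact h.fanB v a z x b y w ⟨by simp_all, ⟨h4, hxb, hyw⟩, by grind⟩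
    exact this h2 h3 h4
  have hdeg : ∀ w ∈ s, ∀ x ∈ s, ∀ y ∈ s, ∀ z ∈ s, x ≠ y → x ≠ z → y ≠ z →
      ¬ (R.Adj w x ∧ R.Adj w y ∧ R.Adj w z) :=
    fun w hw x hx y hy z hz h1 h2 h3 h4 => hd w hw x hx y hy z hz h1 h2 h3 h4.1 h4.2.1 h4.2.2
  have h4 := h.matching_four (w := w) (x := x) (y := y) (z := z) (by simp; grind)
    (hdeg _ hw.2 _ hx.2 _ hy.2 _ hz.2 (by grind) (by grind) (by grind))
    (hdeg _ hx.2 _ hw.2 _ hy.2 _ hz.2 (by grind) (by grind) (by grind))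
    (hdeg _ hy.2 _ hw.2 _ hx.2 _ hz.2 (by grind) (by grind) (by grind))
    (hdeg _ hz.2 _ hw.2 _ hx.2 _ hy.2 (by grind) (by grind) (by grind))
  have k1 := key w hw.2 x hx.2 y hy.2 z hz.2 (by simp; grind)
  have k2 := key w hw.2 x hx.2 z hz.2 y hy.2 (by simp; grind)
  have k3 := key w hw.2 y hy.2 z hz.2 x hx.2 (by simp; grind)
  have k4 := key x hx.2 y hy.2 z hz.2 w hw.2 (by simp; grind)
  have f1 := h.fanB v a b w x y z
  have f2 := h.fanB v a b w y x z
  have f3 := h.fanB v a b w z x y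
  have := hvs w hw.2
  have := hvs x hx.2
  have := hvs y hy.2
  have := hvs z hz.2
  have := hvs b hb
  unfold SimpleGraph.IsFan at f1 f2 f3
  grind

open scoped Classical in
-- Any vertex of a six-element subset can serve as the extra vertex of `false_of_five_add_one`: its
-- own degree bound supplies the `B`-neighbour and forbids an `R`-join to a triangle.
theorem false_of_six (h : FanFreePair B R) {v : V} {s : Finset V} (hs : 6 ≤ #s)
    (hd : MaxDegTwo R s) (hvs : ∀ w ∈ s, B.Adj v w) : False := by
  obtain ⟨s', hss, hs'⟩ := Finset.exists_subset_card_eq hs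
  replace hd := hd.mono hss
  replace hvs : ∀ w ∈ s', B.Adj v w := fun w hw => hvs w (hss hw)
  clear hss hs
  obtain ⟨a, ha⟩ := Finset.card_pos.1 (by omega : 0 < #s')
  have h5 : #(s'.erase a) = 5 := by rw [Finset.card_erase_of_mem ha]; omega
  refine h.false_of_five_add_one (v := v) (a := a) h5 (hd.mono (Finset.erase_subset _ _))
    (fun w hw => hvs w (Finset.mem_of_mem_erase hw)) (hvs a ha) (by simp) ?_ ?_
  · by_contra! hcon
    obtain ⟨x, hx, y, hy, z, hz, h1, h2, h3⟩ := exists_three (s := s'.erase a) (by omega)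
    have hR : ∀ x ∈ s'.erase a, R.Adj a x := fun x hx =>
      (h.total (Finset.ne_of_mem_erase hx).symm).resolve_left (hcon x hx)
    exact hd a ha x (Finset.mem_of_mem_erase hx) y (Finset.mem_of_mem_erase hy) z
      (Finset.mem_of_mem_erase hz) h1 h2 h3 (hR x hx) (hR y hy) (hR z hz)
  · intro x hx y hy z hz h1 h2 h3 h4 h5 h6
    exact hd a ha x (Finset.mem_of_mem_erase hx) y (Finset.mem_of_mem_erase hy) z
      (Finset.mem_of_mem_erase hz) h1.ne h2.ne h3.ne h4 h5 h6

end FanFreePair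

section Counting

variable {V : Type*}

open scoped Classical in
/-- Distinct representatives of three sets of increasing size. -/
theorem exists_distinct_representatives {s₁ s₂ s₃ : Finset V} (h₁ : 1 ≤ #s₁) (h₂ : 2 ≤ #s₂)
    (h₃ : 3 ≤ #s₃) : ∃ a ∈ s₁, ∃ b ∈ s₂, ∃ c ∈ s₃, a ≠ b ∧ a ≠ c ∧ b ≠ c := by
  obtain ⟨a, ha⟩ := Finset.card_pos.1 h₁
  obtain ⟨b, hb, hb'⟩ := Finset.exists_mem_notMem_of_card_lt_card (s := {a}) (t := s₂)
    (by rw [Finset.card_singleton]; omega)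
  obtain ⟨c, hc, hc'⟩ := Finset.exists_mem_notMem_of_card_lt_card (s := {a, b}) (t := s₃)
    (lt_of_le_of_lt Finset.card_le_two (by omega))
  simp only [Finset.mem_singleton, Finset.mem_insert, not_or] at hb' hc'
  exact ⟨a, ha, b, hb, c, hc, fun h => hb' h.symm, fun h => hc'.1 h.symm, fun h => hc'.2 h.symm⟩

open scoped Classical in
theorem card_filter_le_one {p : V → Prop} {s : Finset V}
    (h : ∀ a ∈ s, ∀ b ∈ s, a ≠ b → p a → p b → False) : #{x ∈ s | p x} ≤ 1 := by
  rw [Finset.card_le_one]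
  intro a ha b hb
  rw [Finset.mem_filter] at ha hb
  by_contra hab
  exact h a ha.1 b hb.1 hab ha.2 hb.2

open scoped Classical in
theorem card_filter_le_two {p : V → Prop} {s : Finset V}
    (h : ∀ a ∈ s, ∀ b ∈ s, ∀ c ∈ s, a ≠ b → a ≠ c → b ≠ c → p a → p b → p c → False) :
    #{x ∈ s | p x} ≤ 2 := by
  by_contra! hcon
  obtain ⟨a, ha, b, hb, c, hc, h1, h2, h3⟩ := exists_three hcon
  rw [Finset.mem_filter] at ha hb hc
  exact h a ha.1 b hb.1 c hc.1 h1 h2 h3 ha.2 hb.2 hc.2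

end Counting

namespace FanFreePair

variable {V : Type*} {B R : SimpleGraph V}

open scoped Classical in
theorem card_add_card (h : FanFreePair B R) {s : Finset V} {v : V} (hv : v ∉ s) :
    #{w ∈ s | B.Adj v w} + #{w ∈ s | R.Adj v w} = #s := by
  rw [← Finset.card_filter_add_card_filter_not (s := s) (fun w => B.Adj v w)]
  congr 2
  ext w
  simp only [Finset.mem_filter, and_congr_right_iff]
  exact fun hw => ⟨fun hr hb => h.disj hb hr,
    fun hb => (h.total (x := v) (by rintro rfl; exact hv hw)).resolve_left hb⟩

set_option maxHeartbeats 1000000 in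
open scoped Classical in
-- The `R`-components of `s` are paths and cycles with at least two vertices. Three odd ones would
-- need nine vertices, so just one is odd and `s` has three disjoint `R`-edges, the blades of a fan
-- at `v`. The proof fixes one edge `ab` and checks the other five vertices.
theorem false_of_seven (h : FanFreePair B R) {v : V} {s : Finset V} (hs : #s = 7)
    (hd : MaxDegTwo R s) (hvs : ∀ w ∈ s, R.Adj v w) (hmin : ∀ w ∈ s, ∃ u ∈ s, R.Adj w u) :
    False := by
  obtain ⟨a, ha⟩ := Finset.card_pos.1 (by omega : 0 < #s)
  obtain ⟨b, hb, hab⟩ := hmin a ha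
  set t := (s.erase a).erase b with ht
  have hts : #t = 5 := by
    rw [ht, Finset.card_erase_of_mem (Finset.mem_erase.2 ⟨hab.ne', hb⟩),
      Finset.card_erase_of_mem ha]; omega
  have hmt : ∀ x, x ∈ t ↔ x ≠ b ∧ x ≠ a ∧ x ∈ s := by simp [ht]
  have hat : ∀ x ∈ t, ∀ y ∈ t, x ≠ y → R.Adj a x → R.Adj a y → False := fun x hx y hy hxy h1 h2 =>
    hd a ha b hb x ((hmt x).1 hx).2.2 y ((hmt y).1 hy).2.2 ((hmt x).1 hx).1.symm
      ((hmt y).1 hy).1.symm hxy hab h1 h2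
  have hbt : ∀ x ∈ t, ∀ y ∈ t, x ≠ y → R.Adj b x → R.Adj b y → False := fun x hx y hy hxy h1 h2 =>
    hd b hb a ha x ((hmt x).1 hx).2.2 y ((hmt y).1 hy).2.2 ((hmt x).1 hx).2.1.symm
      ((hmt y).1 hy).2.1.symm hxy hab.symm h1 h2
  have hm : ∀ x ∈ t, ∀ y ∈ t, ∀ z ∈ t, ∀ w ∈ t, x ≠ z → x ≠ w → y ≠ z → y ≠ w →
      R.Adj x y → R.Adj z w → False := by
    intro x hx y hy z hz w hw h1 h2 h3 h4 h5 h6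
    rw [hmt] at hx hy hz hw
    exact h.fanR v a b x y z w ⟨⟨hvs a ha, hvs b hb, hvs x hx.2.2, hvs y hy.2.2, hvs z hz.2.2,
      hvs w hw.2.2⟩, ⟨hab, h5, h6⟩, ⟨hx.2.1.symm, hy.2.1.symm, hx.1.symm, hy.1.symm⟩,
      ⟨hz.2.1.symm, hw.2.1.symm, hz.1.symm, hw.1.symm⟩, ⟨h1, h2, h3, h4⟩⟩
  have hm' : ∀ f ∈ t, ∀ g ∈ t, ∀ x ∈ t, ∀ y ∈ t, x ≠ f → x ≠ g → y ≠ f → y ≠ g → f ≠ g →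
      R.Adj a f → R.Adj b g → R.Adj x y → False := by
    intro f hf g hg x hx y hy h1 h2 h3 h4 hfg h5 h6 h7
    rw [hmt] at hf hg hx hy
    exact h.fanR v a f b g x y ⟨⟨hvs a ha, hvs f hf.2.2, hvs b hb, hvs g hg.2.2, hvs x hx.2.2,
      hvs y hy.2.2⟩, ⟨h5, h6, h7⟩, ⟨hab.ne, hg.2.1.symm, hf.1, hfg⟩,
      ⟨hx.2.1.symm, hy.2.1.symm, h1.symm, h3.symm⟩, ⟨hx.1.symm, hy.1.symm, h2.symm, h4.symm⟩⟩
  -- Besides each other, `a` and `b` have at most one `R`-neighbour each, so three of the five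
  -- vertices of `t` see neither.
  have h3 : 3 ≤ #{x ∈ t | ¬ R.Adj a x ∧ ¬ R.Adj b x} := by
    have h1 := card_filter_le_one hat
    have h2 := card_filter_le_one hbt
    have h3 : t ⊆ ({x ∈ t | R.Adj a x} ∪ {x ∈ t | R.Adj b x}) ∪
        {x ∈ t | ¬ R.Adj a x ∧ ¬ R.Adj b x} := by
      intro x hx
      simp only [Finset.mem_union, Finset.mem_filter]
      tauto
    have h4 := (Finset.card_le_card h3).trans (Finset.card_union_le _ _)
    have h5 := Finset.card_union_le {x ∈ t | R.Adj a x} {x ∈ t | R.Adj b x}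
    omega
  obtain ⟨x, hx, y, hy, z, hz, hxy, hxz, hyz⟩ := exists_three h3
  rw [Finset.mem_filter] at hx hy hz
  obtain ⟨f, hf, g, hg, hfg⟩ := Finset.one_lt_card.1
    (by
      rw [Finset.card_erase_of_mem, Finset.card_erase_of_mem, Finset.card_erase_of_mem] <;> grind :
      1 < #(((t.erase x).erase y).erase z))
  simp only [Finset.mem_erase] at hf hg
  have htt : t = {x, y, z, f, g} := by
    symm
    apply Finset.eq_of_subset_of_card_le
    · intro u hu
      simp only [Finset.mem_insert, Finset.mem_singleton] at hu
      rcases hu with rfl | rfl | rfl | rfl | rfl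
      exacts [hx.1, hy.1, hz.1, hf.2.2.2, hg.2.2.2]
    · rw [hts, Finset.card_insert_of_notMem, Finset.card_insert_of_notMem,
        Finset.card_insert_of_notMem, Finset.card_pair hfg] <;>
      simp only [Finset.mem_insert, Finset.mem_singleton] <;> clear * - hxy hxz hyz hf hg <;> tauto
  have hmin' : ∀ w ∈ t, R.Adj w a ∨ R.Adj w b ∨ R.Adj w x ∨ R.Adj w y ∨ R.Adj w z ∨
      R.Adj w f ∨ R.Adj w g := by
    intro w hw
    obtain ⟨u, hu, hwu⟩ := hmin w ((hmt w).1 hw).2.2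
    rcases eq_or_ne u a with rfl | hua
    · exact Or.inl hwu
    rcases eq_or_ne u b with rfl | hub
    · exact Or.inr (Or.inl hwu)
    have : u ∈ t := (hmt u).2 ⟨hub, hua, hu⟩
    rw [htt] at this
    simp only [Finset.mem_insert, Finset.mem_singleton] at this
    rcases this with rfl | rfl | rfl | rfl | rfl
    exacts [.inr (.inr (.inl hwu)), .inr (.inr (.inr (.inl hwu))), .inr (.inr (.inr (.inr (.inl hwu)))),
      .inr (.inr (.inr (.inr (.inr (.inl hwu))))), .inr (.inr (.inr (.inr (.inr (.inr hwu)))))]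
  have mx := hmin' x hx.1
  have my := hmin' y hy.1
  have mz := hmin' z hz.1
  have mf := hmin' f hf.2.2.2
  have mg := hmin' g hg.2.2.2
  have hf' := hf.2.2.2
  have hg' := hg.2.2.2
  have hds : ∀ p ∈ t, ∀ q ∈ t, ∀ r ∈ t, ∀ u ∈ t, q ≠ r → q ≠ u → r ≠ u →
      R.Adj p q → R.Adj p r → ¬ R.Adj p u := fun p hp q hq r hr u hu h1 h2 h3 h4 h5 h6 =>
    hd p ((hmt p).1 hp).2.2 q ((hmt q).1 hq).2.2 r ((hmt r).1 hr).2.2 u ((hmt u).1 hu).2.2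
      h1 h2 h3 h4 h5 h6
  have dx1 := hds x hx.1 y hy.1 z hz.1 f hf' hyz hf.2.1.symm hf.1.symm
  have dx2 := hds x hx.1 y hy.1 z hz.1 g hg' hyz hg.2.1.symm hg.1.symm
  have dy1 := hds y hy.1 x hx.1 z hz.1 f hf' hxz hf.2.2.1.symm hf.1.symm
  have dy2 := hds y hy.1 x hx.1 z hz.1 g hg' hxz hg.2.2.1.symm hg.1.symm
  have dz1 := hds z hz.1 x hx.1 y hy.1 f hf' hxy hf.2.2.1.symm hf.2.1.symm
  have dz2 := hds z hz.1 x hx.1 y hy.1 g hg' hxy hg.2.2.1.symm hg.2.1.symm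
  have df := hds f hf' x hx.1 y hy.1 z hz.1 hxy hxz hyz
  have dg := hds g hg' x hx.1 y hy.1 z hz.1 hxy hxz hyz
  have e1 := hat f hf' g hg' hfg
  have e2 := hbt f hf' g hg' hfg
  have e3 : ¬ (R.Adj a f ∧ R.Adj b g ∧ (R.Adj x y ∨ R.Adj x z ∨ R.Adj y z)) := by
    rintro ⟨h1, h2, h3 | h3 | h3⟩
    · exact hm' f hf' g hg' x hx.1 y hy.1 (by grind) (by grind) (by grind) (by grind) hfg h1 h2 h3
    · exact hm' f hf' g hg' x hx.1 z hz.1 (by grind) (by grind) (by grind) (by grind) hfg h1 h2 h3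
    · exact hm' f hf' g hg' y hy.1 z hz.1 (by grind) (by grind) (by grind) (by grind) hfg h1 h2 h3
  have e4 : ¬ (R.Adj a g ∧ R.Adj b f ∧ (R.Adj x y ∨ R.Adj x z ∨ R.Adj y z)) := by
    rintro ⟨h1, h2, h3 | h3 | h3⟩
    · exact hm' g hg' f hf' x hx.1 y hy.1 (by grind) (by grind) (by grind) (by grind) hfg.symm h1 h2 h3
    · exact hm' g hg' f hf' x hx.1 z hz.1 (by grind) (by grind) (by grind) (by grind) hfg.symm h1 h2 h3
    · exact hm' g hg' f hf' y hy.1 z hz.1 (by grind) (by grind) (by grind) (by grind) hfg.symm h1 h2 h3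
  have m : ∀ p ∈ t, ∀ q ∈ t, ∀ r ∈ t, ∀ u ∈ t, p ≠ r → p ≠ u → q ≠ r → q ≠ u →
      (R.Adj p q → ¬ R.Adj r u) := fun p hp q hq r hr u hu h1 h2 h3 h4 h5 h6 =>
    hm p hp q hq r hr u hu h1 h2 h3 h4 h5 h6
  have hxf := hf.2.2.1.symm
  have hyf := hf.2.1.symm
  have hzf := hf.1.symm
  have hxg := hg.2.2.1.symm
  have hyg := hg.2.1.symm
  have hzg := hg.1.symm
  have m1 := m x hx.1 y hy.1 z hz.1 f hf' hxz hxf hyz hyf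
  have m2 := m x hx.1 y hy.1 z hz.1 g hg' hxz hxg hyz hyg
  have m3 := m x hx.1 y hy.1 f hf' g hg' hxf hxg hyf hyg
  have m4 := m x hx.1 z hz.1 y hy.1 f hf' hxy hxf hyz.symm hzf
  have m5 := m x hx.1 z hz.1 y hy.1 g hg' hxy hxg hyz.symm hzg
  have m6 := m x hx.1 z hz.1 f hf' g hg' hxf hxg hzf hzg
  have m7 := m y hy.1 z hz.1 x hx.1 f hf' hxy.symm hyf hxz.symm hzf
  have m8 := m y hy.1 z hz.1 x hx.1 g hg' hxy.symm hyg hxz.symm hzg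
  have m9 := m y hy.1 z hz.1 f hf' g hg' hyf hyg hzf hzg
  have m10 := m x hx.1 f hf' y hy.1 g hg' hxy hxg hyf.symm hfg
  have m11 := m x hx.1 f hf' z hz.1 g hg' hxz hxg hzf.symm hfg
  have m12 := m y hy.1 f hf' x hx.1 g hg' hxy.symm hyg hxf.symm hfg
  have m13 := m y hy.1 f hf' z hz.1 g hg' hyz hyg hzf.symm hfg
  have m14 := m z hz.1 f hf' x hx.1 g hg' hxz.symm hzg hxf.symm hfg
  have m15 := m z hz.1 f hf' y hy.1 g hg' hyz.symm hzg hyf.symm hfg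
  clear hds m hm hm' hmin hmin' htt hat hbt hvs hd hmt h3
  have := hx.2
  have := hy.2
  have := hz.2
  -- With every pair written in one order, a purely propositional problem about seven named vertices
  -- remains.
  simp only [SimpleGraph.irrefl, false_or, or_false, R.adj_comm x a, R.adj_comm x b, R.adj_comm y a,
    R.adj_comm y b, R.adj_comm z a, R.adj_comm z b, R.adj_comm f a, R.adj_comm f b, R.adj_comm g a,
    R.adj_comm g b, R.adj_comm y x, R.adj_comm z x, R.adj_comm z y, R.adj_comm f x, R.adj_comm f y,
    R.adj_comm f z, R.adj_comm g x, R.adj_comm g y, R.adj_comm g z, R.adj_comm g f]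
    at mx my mz mf mg df dg dy1 dy2 dz1 dz2
  clear hfg hxf hyf hzf hxg hyg hzg hxy hxz hyz hf hg hf' hg' hx hy hz ht hts hs ha hb h t
  grind

end FanFreePair

/-! ### No monochromatic clique of order six. -/

namespace FanFreePair

variable {V : Type*} {B R : SimpleGraph V}

open scoped Classical in
/-- Three vertices of `t` adjacent to `u` in `R`, matched into a set on which each has few
`B`-neighbours, yield a fan at `u`. -/
theorem false_of_matching_into (h : FanFreePair B R) {u w₁ w₂ w₃ : V} {s₁ s₂ s₃ : Finset V}
    (h₁ : R.Adj u w₁) (h₂ : R.Adj u w₂) (h₃ : R.Adj u w₃)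
    (h₁₂ : w₁ ≠ w₂) (h₁₃ : w₁ ≠ w₃) (h₂₃ : w₂ ≠ w₃)
    (hs₁ : ∀ x ∈ s₁, R.Adj u x ∧ R.Adj w₁ x ∧ x ≠ w₂ ∧ x ≠ w₃)
    (hs₂ : ∀ x ∈ s₂, R.Adj u x ∧ R.Adj w₂ x ∧ x ≠ w₁ ∧ x ≠ w₃)
    (hs₃ : ∀ x ∈ s₃, R.Adj u x ∧ R.Adj w₃ x ∧ x ≠ w₁ ∧ x ≠ w₂)
    (c₁ : 1 ≤ #s₁) (c₂ : 2 ≤ #s₂) (c₃ : 3 ≤ #s₃) : False := by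
  obtain ⟨a, ha, b, hb, c, hc, hab, hac, hbc⟩ := exists_distinct_representatives c₁ c₂ c₃
  have ha' := hs₁ a ha
  have hb' := hs₂ b hb
  have hc' := hs₃ c hc
  exact h.fanR u w₁ a w₂ b w₃ c ⟨⟨h₁, ha'.1, h₂, hb'.1, h₃, hc'.1⟩, ⟨ha'.2.1, hb'.2.1, hc'.2.1⟩,
    ⟨h₁₂, hb'.2.2.1.symm, ha'.2.2.1, hab⟩, ⟨h₁₃, hc'.2.2.1.symm, ha'.2.2.2, hac⟩,
    ⟨h₂₃, hc'.2.2.2.symm, hb'.2.2.2, hbc⟩⟩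

open scoped Classical in
-- An outer vertex with two `B`-neighbours in the clique gives a fan, so any two outer vertices have
-- four common `R`-neighbours in it. Matching into these bounds the outer `R`-degrees by two from
-- above; `false_of_six` bounds them by two from below. A clique vertex with seven outer
-- `R`-neighbours then contradicts `false_of_seven`.
theorem cliqueFree_six [Fintype V] (hV : Fintype.card V = 14) (h : FanFreePair B R) :
    B.CliqueFree 6 := by
  rintro s ⟨hs, hcard⟩
  have hB : ∀ x ∈ s, ∀ y ∈ s, x ≠ y → B.Adj x y := fun x hx y hy => hs hx hy
  have hout : ∀ u ∉ s, ∀ x ∈ s, ∀ y ∈ s, x ≠ y → B.Adj u x → B.Adj u y → False := by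
    intro u hu x hx y hy hxy hux huy
    obtain ⟨a, ha, b, hb, c, hc, d, hd, h1, h2, h3, h4, h5, h6⟩ :=
      exists_four (s := (s.erase x).erase y) (by
        rw [Finset.card_erase_of_mem (Finset.mem_erase.2 ⟨hxy.symm, hy⟩),
          Finset.card_erase_of_mem hx]; omega)
    simp only [Finset.mem_erase] at ha hb hc hd
    have hne : ∀ z ∈ s, u ≠ z := fun z hz huz => hu (huz ▸ hz)
    exact h.fanB x u y a b c d ⟨⟨hux.symm, hB x hx y hy hxy, hB x hx a ha.2.2 ha.2.1.symm,
      hB x hx b hb.2.2 hb.2.1.symm, hB x hx c hc.2.2 hc.2.1.symm, hB x hx d hd.2.2 hd.2.1.symm⟩,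
      ⟨huy, hB a ha.2.2 b hb.2.2 h1, hB c hc.2.2 d hd.2.2 h6⟩,
      ⟨hne a ha.2.2, hne b hb.2.2, ha.1.symm, hb.1.symm⟩,
      ⟨hne c hc.2.2, hne d hd.2.2, hc.1.symm, hd.1.symm⟩, ⟨h2, h4, h3, h5⟩⟩
  have hone : ∀ u ∉ s, #{x ∈ s | B.Adj u x} ≤ 1 := fun u hu => card_filter_le_one (hout u hu)
  have hred : ∀ u ∉ s, 5 ≤ #{x ∈ s | R.Adj u x} := fun u hu => by
    have := h.card_add_card hu; have := hone u hu; omega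
  have hred₂ : ∀ u ∉ s, ∀ w ∉ s, 4 ≤ #{x ∈ s | R.Adj u x ∧ R.Adj w x} := fun u hu w hw => by
    have h1 := hred u hu
    have h2 := hred w hw
    have h3 := Finset.card_union_add_card_inter {x ∈ s | R.Adj u x} {x ∈ s | R.Adj w x}
    have h4 : #({x ∈ s | R.Adj u x} ∪ {x ∈ s | R.Adj w x}) ≤ #s := Finset.card_le_card
      (Finset.union_subset (Finset.filter_subset _ _) (Finset.filter_subset _ _))
    rw [← Finset.filter_and] at h3
    omega
  have hmax : MaxDegTwo R sᶜ := by
    intro u hu a ha b hb c hc h1 h2 h3 h4 h5 h6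
    rw [Finset.mem_compl] at hu ha hb hc
    have := hred₂ u hu a ha
    have := hred₂ u hu b hb
    have := hred₂ u hu c hc
    refine h.false_of_matching_into h4 h5 h6 h1 h2 h3 (s₁ := {x ∈ s | R.Adj u x ∧ R.Adj a x})
      (s₂ := {x ∈ s | R.Adj u x ∧ R.Adj b x}) (s₃ := {x ∈ s | R.Adj u x ∧ R.Adj c x})
      ?_ ?_ ?_ (by omega) (by omega) (by omega) <;>
    · intro x hx
      rw [Finset.mem_filter] at hx
      exact ⟨hx.2.1, hx.2.2, by rintro rfl; exact absurd hx.1 ‹_›, by rintro rfl; exact absurd hx.1 ‹_›⟩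
  have hscard : #sᶜ = 8 := by rw [Finset.card_compl, hcard, hV]
  have htwo : ∀ u ∈ sᶜ, 2 ≤ #{w ∈ sᶜ | R.Adj u w} := by
    intro u hu
    by_contra! hlt
    have h1 := h.card_add_card (s := sᶜ.erase u) (v := u) (by simp)
    rw [Finset.card_erase_of_mem hu] at h1
    have h2 : #{w ∈ sᶜ.erase u | R.Adj u w} ≤ #{w ∈ sᶜ | R.Adj u w} :=
      Finset.card_le_card (Finset.filter_subset_filter _ (Finset.erase_subset _ _))
    refine h.false_of_six (v := u) (s := {w ∈ sᶜ.erase u | B.Adj u w}) (by omega)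
      (hmax.mono ?_) fun w hw => (Finset.mem_filter.1 hw).2
    exact (Finset.filter_subset _ _).trans (Finset.erase_subset _ _)
  -- Otherwise at least twelve `B`-edges leave the clique, but each of the eight outer vertices
  -- receives at most one.
  obtain ⟨x, hx, hx1⟩ : ∃ x ∈ s, #{u ∈ sᶜ | B.Adj x u} ≤ 1 := by
    by_contra! hcon
    have h1 := Finset.sum_card_bipartiteAbove_eq_sum_card_bipartiteBelow (s := s) (t := sᶜ) B.Adj
    have h2 : #s * 2 ≤ ∑ a ∈ s, #(Finset.bipartiteAbove B.Adj sᶜ a) :=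
      Finset.card_nsmul_le_sum s _ 2 fun a ha => hcon a ha
    have h3 : ∑ b ∈ sᶜ, #(Finset.bipartiteBelow B.Adj s b) ≤ #sᶜ * 1 := by
      refine Finset.sum_le_card_nsmul _ _ _ fun b hb => ?_
      simp only [Finset.bipartiteBelow, B.adj_comm _ b]
      exact hone b (Finset.mem_compl.1 hb)
    omega
  have h7 := h.card_add_card (s := sᶜ) (v := x) (by simpa using hx)
  obtain ⟨t, ht, htc⟩ := Finset.exists_subset_card_eq (s := {u ∈ sᶜ | R.Adj x u}) (n := 7)
    (by omega)
  have hts : t ⊆ sᶜ := ht.trans (Finset.filter_subset _ _)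
  refine h.false_of_seven htc (hmax.mono hts) (fun w hw => (Finset.mem_filter.1 (ht hw)).2) ?_
  -- Only one outer vertex is missing from `t`, so one of the two outer `R`-neighbours of `w` lies
  -- in `t`.
  intro w hw
  have h8 := htwo w (hts hw)
  have h9 := Finset.card_sdiff_add_card_eq_card hts
  obtain ⟨u, hu, hut⟩ := Finset.exists_mem_notMem_of_card_lt_card (s := sᶜ \ t)
    (t := {u ∈ sᶜ | R.Adj w u}) (by omega)
  rw [Finset.mem_filter] at hu
  rw [Finset.mem_sdiff, not_and_not_right] at hut
  exact ⟨u, hut hu.1, hu.2⟩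

end FanFreePair

/-! ### Sets without three disjoint `R`-edges. -/

namespace FanFreePair

variable {V : Type*} {B R : SimpleGraph V}

/-- No three disjoint edges of `G` inside `A`. -/
def NoThreeMatching (G : SimpleGraph V) (A : Finset V) : Prop :=
  ∀ p ∈ A, ∀ q ∈ A, ∀ r ∈ A, ∀ u ∈ A, ∀ k ∈ A, ∀ l ∈ A, G.Adj p q → G.Adj r u → G.Adj k l →
    p ≠ r → p ≠ u → q ≠ r → q ≠ u → p ≠ k → p ≠ l → q ≠ k → q ≠ l →
    r ≠ k → r ≠ l → u ≠ k → u ≠ l → False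

/-- A set `A` without three disjoint `R`-edges contains a large `B`-clique, or an `R`-triangle
completely `B`-joined to a large `B`-clique, or five vertices completely `B`-joined to a
`B`-clique. -/
def HasLargeJoin (B R : SimpleGraph V) (A : Finset V) : Prop :=
  (∃ s ⊆ A, B.IsClique s ∧ #s + 2 = #A) ∨
  (∃ a ∈ A, ∃ b ∈ A, ∃ c ∈ A, R.Adj a b ∧ R.Adj a c ∧ R.Adj b c ∧ ∃ s ⊆ A, B.IsClique s ∧
    #s + 4 = #A ∧ ∀ x ∈ s, B.Adj a x ∧ B.Adj b x ∧ B.Adj c x) ∨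
  (∃ t ⊆ A, #t = 5 ∧ ∃ s ⊆ A, B.IsClique s ∧ #s + 5 = #A ∧ ∀ x ∈ s, ∀ y ∈ t, B.Adj x y)

/-- Two disjoint `R`-edges `ab`, `de` of `A` and the `B`-clique `s` of all other vertices. -/
structure TwoMatching (B R : SimpleGraph V) (A s : Finset V) (a b d e : V) : Prop where
  noThree : NoThreeMatching R A
  sub : s ⊆ A
  card : #s + 4 = #A
  clique : ∀ x ∈ s, ∀ y ∈ s, x ≠ y → B.Adj x y
  ha : a ∈ A
  hb : b ∈ A
  hd : d ∈ A
  he : e ∈ A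
  ha' : a ∉ s
  hb' : b ∉ s
  hd' : d ∉ s
  he' : e ∉ s
  had : a ≠ d
  hae : a ≠ e
  hbd : b ≠ d
  hbe : b ≠ e
  hab : R.Adj a b
  hde : R.Adj d e

namespace TwoMatching

variable {A s : Finset V} {a b d e : V}

theorem swap_left (m : TwoMatching B R A s a b d e) : TwoMatching B R A s b a d e :=
  { m with ha := m.hb, hb := m.ha, ha' := m.hb', hb' := m.ha', had := m.hbd, hae := m.hbe,
           hbd := m.had, hbe := m.hae, hab := m.hab.symm }

theorem swap (m : TwoMatching B R A s a b d e) : TwoMatching B R A s d e a b :=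
  { m with ha := m.hd, hb := m.he, hd := m.ha, he := m.hb, ha' := m.hd', hb' := m.he',
           hd' := m.ha', he' := m.hb', had := m.had.symm, hae := m.hbd.symm, hbd := m.hae.symm,
           hbe := m.hbe.symm, hab := m.hde, hde := m.hab }

theorem swap_right (m : TwoMatching B R A s a b d e) : TwoMatching B R A s a b e d :=
  m.swap.swap_left.swap

/-- The path `x a b y` would augment the matching `ab`, `de`. -/
theorem no_augment (m : TwoMatching B R A s a b d e) {x y : V} (hx : x ∈ s) (hy : y ∈ s)
    (hxy : x ≠ y) (hax : R.Adj a x) (hby : R.Adj b y) : False := by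
  have := m.ha'; have := m.hb'; have := m.hd'; have := m.he'
  refine m.noThree a m.ha x (m.sub hx) b m.hb y (m.sub hy) d m.hd e m.he hax hby m.hde
    m.hab.ne ?_ ?_ hxy m.had m.hae ?_ ?_ m.hbd m.hbe ?_ ?_ <;>
  rintro rfl <;> contradiction

/-- The path `x a b e d y` would augment the matching. -/
theorem no_long_augment (m : TwoMatching B R A s a b d e) {x y : V} (hx : x ∈ s) (hy : y ∈ s)
    (hxy : x ≠ y) (hax : R.Adj a x) (hdy : R.Adj d y) (hbe : R.Adj b e) : False := by
  have := m.ha'; have := m.hb'; have := m.hd'; have := m.he'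
  refine m.noThree a m.ha x (m.sub hx) d m.hd y (m.sub hy) b m.hb e m.he hax hdy hbe
    m.had ?_ ?_ hxy m.hab.ne m.hae ?_ ?_ m.hbd.symm m.hde.ne ?_ ?_ <;>
  rintro rfl <;> contradiction

theorem cases_left (m : TwoMatching B R A s a b d e) :
    (∀ w ∈ s, ¬ R.Adj b w) ∨ (∀ w ∈ s, ¬ R.Adj a w) ∨
    ∃ x ∈ s, R.Adj a x ∧ R.Adj b x ∧ ∀ w ∈ s, w ≠ x → ¬ R.Adj a w ∧ ¬ R.Adj b w := by
  by_contra! hcon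
  obtain ⟨⟨y, hy, hby⟩, ⟨x, hx, hax⟩, h⟩ := hcon
  have hyx : x = y := by
    by_contra hne
    exact m.no_augment hx hy hne hax hby
  subst hyx
  obtain ⟨w, hw, hwx, hR⟩ := h x hx hax hby
  by_cases haw : R.Adj a w
  · exact m.no_augment hw hx hwx haw hby
  · exact m.no_augment hx hw hwx.symm hax (hR haw)

open scoped Classical in
theorem large_clique (h : FanFreePair B R) (m : TwoMatching B R A s a b d e)
    (hb : ∀ w ∈ s, ¬ R.Adj b w) (he : ∀ w ∈ s, ¬ R.Adj e w) (hbe : B.Adj b e) :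
    HasLargeJoin B R A := by
  left
  have hbs : ∀ w ∈ s, B.Adj b w := fun w hw =>
    (h.total (by rintro rfl; exact m.hb' hw)).resolve_right (hb w hw)
  have hes : ∀ w ∈ s, B.Adj e w := fun w hw =>
    (h.total (by rintro rfl; exact m.he' hw)).resolve_right (he w hw)
  refine ⟨insert b (insert e s), ?_, ?_, ?_⟩
  · simp only [Finset.insert_subset_iff]
    exact ⟨m.hb, m.he, m.sub⟩
  · rw [Finset.coe_insert, Finset.coe_insert, SimpleGraph.isClique_insert,
      SimpleGraph.isClique_insert]
    refine ⟨⟨fun x hx y hy hxy => m.clique x hx y hy hxy, fun w hw _ => hes w hw⟩, ?_⟩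
    rintro w (rfl | hw) _
    exacts [hbe, hbs w hw]
  · rw [Finset.card_insert_of_notMem, Finset.card_insert_of_notMem m.he', ← m.card]
    simp only [Finset.mem_insert, not_or]
    exact ⟨m.hbe, m.hb'⟩

open scoped Classical in
theorem five_join (h : FanFreePair B R) (m : TwoMatching B R A s a b d e) {x : V} (hx : x ∈ s)
    (hw : ∀ w ∈ s, w ≠ x → ¬ R.Adj a w ∧ ¬ R.Adj b w ∧ ¬ R.Adj d w ∧ ¬ R.Adj e w) :
    HasLargeJoin B R A := by
  right; right
  have hB : ∀ w ∈ s, w ≠ x → ∀ c, c ∉ s → ¬ R.Adj c w → B.Adj w c := fun w hws _ c hc hR =>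
    ((h.total (by rintro rfl; exact hc hws)).resolve_right hR).symm
  refine ⟨{x, a, b, d, e}, ?_, ?_, s.erase x, (Finset.erase_subset _ _).trans m.sub, ?_, ?_, ?_⟩
  · simp only [Finset.insert_subset_iff, Finset.singleton_subset_iff]
    exact ⟨m.sub hx, m.ha, m.hb, m.hd, m.he⟩
  · have h1 : ∀ c, c ∉ s → x ≠ c := by rintro c hc rfl; exact hc hx
    rw [Finset.card_insert_of_notMem, Finset.card_insert_of_notMem, Finset.card_insert_of_notMem,
      Finset.card_pair m.hde.ne] <;> simp only [Finset.mem_insert, Finset.mem_singleton, not_or]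
    · exact ⟨m.hbd, m.hbe⟩
    · exact ⟨m.hab.ne, m.had, m.hae⟩
    · exact ⟨h1 a m.ha', h1 b m.hb', h1 d m.hd', h1 e m.he'⟩
  · exact fun p hp q hq hpq => m.clique p (Finset.mem_of_mem_erase hp) q
      (Finset.mem_of_mem_erase hq) hpq
  · rw [Finset.card_erase_of_mem hx, ← m.card]
    have := Finset.card_pos.2 ⟨x, hx⟩
    omega
  · intro w hws c hc
    rw [Finset.mem_erase] at hws
    have h1 := hw w hws.2 hws.1
    simp only [Finset.mem_insert, Finset.mem_singleton] at hc
    rcases hc with rfl | rfl | rfl | rfl | rfl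
    · exact m.clique w hws.2 _ hx hws.1
    · exact hB w hws.2 hws.1 _ m.ha' h1.1
    · exact hB w hws.2 hws.1 _ m.hb' h1.2.1
    · exact hB w hws.2 hws.1 _ m.hd' h1.2.2.1
    · exact hB w hws.2 hws.1 _ m.he' h1.2.2.2

/-- If `be` is in `B`, then `b` and `e` enlarge the clique `s`. If it is in `R`, then either a third
matched vertex has no `R`-neighbour in `s`, which gives a larger clique or an `R`-triangle, or
`no_long_augment` makes `a` and `d` share their only `R`-neighbour in `s`. -/
theorem of_isolated_of_isolated (h : FanFreePair B R) (m : TwoMatching B R A s a b d e)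
    (hb : ∀ w ∈ s, ¬ R.Adj b w) (he : ∀ w ∈ s, ¬ R.Adj e w) :
    HasLargeJoin B R A := by
  rcases h.total m.hbe with hbe | hbe
  · exact m.large_clique h hb he hbe
  have tri : ∀ {a b d e : V}, TwoMatching B R A s a b d e → (∀ w ∈ s, ¬ R.Adj b w) →
      (∀ w ∈ s, ¬ R.Adj e w) → R.Adj b e → (∀ w ∈ s, ¬ R.Adj d w) → HasLargeJoin B R A := by
    intro a b d e m hb he hbe hd
    rcases h.total m.hbd with hbd | hbd
    · exact m.swap_right.large_clique h hb hd hbd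
    · refine Or.inr (Or.inl ⟨b, m.hb, d, m.hd, e, m.he, hbd, hbe, m.hde, s, m.sub,
        fun x hx y hy => m.clique x hx y hy, m.card, fun x hx => ?_⟩)
      exact ⟨(h.total (by rintro rfl; exact m.hb' hx)).resolve_right (hb x hx),
        (h.total (by rintro rfl; exact m.hd' hx)).resolve_right (hd x hx),
        (h.total (by rintro rfl; exact m.he' hx)).resolve_right (he x hx)⟩
  by_cases hd : ∀ w ∈ s, ¬ R.Adj d w
  · exact tri m hb he hbe hd
  by_cases ha : ∀ w ∈ s, ¬ R.Adj a w
  · exact tri m.swap he hb hbe.symm ha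
  push Not at ha hd
  obtain ⟨x, hx, hax⟩ := ha
  obtain ⟨y, hy, hdy⟩ := hd
  have key : ∀ x ∈ s, ∀ y ∈ s, R.Adj a x → R.Adj d y → x = y := fun x hx y hy h1 h2 => by
    by_contra hne
    exact m.no_long_augment hx hy hne h1 h2 hbe
  obtain rfl := key x hx y hy hax hdy
  exact m.five_join h hx fun w hw hwx => ⟨fun h1 => hwx (key w hw x hx h1 hdy), hb w hw,
    fun h1 => hwx (key x hx w hw hax h1).symm, he w hw⟩

open scoped Classical in
-- An `R`-neighbour of `d` in `s` other than `x` forces `B`-edges from `e` to `a` and `b`, by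
-- `no_long_augment`; then `e` can replace `x` in the clique, and `abx` is the joined triangle.
theorem of_triangle_of_isolated (h : FanFreePair B R) (m : TwoMatching B R A s a b d e) {x : V}
    (hx : x ∈ s) (hax : R.Adj a x) (hbx : R.Adj b x)
    (hab : ∀ w ∈ s, w ≠ x → ¬ R.Adj a w ∧ ¬ R.Adj b w) (he : ∀ w ∈ s, ¬ R.Adj e w) :
    HasLargeJoin B R A := by
  by_cases hd : ∀ w ∈ s, w ≠ x → ¬ R.Adj d w
  · exact m.five_join h hx fun w hw hwx =>
      ⟨(hab w hw hwx).1, (hab w hw hwx).2, hd w hw hwx, he w hw⟩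
  push Not at hd
  obtain ⟨y, hy, hyx, hdy⟩ := hd
  have hea : B.Adj e a := (h.total m.hae.symm).resolve_right fun h1 =>
    m.swap_left.no_long_augment hx hy hyx.symm hbx hdy h1.symm
  have heb : B.Adj e b := (h.total m.hbe.symm).resolve_right fun h1 =>
    m.no_long_augment hx hy hyx.symm hax hdy h1.symm
  have hB : ∀ w ∈ s, ∀ c, c ∉ s → ¬ R.Adj c w → B.Adj c w := fun w hws c hc hR =>
    (h.total (by rintro rfl; exact hc hws)).resolve_right hR
  refine Or.inr (Or.inl ⟨a, m.ha, b, m.hb, x, m.sub hx, m.hab, hax, hbx, insert e (s.erase x),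
    ?_, ?_, ?_, ?_⟩)
  · exact Finset.insert_subset_iff.2 ⟨m.he, (Finset.erase_subset _ _).trans m.sub⟩
  · rw [Finset.coe_insert, SimpleGraph.isClique_insert]
    refine ⟨fun p hp q hq hpq => m.clique p (Finset.mem_of_mem_erase hp) q
      (Finset.mem_of_mem_erase hq) hpq, fun w hw _ => ?_⟩
    have hw' := Finset.mem_of_mem_erase (Finset.mem_coe.1 hw)
    exact hB w hw' e m.he' (he w hw')
  · rw [Finset.card_insert_of_notMem fun hc => m.he' (Finset.mem_of_mem_erase hc),
      Finset.card_erase_of_mem hx, ← m.card]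
    have := Finset.card_pos.2 ⟨x, hx⟩
    omega
  · intro w hw
    rw [Finset.mem_insert, Finset.mem_erase] at hw
    rcases hw with rfl | ⟨hwx, hw⟩
    · exact ⟨hea.symm, heb.symm, (hB x hx _ m.he' (he x hx)).symm⟩
    · exact ⟨hB w hw a m.ha' (hab w hw hwx).1, hB w hw b m.hb' (hab w hw hwx).2,
        m.clique x hx w hw hwx.symm⟩

/-- Two separate `R`-triangles `abx` and `dey` have matching number two without fitting any
alternative of `HasLargeJoin`. They are excluded by a third clique vertex `z`, the centre of a
`B`-fan with blades `ae`, `by`, `xd`. -/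
theorem of_triangle_of_triangle (h : FanFreePair B R) (m : TwoMatching B R A s a b d e) {x y : V}
    (hx : x ∈ s) (hbx : R.Adj b x)
    (hab : ∀ w ∈ s, w ≠ x → ¬ R.Adj a w ∧ ¬ R.Adj b w)
    (hy : y ∈ s) (hdy : R.Adj d y) (hey : R.Adj e y)
    (hde : ∀ w ∈ s, w ≠ y → ¬ R.Adj d w ∧ ¬ R.Adj e w) (hs : 3 ≤ #s) :
    HasLargeJoin B R A := by
  classical
  rcases eq_or_ne x y with rfl | hxy
  · exact m.five_join h hx fun w hw hwx =>
      ⟨(hab w hw hwx).1, (hab w hw hwx).2, (hde w hw hwx).1, (hde w hw hwx).2⟩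
  exfalso
  obtain ⟨z, hz, hz'⟩ := Finset.exists_mem_notMem_of_card_lt_card (s := {x, y}) (t := s)
    (lt_of_le_of_lt Finset.card_le_two hs)
  simp only [Finset.mem_insert, Finset.mem_singleton, not_or] at hz'
  have hB : ∀ w ∈ s, ∀ c, c ∉ s → ¬ R.Adj c w → B.Adj w c := fun w hws c hc hR =>
    ((h.total (by rintro rfl; exact hc hws)).resolve_right hR).symm
  have hae : B.Adj a e := (h.total m.hae).resolve_right fun h1 =>
    m.swap_left.no_long_augment hx hy hxy hbx hdy h1
  have hxd : B.Adj x d := hB x hx d m.hd' (hde x hx hxy).1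
  have hby : B.Adj b y := (hB y hy b m.hb' (hab y hy hxy.symm).2).symm
  have hne : ∀ w ∈ s, ∀ c, c ∉ s → w ≠ c := by rintro w hw c hc rfl; exact hc hw
  exact h.fanB z a e b y x d ⟨⟨hB z hz a m.ha' (hab z hz hz'.1).1,
    hB z hz e m.he' (hde z hz hz'.2).2, hB z hz b m.hb' (hab z hz hz'.1).2,
    m.clique z hz y hy hz'.2, m.clique z hz x hx hz'.1, hB z hz d m.hd' (hde z hz hz'.2).1⟩,
    ⟨hae, hby, hxd⟩,
    ⟨m.hab.ne, (hne y hy a m.ha').symm, m.hbe.symm, (hne y hy e m.he').symm⟩,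
    ⟨(hne x hx a m.ha').symm, m.had, (hne x hx e m.he').symm, m.hde.ne'⟩,
    ⟨(hne x hx b m.hb').symm, m.hbd, hxy.symm, hne y hy d m.hd'⟩⟩

theorem hasLargeJoin (h : FanFreePair B R) (m : TwoMatching B R A s a b d e) (hs : 3 ≤ #s) :
    HasLargeJoin B R A := by
  rcases m.cases_left with h1 | h1 | ⟨x, hx, h1, h2, h3⟩ <;>
    rcases m.swap.cases_left with h1' | h1' | ⟨y, hy, h1', h2', h3'⟩
  · exact m.of_isolated_of_isolated h h1 h1'
  · exact m.swap_right.of_isolated_of_isolated h h1 h1'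
  · exact m.swap.of_triangle_of_isolated h hy h1' h2' h3' h1
  · exact m.swap_left.of_isolated_of_isolated h h1 h1'
  · exact m.swap_left.swap_right.of_isolated_of_isolated h h1 h1'
  · exact m.swap_left.swap.of_triangle_of_isolated h hy h1' h2' h3' h1
  · exact m.of_triangle_of_isolated h hx h1 h2 h3 h1'
  · exact m.swap_right.of_triangle_of_isolated h hx h1 h2 h3 h1'
  · exact m.of_triangle_of_triangle h hx h2 h3 hy h1' h2' h3' hs

end TwoMatching

open scoped Classical in
-- For matching number two, Tutte–Berge allows four shapes: two deleted vertices, one deleted vertex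
-- with a triangle, five special vertices, or two triangles. Fan-freeness removes the last. Seven
-- vertices guarantee the three clique vertices needed for that.
theorem hasLargeJoin (h : FanFreePair B R) {A : Finset V} (hA : NoThreeMatching R A)
    (hcard : 7 ≤ #A) : HasLargeJoin B R A := by
  by_cases h2 : ∃ a ∈ A, ∃ b ∈ A, ∃ d ∈ A, ∃ e ∈ A, R.Adj a b ∧ R.Adj d e ∧ a ≠ d ∧ a ≠ e ∧
      b ≠ d ∧ b ≠ e
  · obtain ⟨a, ha, b, hb, d, hd, e, he, hab, hde, had, hae, hbd, hbe⟩ := h2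
    have h4 : #({a, b, d, e} : Finset V) = 4 := by
      rw [Finset.card_insert_of_notMem, Finset.card_insert_of_notMem, Finset.card_pair hde.ne] <;>
        simp only [Finset.mem_insert, Finset.mem_singleton, not_or]
      · exact ⟨hbd, hbe⟩
      · exact ⟨hab.ne, had, hae⟩
    have h5 := Finset.card_sdiff_add_card_eq_card (s := {a, b, d, e}) (t := A) (by
      simp only [Finset.insert_subset_iff, Finset.singleton_subset_iff]
      exact ⟨ha, hb, hd, he⟩)
    rw [h4] at h5
    have m : TwoMatching B R A (A \ {a, b, d, e}) a b d e := by
      refine ⟨hA, Finset.sdiff_subset, h5, ?_, ha, hb, hd, he, by simp, by simp, by simp, by simp,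
        had, hae, hbd, hbe, hab, hde⟩
      intro x hx y hy hxy
      simp only [Finset.mem_sdiff, Finset.mem_insert, Finset.mem_singleton, not_or, ← ne_eq] at hx hy
      refine (h.total hxy).resolve_right fun hR => ?_
      exact hA a ha b hb d hd e he x hx.1 y hy.1 hab hde hR had hae hbd hbe hx.2.1.symm
        hy.2.1.symm hx.2.2.1.symm hy.2.2.1.symm hx.2.2.2.1.symm hy.2.2.2.1.symm hx.2.2.2.2.symm
        hy.2.2.2.2.symm
    exact m.hasLargeJoin h (by omega)
  push Not at h2
  left
  -- All `R`-edges meet a given one, so deleting its ends leaves a `B`-clique.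
  obtain ⟨a, ha, b, hb, hab, hc⟩ : ∃ a ∈ A, ∃ b ∈ A, a ≠ b ∧
      ∀ x ∈ A, ∀ y ∈ A, x ≠ a → x ≠ b → y ≠ a → y ≠ b → ¬ R.Adj x y := by
    by_cases h1 : ∃ a ∈ A, ∃ b ∈ A, R.Adj a b
    · obtain ⟨a, ha, b, hb, hab⟩ := h1
      refine ⟨a, ha, b, hb, hab.ne, fun x hx y hy h3 h4 h5 h6 h7 => ?_⟩
      exact h6 (h2 a ha b hb x hx y hy hab h7 h3.symm h5.symm h4.symm).symm
    · push Not at h1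
      obtain ⟨a, ha, b, hb, hab⟩ := Finset.one_lt_card.1 (by omega : 1 < #A)
      exact ⟨a, ha, b, hb, hab, fun x hx y hy _ _ _ _ => h1 x hx y hy⟩
  refine ⟨A \ {a, b}, Finset.sdiff_subset, fun x hx y hy hxy => ?_, ?_⟩
  · simp only [Finset.coe_sdiff, Set.mem_sdiff, Finset.mem_coe, Finset.mem_insert,
      Finset.mem_singleton, not_or] at hx hy
    exact (h.total hxy).resolve_right (hc x hx.1 y hy.1 hx.2.1 hx.2.2 hy.2.1 hy.2.2)
  · rw [← Finset.card_pair hab]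
    exact Finset.card_sdiff_add_card_eq_card
      (by simp only [Finset.insert_subset_iff, Finset.singleton_subset_iff]; exact ⟨ha, hb⟩)

end FanFreePair

/-! ### Degrees six and seven, and the structure of a neighbourhood of order seven. -/

namespace FanFreePair

variable {V : Type*} {B R : SimpleGraph V}

theorem noThreeMatching (h : FanFreePair B R) {A : Finset V} {v : V} (hA : ∀ w ∈ A, R.Adj v w) :
    NoThreeMatching R A :=
  fun p hp q hq r hr u hu k hk l hl h1 h2 h3 n1 n2 n3 n4 n5 n6 n7 n8 n9 n10 n11 n12 =>
    h.fanR v p q r u k l ⟨⟨hA p hp, hA q hq, hA r hr, hA u hu, hA k hk, hA l hl⟩, ⟨h1, h2, h3⟩,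
      ⟨n1, n2, n3, n4⟩, ⟨n5, n6, n7, n8⟩, ⟨n9, n10, n11, n12⟩⟩

open scoped Classical in
-- For eight neighbours, `hasLargeJoin` gives a `B`-clique of order six, or a triangle joined to a
-- four-clique and so a fan centred in that clique, or five vertices `t` joined to a `B`-triangle.
-- In the last case a `B`-edge in `t` would complete a fan centred in the `B`-triangle, so `t` and
-- `v` form an `R`-clique of order six.
theorem card_red_le_seven [Fintype V] (hV : Fintype.card V = 14) (h : FanFreePair B R) (v : V) :
    #{w | R.Adj v w} ≤ 7 := by
  by_contra! hcon
  obtain ⟨A, hA, hcard⟩ := Finset.exists_subset_card_eq hcon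
  have hvA : ∀ w ∈ A, R.Adj v w := fun w hw => (Finset.mem_filter.1 (hA hw)).2
  rcases h.hasLargeJoin (h.noThreeMatching hvA) (by omega) with ⟨s, -, hs, hc⟩ |
    ⟨a, -, b, -, c, -, hab, hac, hbc, s, -, hs, hc, hsB⟩ | ⟨t, htA, ht, s, -, hs, hc, hst⟩
  · exact h.cliqueFree_six hV s ⟨hs, by omega⟩
  · obtain ⟨x, hx, y, hy, z, hz, w, hw, h1, h2, h3, h4, h5, h6⟩ :=
      exists_four (s := s) (by omega)
    have hax := hsB x hx
    have hay := hsB y hy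
    have haz := hsB z hz
    have haw := hsB w hw
    have n1 : a ≠ z := haz.1.ne
    exact h.fanB x a y b z c w ⟨⟨hax.1.symm, hs hx hy h1, hax.2.1.symm, hs hx hz h2, hax.2.2.symm,
      hs hx hw h4⟩, ⟨hay.1, haz.2.1, haw.2.2⟩, ⟨hab.ne, haz.1.ne, hay.2.1.ne', h3⟩,
      ⟨hac.ne, haw.1.ne, hay.2.2.ne', h5⟩, ⟨hbc.ne, haw.2.1.ne, haz.2.2.ne', h6⟩⟩
  · obtain ⟨x, hx, y, hy, z, hz, h1, h2, h3⟩ := exists_three (s := s) (by omega)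
    refine h.swap.cliqueFree_six hV (insert v t) ⟨?_, ?_⟩
    · rw [Finset.coe_insert, SimpleGraph.isClique_insert]
      refine ⟨fun p hp q hq hpq => (h.total hpq).resolve_left fun hB => ?_,
        fun w hw _ => hvA w (htA hw)⟩
      rw [Finset.mem_coe] at hp hq
      obtain ⟨k, hk, l, hl, hkl⟩ := Finset.one_lt_card.1 (by
        rw [Finset.card_erase_of_mem (Finset.mem_erase.2 ⟨hpq.symm, hq⟩),
          Finset.card_erase_of_mem hp]; omega : 1 < #((t.erase p).erase q))
      simp only [Finset.mem_erase] at hk hl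
      exact h.fanB x p q y k z l ⟨⟨hst x hx p hp, hst x hx q hq, hs hx hy h1, hst x hx k hk.2.2,
        hs hx hz h2, hst x hx l hl.2.2⟩, ⟨hB, hst y hy k hk.2.2, hst z hz l hl.2.2⟩,
        ⟨(hst y hy p hp).ne', hk.2.1.symm, (hst y hy q hq).ne', hk.1.symm⟩,
        ⟨(hst z hz p hp).ne', hl.2.1.symm, (hst z hz q hq).ne', hl.1.symm⟩,
        ⟨h3, (hst y hy l hl.2.2).ne, (hst z hz k hk.2.2).ne', hkl⟩⟩
    · rw [Finset.card_insert_of_notMem fun hv => (hvA v (htA hv)).ne rfl, ht]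

open scoped Classical in
theorem card_blue_le_seven [Fintype V] (hV : Fintype.card V = 14) (h : FanFreePair B R) (v : V) :
    #{w | B.Adj v w} ≤ 7 := h.swap.card_red_le_seven hV v

open scoped Classical in
theorem card_blue_add_card_red [Fintype V] (hV : Fintype.card V = 14) (h : FanFreePair B R)
    (v : V) : #{w | B.Adj v w} + #{w | R.Adj v w} = 13 := by
  have h1 := h.card_add_card (s := Finset.univ.erase v) (v := v) (by simp)
  rw [Finset.card_erase_of_mem (Finset.mem_univ v), Finset.card_univ, hV] at h1
  have h2 : ∀ G : SimpleGraph V, {w ∈ Finset.univ.erase v | G.Adj v w} =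
      ({w | G.Adj v w} : Finset V) := by
    intro G
    ext w
    simp only [Finset.mem_filter, Finset.mem_erase, Finset.mem_univ, and_true, true_and,
      and_iff_right_iff_imp]
    exact fun hw => hw.ne'
  rwa [h2, h2] at h1

/-- An `R`-triangle completely `B`-joined to a `B`-triangle. -/
structure TriangleJoin (B R : SimpleGraph V) (t₁ t₂ t₃ q₁ q₂ q₃ : V) : Prop where
  t₁₂ : R.Adj t₁ t₂
  t₁₃ : R.Adj t₁ t₃
  t₂₃ : R.Adj t₂ t₃
  q₁₂ : B.Adj q₁ q₂
  q₁₃ : B.Adj q₁ q₃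
  q₂₃ : B.Adj q₂ q₃
  t₁q₁ : B.Adj t₁ q₁
  t₁q₂ : B.Adj t₁ q₂
  t₁q₃ : B.Adj t₁ q₃
  t₂q₁ : B.Adj t₂ q₁
  t₂q₂ : B.Adj t₂ q₂
  t₂q₃ : B.Adj t₂ q₃
  t₃q₁ : B.Adj t₃ q₁
  t₃q₂ : B.Adj t₃ q₂
  t₃q₃ : B.Adj t₃ q₃

open scoped Classical in
-- In the last alternative of `hasLargeJoin`, two disjoint `B`-edges in the five-set `t` would form
-- a fan at `p` together with `q` and the fifth vertex. So the `B`-edges of `t` form a star, whose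
-- removal leaves an `R`-clique of order four, or a triangle, which `p` and `q` extend to a
-- `B`-clique of order five.
theorem large_red_neighborhood (h : FanFreePair B R) {A : Finset V} {v : V}
    (hA : ∀ w ∈ A, R.Adj v w) (hcard : 7 ≤ #A) :
    (∃ s ⊆ A, B.IsNClique 5 s) ∨
    (∃ t ⊆ A, R.IsNClique 4 t ∧ ∃ p ∈ A, ∃ q ∈ A, B.Adj p q ∧ ∀ x ∈ t, B.Adj p x ∧ B.Adj q x) ∨
    (∃ t₁ t₂ t₃ q₁ q₂ q₃, TriangleJoin B R t₁ t₂ t₃ q₁ q₂ q₃) := by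
  obtain ⟨A', hA', hcard'⟩ := Finset.exists_subset_card_eq hcard
  have hvA : ∀ w ∈ A', R.Adj v w := fun w hw => hA w (hA' hw)
  rcases h.hasLargeJoin (h.noThreeMatching hvA) (by omega) with ⟨s, hsA, hs, hc⟩ |
    ⟨a, -, b, -, c, -, hab, hac, hbc, s, -, hs, hc, hsB⟩ | ⟨t, htA, ht, s, hsA, hs, hc, hst⟩
  · exact Or.inl ⟨s, hsA.trans hA', hs, by omega⟩
  · obtain ⟨x, hx, y, hy, z, hz, h1, h2, h3⟩ := exists_three (s := s) (by omega)
    exact Or.inr (Or.inr ⟨a, b, c, x, y, z, hab, hac, hbc, hs hx hy h1, hs hx hz h2, hs hy hz h3,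
      (hsB x hx).1, (hsB y hy).1, (hsB z hz).1, (hsB x hx).2.1, (hsB y hy).2.1, (hsB z hz).2.1,
      (hsB x hx).2.2, (hsB y hy).2.2, (hsB z hz).2.2⟩)
  obtain ⟨p, hp, q, hq, hpq⟩ := Finset.one_lt_card.1 (by omega : 1 < #s)
  have hBpq := hs hp hq hpq
  have hdisj : ∀ x ∈ t, ∀ y ∈ t, ∀ z ∈ t, ∀ w ∈ t, x ≠ z → x ≠ w → y ≠ z → y ≠ w →
      B.Adj x y → B.Adj z w → False := by
    intro x hx y hy z hz w hw h1 h2 h3 h4 h5 h6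
    obtain ⟨u, hu, hu'⟩ := Finset.exists_mem_notMem_of_card_lt_card (s := {x, y, z, w}) (t := t)
      (lt_of_le_of_lt Finset.card_le_four (by omega))
    simp only [Finset.mem_insert, Finset.mem_singleton, not_or, ← ne_eq] at hu'
    exact h.fanB p x y z w q u ⟨⟨hst p hp x hx, hst p hp y hy, hst p hp z hz, hst p hp w hw, hBpq,
      hst p hp u hu⟩, ⟨h5, h6, hst q hq u hu⟩, ⟨h1, h2, h3, h4⟩, ⟨(hst q hq x hx).ne', hu'.1.symm,
      (hst q hq y hy).ne', hu'.2.1.symm⟩, ⟨(hst q hq z hz).ne', hu'.2.2.1.symm,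
      (hst q hq w hw).ne', hu'.2.2.2.symm⟩⟩
  by_cases hstar : ∃ c ∈ t, ∀ x ∈ t, ∀ y ∈ t, x ≠ c → y ≠ c → x ≠ y → R.Adj x y
  · obtain ⟨c, hct, hc⟩ := hstar
    refine Or.inr (Or.inl ⟨t.erase c, (Finset.erase_subset _ _).trans (htA.trans hA'), ⟨?_, ?_⟩,
      p, hA' (hsA hp), q, hA' (hsA hq), hBpq, fun x hx => ?_⟩)
    · intro x hx y hy hxy
      rw [Finset.mem_coe, Finset.mem_erase] at hx hy
      exact hc x hx.2 y hy.2 hx.1 hy.1 hxy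
    · rw [Finset.card_erase_of_mem hct, ht]
    · have hx' := Finset.mem_of_mem_erase hx
      exact ⟨hst p hp x hx', hst q hq x hx'⟩
  have hedge : ∀ c ∈ t, ∃ x ∈ t, ∃ y ∈ t, x ≠ c ∧ y ≠ c ∧ B.Adj x y := by
    intro c hc
    by_contra! hcon
    exact hstar ⟨c, hc, fun x hx y hy h1 h2 h3 =>
      (h.total h3).resolve_left (hcon x hx y hy h1 h2)⟩
  obtain ⟨c, hc⟩ := Finset.card_pos.1 (by omega : 0 < #t)
  obtain ⟨x, hx, y, hy, -, -, hxy⟩ := hedge c hc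
  have third : ∀ x ∈ t, ∀ y ∈ t, B.Adj x y → ∃ z ∈ t, z ≠ x ∧ B.Adj y z := by
    intro x hx y hy hxy
    obtain ⟨z, hz, w, hw, h1, h2, h3⟩ := hedge x hx
    by_cases hyz : y = z
    · exact ⟨w, hw, h2, hyz ▸ h3⟩
    by_cases hyw : y = w
    · exact ⟨z, hz, h1, hyw ▸ h3.symm⟩
    exact (hdisj x hx y hy z hz w hw h1.symm h2.symm hyz hyw hxy h3).elim
  obtain ⟨z, hz, hzx, hyz⟩ := third x hx y hy hxy
  obtain ⟨w, hw, hwy, hxw⟩ := third y hy x hx hxy.symm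
  have hwz : w = z := by
    by_contra hne
    exact hdisj x hx w hw y hy z hz hxy.ne hzx.symm hwy hne hxw hyz
  subst hwz
  left
  refine ⟨{p, q, x, y, w}, ?_, ?_⟩
  · simp only [Finset.insert_subset_iff, Finset.singleton_subset_iff]
    exact ⟨hA' (hsA hp), hA' (hsA hq), hA' (htA hx), hA' (htA hy), hA' (htA hw)⟩
  · rw [show (5 : ℕ) = 3 + 1 + 1 from rfl]
    refine SimpleGraph.IsNClique.insert (SimpleGraph.IsNClique.insert
      (SimpleGraph.is3Clique_triple_iff.2 ⟨hxy, hxw, hyz⟩) ?_) ?_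
    · simp only [Finset.mem_insert, Finset.mem_singleton, forall_eq_or_imp, forall_eq]
      exact ⟨hst q hq x hx, hst q hq y hy, hst q hq w hw⟩
    · simp only [Finset.mem_insert, Finset.mem_singleton, forall_eq_or_imp, forall_eq]
      exact ⟨hBpq, hst p hp x hx, hst p hp y hy, hst p hp w hw⟩

end FanFreePair

/-! ### Five triples in nine points. -/

section SetSystem

variable {V : Type*}

/-- Two different elements of a member of the set system are never shared with two different
further members. -/
def StarLike (s : Finset V) (U : V → Finset V) : Prop :=
  ∀ i ∈ s, ∀ j ∈ s, ∀ l ∈ s, i ≠ j → i ≠ l → j ≠ l →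
    ∀ x ∈ U i, ∀ y ∈ U i, x ≠ y → x ∈ U j → y ∈ U l → False

open scoped Classical in
-- If `U i` meets two other members, it does so in a single point `w` common to all three. A member
-- through `w` then shares nothing but `w` with any other member, and the members need more than
-- nine points.
theorem StarLike.not_meets_two {s : Finset V} {U : V → Finset V} (hU : StarLike s U)
    (hs : #s = 5) (hc : ∀ i ∈ s, #(U i) = 3) {o : Finset V} (ho : #o ≤ 9)
    (hUo : ∀ i ∈ s, U i ⊆ o) {i j l : V} (hi : i ∈ s) (hj : j ∈ s) (hl : l ∈ s)
    (hij : i ≠ j) (hil : i ≠ l) (hjl : j ≠ l) (h₁ : ¬ Disjoint (U i) (U j))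
    (h₂ : ¬ Disjoint (U i) (U l)) : False := by
  obtain ⟨w, hwi, hwj⟩ := Finset.not_disjoint_iff.1 h₁
  obtain ⟨w', hwi', hwl⟩ := Finset.not_disjoint_iff.1 h₂
  have hww : w = w' := by
    by_contra hne
    exact hU i hi j hj l hl hij hil hjl w hwi w' hwi' hne hwj hwl
  subst hww
  have hthird : ∀ x y : V, ∃ k ∈ s, w ∈ U k ∧ k ≠ x ∧ k ≠ y := by
    intro x y
    obtain ⟨k, hk, hk'⟩ := Finset.exists_mem_notMem_of_card_lt_card (s := {x, y})
      (t := {i, j, l}) (lt_of_le_of_lt Finset.card_le_two (by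
        rw [Finset.card_insert_of_notMem, Finset.card_pair hjl]
        · omega
        · simp only [Finset.mem_insert, Finset.mem_singleton, not_or]
          exact ⟨hij, hil⟩))
    simp only [Finset.mem_insert, Finset.mem_singleton, not_or] at hk hk'
    rcases hk with rfl | rfl | rfl
    exacts [⟨_, hi, hwi, hk'⟩, ⟨_, hj, hwj, hk'⟩, ⟨_, hl, hwl, hk'⟩]
  have hmeet : ∀ x ∈ s, ∀ y ∈ s, x ≠ y → w ∈ U x → Disjoint ((U x).erase w) ((U y).erase w) := by
    intro x hx y hy hxy hwx
    rw [Finset.disjoint_left]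
    intro v hvx hvy
    rw [Finset.mem_erase] at hvx hvy
    obtain ⟨k, hk, hwk, hkx, hky⟩ := hthird x y
    exact hU x hx y hy k hk hxy hkx.symm hky.symm v hvx.2 w hwx hvx.1 hvy.2 hwk
  have hsum : ∀ a ⊆ s, (∀ x ∈ a, ∀ y ∈ a, x ≠ y → w ∈ U x ∨ w ∈ U y) →
      ∑ x ∈ a, #((U x).erase w) + 1 ≤ 9 := by
    intro a ha h
    rw [← Finset.card_biUnion]
    · rw [← Finset.card_insert_of_notMem (a := w)]
      · refine (Finset.card_le_card ?_).trans ho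
        rw [Finset.insert_subset_iff]
        refine ⟨hUo i hi hwi, ?_⟩
        rw [Finset.biUnion_subset]
        exact fun x hx => (Finset.erase_subset _ _).trans (hUo x (ha hx))
      · simp
    · intro x hx y hy hxy
      rcases h x hx y hy hxy with h1 | h1
      · exact hmeet x (ha hx) y (ha hy) hxy h1
      · exact (hmeet y (ha hy) x (ha hx) hxy.symm h1).symm
  have hall : ∀ x ∈ s, w ∈ U x := by
    intro m hm
    by_contra hwm
    have hmi : m ≠ i := by rintro rfl; exact hwm hwi
    have hmj : m ≠ j := by rintro rfl; exact hwm hwj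
    have hml : m ≠ l := by rintro rfl; exact hwm hwl
    -- A member avoiding `w` would give `3 + 2 + 2 + 2 + 1 = 10` points.
    have h4 := hsum {m, i, j, l} (by
      simp only [Finset.insert_subset_iff, Finset.singleton_subset_iff]
      exact ⟨hm, hi, hj, hl⟩) (by
      intro x hx y hy hxy
      simp only [Finset.mem_insert, Finset.mem_singleton] at hx hy
      rcases hx with rfl | rfl | rfl | rfl
      · rcases hy with rfl | rfl | rfl | rfl
        exacts [absurd rfl hxy, Or.inr hwi, Or.inr hwj, Or.inr hwl]
      exacts [Or.inl hwi, Or.inl hwj, Or.inl hwl])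
    rw [Finset.sum_insert (by simp [hmi, hmj, hml]), Finset.sum_insert (by simp [hij, hil]),
      Finset.sum_pair hjl, Finset.erase_eq_of_notMem hwm, Finset.card_erase_of_mem hwi,
      Finset.card_erase_of_mem hwj, Finset.card_erase_of_mem hwl, hc m hm, hc i hi, hc j hj,
      hc l hl] at h4
    omega
  -- Five members through `w` would give `5 * 2 + 1 = 11` points.
  have h5 := hsum s subset_rfl fun x hx y _ _ => Or.inl (hall x hx)
  rw [Finset.sum_congr rfl fun x hx => by rw [Finset.card_erase_of_mem (hall x hx), hc x hx],
    Finset.sum_const, hs] at h5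
  simp at h5

open scoped Classical in
-- Each member meets at most one other, and a graph of maximum degree one on five vertices has three
-- independent vertices.
theorem StarLike.exists_disjoint {s : Finset V} {U : V → Finset V} (hU : StarLike s U)
    (hs : #s = 5) (hc : ∀ i ∈ s, #(U i) = 3) {o : Finset V} (ho : #o ≤ 9)
    (hUo : ∀ i ∈ s, U i ⊆ o) :
    ∃ i ∈ s, ∃ j ∈ s, ∃ l ∈ s, i ≠ j ∧ i ≠ l ∧ j ≠ l ∧ Disjoint (U i) (U j) ∧
      Disjoint (U i) (U l) ∧ Disjoint (U j) (U l) := by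
  by_cases hm : ∃ i ∈ s, ∃ j ∈ s, i ≠ j ∧ ¬ Disjoint (U i) (U j)
  · obtain ⟨i, hi, j, hj, hij, hmij⟩ := hm
    obtain ⟨l, hl, m, hm, n, hn, hlm, hln, hmn⟩ := exists_three (s := (s.erase i).erase j) (by
      rw [Finset.card_erase_of_mem (Finset.mem_erase.2 ⟨hij.symm, hj⟩),
        Finset.card_erase_of_mem hi]; omega)
    simp only [Finset.mem_erase] at hl hm hn
    have hd : ∀ k ∈ s, k ≠ i → k ≠ j → Disjoint (U i) (U k) := fun k hk hki hkj => by
      by_contra hcon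
      exact hU.not_meets_two hs hc ho hUo hi hj hk hij hki.symm hkj.symm hmij hcon
    by_cases hlm' : Disjoint (U l) (U m)
    · exact ⟨i, hi, l, hl.2.2, m, hm.2.2, hl.2.1.symm, hm.2.1.symm, hlm,
        hd l hl.2.2 hl.2.1 hl.1, hd m hm.2.2 hm.2.1 hm.1, hlm'⟩
    · refine ⟨i, hi, l, hl.2.2, n, hn.2.2, hl.2.1.symm, hn.2.1.symm, hln,
        hd l hl.2.2 hl.2.1 hl.1, hd n hn.2.2 hn.2.1 hn.1, ?_⟩
      by_contra hcon
      exact hU.not_meets_two hs hc ho hUo hl.2.2 hm.2.2 hn.2.2 hlm hln hmn hlm' hcon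
  · push Not at hm
    obtain ⟨i, hi, j, hj, l, hl, h1, h2, h3⟩ := exists_three (s := s) (by omega)
    exact ⟨i, hi, j, hj, l, hl, h1, h2, h3, hm i hi j hj h1, hm i hi l hl h2, hm j hj l hl h3⟩

end SetSystem

/-! ### `R`-cliques of order five and their outer neighbours. -/

namespace FanFreePair

variable {V : Type*} {B R : SimpleGraph V}

open scoped Classical in
theorem exists_two_others {s : Finset V} {n : ℕ} (hs : #s = n) {a b : V} (ha : a ∈ s) (hb : b ∈ s)
    (hab : a ≠ b) (hn : 4 ≤ n) : ∃ c ∈ s, ∃ d ∈ s, c ≠ a ∧ c ≠ b ∧ d ≠ a ∧ d ≠ b ∧ c ≠ d := by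
  obtain ⟨c, hc, d, hd, hcd⟩ := Finset.one_lt_card.1 (by
    rw [Finset.card_erase_of_mem (Finset.mem_erase.2 ⟨hab.symm, hb⟩),
      Finset.card_erase_of_mem ha]; omega : 1 < #((s.erase a).erase b))
  simp only [Finset.mem_erase] at hc hd
  exact ⟨c, hc.2.2, d, hd.2.2, hc.2.1, hc.1, hd.2.1, hd.1, hcd⟩

open scoped Classical in
-- Otherwise `uw` and two disjoint edges of the clique are blades at `x`.
theorem clique_five_outside_edge (h : FanFreePair B R) {s : Finset V} (hs : R.IsNClique 5 s)
    {x u w : V} (hx : x ∈ s) (hu : u ∉ s) (hw : w ∉ s) (hxu : R.Adj x u) (hxw : R.Adj x w) :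
    ¬ R.Adj u w := by
  intro huw
  obtain ⟨a, ha, b, hb, c, hc, d, hd, h1, h2, h3, h4, h5, h6⟩ := exists_four (s := s.erase x)
    (by rw [Finset.card_erase_of_mem hx, hs.2])
  rw [Finset.mem_erase] at ha hb hc hd
  have hne : ∀ y ∈ s, ∀ z, z ∉ s → z ≠ y := by rintro y hy z hz rfl; exact hz hy
  exact h.fanR x u w a b c d ⟨⟨hxu, hxw, hs.1 hx ha.2 ha.1.symm, hs.1 hx hb.2 hb.1.symm,
    hs.1 hx hc.2 hc.1.symm, hs.1 hx hd.2 hd.1.symm⟩, ⟨huw, hs.1 ha.2 hb.2 h1, hs.1 hc.2 hd.2 h6⟩,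
    ⟨hne a ha.2 u hu, hne b hb.2 u hu, hne a ha.2 w hw, hne b hb.2 w hw⟩,
    ⟨hne c hc.2 u hu, hne d hd.2 u hu, hne c hc.2 w hw, hne d hd.2 w hw⟩, ⟨h2, h4, h3, h5⟩⟩

open scoped Classical in
-- The blades at `x` are `uy`, `wz` and the edge on the two unused clique vertices.
theorem clique_five_two_paths (h : FanFreePair B R) {s : Finset V} (hs : R.IsNClique 5 s)
    {x y z u w : V} (hx : x ∈ s) (hy : y ∈ s) (hz : z ∈ s) (hxy : x ≠ y) (hxz : x ≠ z)
    (hyz : y ≠ z) (hu : u ∉ s) (hw : w ∉ s) (huw : u ≠ w) (hxu : R.Adj x u) (hxw : R.Adj x w)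
    (hyu : R.Adj y u) (hzw : R.Adj z w) : False := by
  obtain ⟨a, ha, b, hb, h1, h2, h3, h4, h5⟩ := exists_two_others (s := s.erase x) (n := 4)
    (by rw [Finset.card_erase_of_mem hx, hs.2]) (Finset.mem_erase.2 ⟨hxy.symm, hy⟩)
    (Finset.mem_erase.2 ⟨hxz.symm, hz⟩) hyz le_rfl
  rw [Finset.mem_erase] at ha hb
  have hne : ∀ y ∈ s, ∀ z, z ∉ s → z ≠ y := by rintro y hy z hz rfl; exact hz hy
  exact h.fanR x u y w z a b ⟨⟨hxu, hs.1 hx hy hxy, hxw, hs.1 hx hz hxz, hs.1 hx ha.2 ha.1.symm,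
    hs.1 hx hb.2 hb.1.symm⟩, ⟨hyu.symm, hzw.symm, hs.1 ha.2 hb.2 h5⟩,
    ⟨huw, hne z hz u hu, (hne y hy w hw).symm, hyz⟩,
    ⟨hne a ha.2 u hu, hne b hb.2 u hu, h1.symm, h3.symm⟩,
    ⟨hne a ha.2 w hw, hne b hb.2 w hw, h2.symm, h4.symm⟩⟩

open scoped Classical in
theorem clique_five_starLike (h : FanFreePair B R) {s o : Finset V} (hs : R.IsNClique 5 s)
    (ho : Disjoint s o) : StarLike s fun x => {w ∈ o | R.Adj x w} := by
  intro i hi j hj l hl hij hil hjl x hx y hy hxy hxj hyl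
  rw [Finset.mem_filter] at hx hy hxj hyl
  exact h.clique_five_two_paths hs hi hj hl hij hil hjl (Finset.disjoint_right.1 ho hx.1)
    (Finset.disjoint_right.1 ho hy.1) hxy hx.2 hy.2 hxj.2 hyl.2

end FanFreePair

section Picking

variable {V : Type*} {s : Finset V}

open scoped Classical in
theorem exists_other_two (hs : #s = 3) {a : V} (ha : a ∈ s) :
    ∃ b ∈ s, ∃ c ∈ s, b ≠ a ∧ c ≠ a ∧ b ≠ c := by
  obtain ⟨b, hb, c, hc, hbc⟩ := Finset.one_lt_card.1
    (by rw [Finset.card_erase_of_mem ha]; omega : 1 < #(s.erase a))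
  rw [Finset.mem_erase] at hb hc
  exact ⟨b, hb.2, c, hc.2, hb.1, hc.1, hbc⟩

open scoped Classical in
theorem exists_other_one (hs : 3 ≤ #s) (a b : V) : ∃ c ∈ s, c ≠ a ∧ c ≠ b := by
  obtain ⟨c, hc, hc'⟩ := Finset.exists_mem_notMem_of_card_lt_card (s := {a, b}) (t := s)
    (lt_of_le_of_lt Finset.card_le_two hs)
  simp only [Finset.mem_insert, Finset.mem_singleton, not_or] at hc'
  exact ⟨c, hc, hc'⟩

end Picking

/-! ### Joins of two triangles: near and far vertices. -/

namespace FanFreePair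

variable {V : Type*} {B R : SimpleGraph V}

/-- An `R`-triangle `T` and a `B`-triangle `Q`, completely `B`-joined. -/
structure Join (B R : SimpleGraph V) (T Q : Finset V) : Prop where
  cardT : #T = 3
  cardQ : #Q = 3
  redT : ∀ x ∈ T, ∀ y ∈ T, x ≠ y → R.Adj x y
  blueQ : ∀ x ∈ Q, ∀ y ∈ Q, x ≠ y → B.Adj x y
  join : ∀ x ∈ T, ∀ y ∈ Q, B.Adj x y

section Parts

variable [Fintype V]

open scoped Classical in
/-- The vertices outside `T` and `Q`. -/
noncomputable def rest (T Q : Finset V) : Finset V := (T ∪ Q)ᶜ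

open scoped Classical in
/-- The outer vertices with a `B`-neighbour in `Q`. -/
noncomputable def near (B : SimpleGraph V) (T Q : Finset V) : Finset V :=
  {w ∈ rest T Q | ∃ q ∈ Q, B.Adj w q}

open scoped Classical in
/-- The outer vertices completely `R`-joined to `Q`. -/
noncomputable def far (R : SimpleGraph V) (T Q : Finset V) : Finset V :=
  {w ∈ rest T Q | ∀ q ∈ Q, R.Adj w q}

theorem mem_rest {T Q : Finset V} {w : V} : w ∈ rest T Q ↔ w ∉ T ∧ w ∉ Q := by
  classical
  simp [rest]

theorem mem_near {T Q : Finset V} {w : V} :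
    w ∈ near B T Q ↔ w ∈ rest T Q ∧ ∃ q ∈ Q, B.Adj w q := by
  classical
  simp [near]

theorem mem_far {T Q : Finset V} {w : V} :
    w ∈ far R T Q ↔ w ∈ rest T Q ∧ ∀ q ∈ Q, R.Adj w q := by
  classical
  simp [far]

end Parts

namespace Join

variable {T Q : Finset V}

theorem disjoint (J : Join B R T Q) : Disjoint T Q :=
  Finset.disjoint_left.2 fun x hx hx' => (J.join x hx x hx').ne rfl

variable [Fintype V]

open scoped Classical in
theorem card_split (J : Join B R T Q) (p : V → Prop) :
    #{x | p x} = #{x ∈ T | p x} + #{x ∈ Q | p x} + #{x ∈ rest T Q | p x} := by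
  rw [← Finset.card_union_of_disjoint, ← Finset.card_union_of_disjoint, ← Finset.filter_union,
    ← Finset.filter_union]
  · congr 1
    ext x
    simp only [rest, Finset.mem_filter, Finset.mem_univ, true_and, Finset.union_compl]
  · rw [← Finset.filter_union]
    exact Finset.disjoint_filter_filter disjoint_compl_right
  · exact Finset.disjoint_filter_filter J.disjoint

theorem card_rest (hV : Fintype.card V = 14) (J : Join B R T Q) : #(rest T Q) = 8 := by
  classical
  rw [rest, Finset.card_compl, Finset.card_union_of_disjoint J.disjoint, J.cardT, J.cardQ, hV]

theorem near_or_far (h : FanFreePair B R) {w : V} (hw : w ∈ rest T Q) :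
    w ∈ near B T Q ∨ w ∈ far R T Q := by
  by_cases hn : ∃ q ∈ Q, B.Adj w q
  · exact Or.inl (mem_near.2 ⟨hw, hn⟩)
  · push Not at hn
    exact Or.inr (mem_far.2 ⟨hw, fun q hq =>
      (h.total (by rintro rfl; exact (mem_rest.1 hw).2 hq)).resolve_left (hn q hq)⟩)

theorem ne_near_far (h : FanFreePair B R) {z w : V} (hz : z ∈ near B T Q) (hw : w ∈ far R T Q) :
    z ≠ w := by
  rintro rfl
  obtain ⟨-, q, hq, hzq⟩ := mem_near.1 hz
  exact h.disj hzq ((mem_far.1 hw).2 q hq)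

theorem card_near_add_card_far (hV : Fintype.card V = 14) (h : FanFreePair B R)
    (J : Join B R T Q) : #(near B T Q) + #(far R T Q) = 8 := by
  classical
  rw [← J.card_rest hV, ← Finset.card_union_of_disjoint]
  · congr 1
    ext x
    rw [Finset.mem_union]
    refine ⟨?_, near_or_far h⟩
    rintro (hx | hx)
    exacts [(mem_near.1 hx).1, (mem_far.1 hx).1]
  · exact Finset.disjoint_left.2 fun x hx hx' => ne_near_far h hx hx' rfl

/-- A `B`-edge `tz` would be a blade at `q`, the other two blades joining the rest of `T` to the
rest of `Q`. -/
theorem near_red (h : FanFreePair B R) (J : Join B R T Q) {z t : V} (hz : z ∈ near B T Q)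
    (ht : t ∈ T) : R.Adj z t := by
  obtain ⟨hz, q, hq, hzq⟩ := mem_near.1 hz
  rw [mem_rest] at hz
  have hzT : ∀ t ∈ T, z ≠ t := by rintro t ht rfl; exact hz.1 ht
  have hzQ : ∀ t ∈ Q, z ≠ t := by rintro t ht rfl; exact hz.2 ht
  refine (h.total (hzT t ht)).resolve_left fun hB => ?_
  obtain ⟨t₁, ht₁, t₂, ht₂, h1, h2, h3⟩ := exists_other_two J.cardT ht
  obtain ⟨q₁, hq₁, q₂, hq₂, h4, h5, h6⟩ := exists_other_two J.cardQ hq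
  exact h.fanB q t z t₁ q₁ t₂ q₂ ⟨⟨(J.join t ht q hq).symm, hzq.symm, (J.join t₁ ht₁ q hq).symm,
    J.blueQ q hq q₁ hq₁ h4.symm, (J.join t₂ ht₂ q hq).symm, J.blueQ q hq q₂ hq₂ h5.symm⟩,
    ⟨hB.symm, J.join t₁ ht₁ q₁ hq₁, J.join t₂ ht₂ q₂ hq₂⟩,
    ⟨h1.symm, (J.join t ht q₁ hq₁).ne, hzT t₁ ht₁, hzQ q₁ hq₁⟩,
    ⟨h2.symm, (J.join t ht q₂ hq₂).ne, hzT t₂ ht₂, hzQ q₂ hq₂⟩,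
    ⟨h3, (J.join t₁ ht₁ q₂ hq₂).ne, (J.join t₂ ht₂ q₁ hq₁).ne', h6⟩⟩

/-- `z`, `z'` are two outer `B`-neighbours of a vertex of `Q`. -/
theorem near_pair_red (h : FanFreePair B R) (J : Join B R T Q) {z z' q : V}
    (hz : z ∈ rest T Q) (hz' : z' ∈ rest T Q) (hq : q ∈ Q) (hzz' : z ≠ z') (hzq : B.Adj z q)
    (hzq' : B.Adj z' q) : R.Adj z z' := by
  rw [mem_rest] at hz hz'
  refine (h.total hzz').resolve_left fun hB => ?_
  obtain ⟨t₁, ht₁, t₂, ht₂, h3⟩ := Finset.one_lt_card.1 (by rw [J.cardT]; omega : 1 < #T)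
  obtain ⟨q₁, hq₁, q₂, hq₂, h4, h5, h6⟩ := exists_other_two J.cardQ hq
  have hne : ∀ s : Finset V, ∀ x ∉ s, ∀ y ∈ s, x ≠ y := by rintro s x hx y hy rfl; exact hx hy
  exact h.fanB q z z' t₁ q₁ t₂ q₂ ⟨⟨hzq.symm, hzq'.symm, (J.join t₁ ht₁ q hq).symm,
    J.blueQ q hq q₁ hq₁ h4.symm, (J.join t₂ ht₂ q hq).symm, J.blueQ q hq q₂ hq₂ h5.symm⟩,
    ⟨hB, J.join t₁ ht₁ q₁ hq₁, J.join t₂ ht₂ q₂ hq₂⟩,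
    ⟨hne T z hz.1 _ ht₁, hne Q z hz.2 _ hq₁, hne T z' hz'.1 _ ht₁, hne Q z' hz'.2 _ hq₁⟩,
    ⟨hne T z hz.1 _ ht₂, hne Q z hz.2 _ hq₂, hne T z' hz'.1 _ ht₂, hne Q z' hz'.2 _ hq₂⟩,
    ⟨h3, (J.join t₁ ht₁ q₂ hq₂).ne, (J.join t₂ ht₂ q₁ hq₁).ne', h6⟩⟩

/-- Three far `R`-neighbours of a far vertex could be matched into `Q`. -/
theorem far_maxDegTwo (h : FanFreePair B R) (J : Join B R T Q) : MaxDegTwo R (far R T Q) := by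
  intro u hu a ha b hb c hc h1 h2 h3 h4 h5 h6
  rw [mem_far, mem_rest] at hu ha hb hc
  have := J.cardQ
  refine h.false_of_matching_into h4 h5 h6 h1 h2 h3 (s₁ := Q) (s₂ := Q) (s₃ := Q) ?_ ?_ ?_
    (by omega) (by omega) (by omega)
  · exact fun x hx => ⟨hu.2 x hx, ha.2 x hx, by rintro rfl; exact hb.1.2 hx,
      by rintro rfl; exact hc.1.2 hx⟩
  · exact fun x hx => ⟨hu.2 x hx, hb.2 x hx, by rintro rfl; exact ha.1.2 hx,
      by rintro rfl; exact hc.1.2 hx⟩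
  · exact fun x hx => ⟨hu.2 x hx, hc.2 x hx, by rintro rfl; exact ha.1.2 hx,
      by rintro rfl; exact hb.1.2 hx⟩

/-- A far vertex with two far `R`-neighbours has at most one `R`-neighbour in any `R`-clique
outside. -/
theorem far_red_edge (h : FanFreePair B R) (J : Join B R T Q) {w a b x y : V}
    (hw : w ∈ far R T Q) (ha : a ∈ far R T Q) (hb : b ∈ far R T Q) (hab : a ≠ b)
    (hwa : R.Adj w a) (hwb : R.Adj w b) (hwx : R.Adj w x) (hwy : R.Adj w y) (hxa : x ≠ a)
    (hxb : x ≠ b) (hya : y ≠ a) (hyb : y ≠ b) (hxQ : x ∉ Q) (hyQ : y ∉ Q) : ¬ R.Adj x y := by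
  intro hxy
  obtain ⟨q₁, hq₁, q₂, hq₂, h3⟩ := Finset.one_lt_card.1 (by rw [J.cardQ]; omega : 1 < #Q)
  rw [mem_far, mem_rest] at hw ha hb
  have hne : ∀ s : Finset V, ∀ x ∉ s, ∀ y ∈ s, x ≠ y := by rintro s x hx y hy rfl; exact hx hy
  exact h.fanR w x y a q₁ b q₂ ⟨⟨hwx, hwy, hwa, hw.2 q₁ hq₁, hwb, hw.2 q₂ hq₂⟩,
    ⟨hxy, ha.2 q₁ hq₁, hb.2 q₂ hq₂⟩, ⟨hxa, hne Q x hxQ _ hq₁, hya, hne Q y hyQ _ hq₁⟩,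
    ⟨hxb, hne Q x hxQ _ hq₂, hyb, hne Q y hyQ _ hq₂⟩,
    ⟨hab, hne Q a ha.1.2 _ hq₂, (hne Q b hb.1.2 _ hq₁).symm, h3⟩⟩

/-- The blades at `w` are `zq` and the edges from `a` and `b` to the rest of `Q`. -/
theorem far_red_near (h : FanFreePair B R) (J : Join B R T Q) {w a b z q : V}
    (hw : w ∈ far R T Q) (ha : a ∈ far R T Q) (hb : b ∈ far R T Q) (hz : z ∈ near B T Q)
    (hq : q ∈ Q) (hab : a ≠ b) (hwa : R.Adj w a) (hwb : R.Adj w b) (hwz : R.Adj w z)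
    (hzq : R.Adj z q) : False := by
  obtain ⟨q₁, hq₁, q₂, hq₂, h1, h2, h3⟩ := exists_other_two J.cardQ hq
  have hza := ne_near_far h hz ha
  have hzb := ne_near_far h hz hb
  rw [mem_far, mem_rest] at hw ha hb
  rw [mem_near, mem_rest] at hz
  have hne : ∀ s : Finset V, ∀ x ∉ s, ∀ y ∈ s, x ≠ y := by rintro s x hx y hy rfl; exact hx hy
  exact h.fanR w z q a q₁ b q₂ ⟨⟨hwz, hw.2 q hq, hwa, hw.2 q₁ hq₁, hwb, hw.2 q₂ hq₂⟩,
    ⟨hzq, ha.2 q₁ hq₁, hb.2 q₂ hq₂⟩, ⟨hza, hne Q z hz.1.2 _ hq₁, (hne Q a ha.1.2 _ hq).symm,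
      h1.symm⟩, ⟨hzb, hne Q z hz.1.2 _ hq₂, (hne Q b hb.1.2 _ hq).symm, h2.symm⟩,
    ⟨hab, hne Q a ha.1.2 _ hq₂, (hne Q b hb.1.2 _ hq₁).symm, h3⟩⟩

/-- The blades at `z` are `t₁t₂`, `t₃z'` and `wq`. -/
theorem near_red_far (h : FanFreePair B R) (J : Join B R T Q) {z z' w q : V}
    (hz : z ∈ near B T Q) (hz' : z' ∈ near B T Q) (hw : w ∈ far R T Q) (hq : q ∈ Q)
    (hzz' : R.Adj z z') (hzw : R.Adj z w) (hzq : R.Adj z q) : False := by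
  obtain ⟨t₁, ht₁, t₂, ht₂, t₃, ht₃, h1, h2, h3⟩ := exists_three (s := T) (by rw [J.cardT])
  have r := fun t (ht : t ∈ T) => J.near_red h hz ht
  have r' := fun t (ht : t ∈ T) => J.near_red h hz' ht
  have hzw' := ne_near_far h hz' hw
  rw [mem_far, mem_rest] at hw
  rw [mem_near, mem_rest] at hz hz'
  have hne : ∀ s : Finset V, ∀ x ∉ s, ∀ y ∈ s, x ≠ y := by rintro s x hx y hy rfl; exact hx hy
  exact h.fanR z t₁ t₂ t₃ z' w q ⟨⟨r t₁ ht₁, r t₂ ht₂, r t₃ ht₃, hzz', hzw, hzq⟩,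
    ⟨J.redT t₁ ht₁ t₂ ht₂ h1, (r' t₃ ht₃).symm, hw.2 q hq⟩,
    ⟨h2, (r' t₁ ht₁).ne', h3, (r' t₂ ht₂).ne'⟩,
    ⟨(hne T w hw.1.1 _ ht₁).symm, (J.join t₁ ht₁ q hq).ne, (hne T w hw.1.1 _ ht₂).symm,
      (J.join t₂ ht₂ q hq).ne⟩,
    ⟨(hne T w hw.1.1 _ ht₃).symm, (J.join t₃ ht₃ q hq).ne, hzw', hne Q z' hz'.1.2 _ hq⟩⟩

/-- An `R`-edge `xy` would be a third blade at `t`, besides the edges from `z` and `z'` to the other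
two vertices of `T`. -/
theorem blue_of_two_near (h : FanFreePair B R) (J : Join B R T Q) {t z z' x y : V} (ht : t ∈ T)
    (hz : z ∈ near B T Q) (hz' : z' ∈ near B T Q) (hzz' : z ≠ z') (hx : x ∈ rest T Q)
    (hy : y ∈ rest T Q) (hxy : x ≠ y) (htx : R.Adj t x) (hty : R.Adj t y)
    (hxz : x ≠ z) (hxz' : x ≠ z') (hyz : y ≠ z) (hyz' : y ≠ z') : B.Adj x y := by
  refine (h.total hxy).resolve_right fun hR => ?_
  obtain ⟨t₁, ht₁, t₂, ht₂, h1, h2, h3⟩ := exists_other_two J.cardT ht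
  have r := fun t (ht : t ∈ T) => J.near_red h hz ht
  have r' := fun t (ht : t ∈ T) => J.near_red h hz' ht
  rw [mem_rest] at hx hy
  have hne : ∀ s : Finset V, ∀ x ∉ s, ∀ y ∈ s, x ≠ y := by rintro s x hx y hy rfl; exact hx hy
  exact h.fanR t z t₁ z' t₂ x y ⟨⟨(r t ht).symm, J.redT t ht t₁ ht₁ h1.symm, (r' t ht).symm,
    J.redT t ht t₂ ht₂ h2.symm, htx, hty⟩, ⟨r t₁ ht₁, r' t₂ ht₂, hR⟩,
    ⟨hzz', (r t₂ ht₂).ne, (r' t₁ ht₁).ne', h3⟩,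
    ⟨hxz.symm, hyz.symm, (hne T x hx.1 _ ht₁).symm, (hne T y hy.1 _ ht₁).symm⟩,
    ⟨hxz'.symm, hyz'.symm, (hne T x hx.1 _ ht₂).symm, (hne T y hy.1 _ ht₂).symm⟩⟩

open scoped Classical in
theorem card_red_bounds (hV : Fintype.card V = 14) (h : FanFreePair B R) (J : Join B R T Q)
    (v : V) :
    6 ≤ #{x ∈ T | R.Adj v x} + #{x ∈ Q | R.Adj v x} + #{x ∈ rest T Q | R.Adj v x} ∧
    #{x ∈ T | R.Adj v x} + #{x ∈ Q | R.Adj v x} + #{x ∈ rest T Q | R.Adj v x} ≤ 7 := by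
  rw [← J.card_split]
  have h1 := h.card_blue_add_card_red hV v
  have h2 := h.card_blue_le_seven hV v
  have h3 := h.card_red_le_seven hV v
  omega

open scoped Classical in
/-- Each vertex of `T` has three or four `B`-neighbours among the far vertices. -/
theorem card_blue_far (hV : Fintype.card V = 14) (h : FanFreePair B R) (J : Join B R T Q)
    {t : V} (ht : t ∈ T) :
    3 ≤ #{w ∈ far R T Q | B.Adj t w} ∧ #{w ∈ far R T Q | B.Adj t w} ≤ 4 := by
  have h1 := h.card_blue_add_card_red hV t
  have h2 := h.card_blue_le_seven hV t
  have h3 := h.card_red_le_seven hV t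
  rw [J.card_split] at h2
  rw [J.card_split (B.Adj t)] at h1
  have h4 : #{x ∈ T | B.Adj t x} = 0 := by
    rw [Finset.card_eq_zero, Finset.filter_eq_empty_iff]
    exact fun x hx hB => h.disj hB (J.redT t ht x hx hB.ne)
  have h5 : #{x ∈ Q | B.Adj t x} = 3 := by
    rw [Finset.filter_true_of_mem fun x hx => J.join t ht x hx, J.cardQ]
  have h6 : {x ∈ rest T Q | B.Adj t x} = {w ∈ far R T Q | B.Adj t w} := by
    ext x
    simp only [Finset.mem_filter]
    refine ⟨fun hx => ⟨?_, hx.2⟩, fun hx => ⟨(mem_far.1 hx.1).1, hx.2⟩⟩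
    exact (near_or_far h hx.1).resolve_left fun hn => h.disj hx.2 (J.near_red h hn ht).symm
  rw [h6] at h1 h2
  omega

open scoped Classical in
/-- Each vertex of `Q` has one or two outer `B`-neighbours. -/
theorem card_blue_near (hV : Fintype.card V = 14) (h : FanFreePair B R) (J : Join B R T Q)
    {q : V} (hq : q ∈ Q) :
    1 ≤ #{z ∈ near B T Q | B.Adj z q} ∧ #{z ∈ near B T Q | B.Adj z q} ≤ 2 := by
  have h1 := h.card_blue_add_card_red hV q
  have h2 := h.card_blue_le_seven hV q
  have h3 := h.card_red_le_seven hV q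
  rw [J.card_split] at h2
  rw [J.card_split (B.Adj q)] at h1
  have h4 : #{x ∈ T | B.Adj q x} = 3 := by
    rw [Finset.filter_true_of_mem fun x hx => (J.join x hx q hq).symm, J.cardT]
  have h5 : #{x ∈ Q | B.Adj q x} = 2 := by
    have h6 : {x ∈ Q | B.Adj q x} = Q.erase q := by
      ext x
      simp only [Finset.mem_filter, Finset.mem_erase]
      exact ⟨fun hx => ⟨hx.2.ne', hx.1⟩, fun hx => ⟨hx.2, J.blueQ q hq x hx.2 hx.1.symm⟩⟩
    rw [h6, Finset.card_erase_of_mem hq, J.cardQ]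
  have h6 : {x ∈ rest T Q | B.Adj q x} = {z ∈ near B T Q | B.Adj z q} := by
    ext x
    simp only [Finset.mem_filter, mem_near]
    exact ⟨fun hx => ⟨⟨hx.1, q, hq, hx.2.symm⟩, hx.2.symm⟩, fun hx => ⟨hx.1.1, hx.2.symm⟩⟩
  rw [h6] at h1 h2
  omega

end Join

end FanFreePair

/-! ### At most three near vertices, not one, and the clique join. -/

namespace FanFreePair

variable {V : Type*} {B R : SimpleGraph V}

namespace Join

variable [Fintype V] {T Q : Finset V}

open scoped Classical in
/-- If the near vertices form a `B`-clique, they have disjoint neighbourhoods in `Q`. -/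
theorem card_blue_near_le_one (h : FanFreePair B R) (J : Join B R T Q)
    (hn : ∀ z ∈ near B T Q, ∀ z' ∈ near B T Q, z ≠ z' → B.Adj z z') {q : V} (hq : q ∈ Q) :
    #{z ∈ near B T Q | B.Adj z q} ≤ 1 :=
  card_filter_le_one fun z hz z' hz' hzz' h1 h2 => h.disj (hn z hz z' hz' hzz')
    (J.near_pair_red h (mem_near.1 hz).1 (mem_near.1 hz').1 hq hzz' h1 h2)

/-- With four near vertices, any two are `B`-adjacent because two others serve in
`blue_of_two_near`. By `near_pair_red` each vertex of `Q` then has at most one near `B`-neighbour,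
so `Q` accounts for only three. -/
theorem card_near_le_three (h : FanFreePair B R) (J : Join B R T Q) : #(near B T Q) ≤ 3 := by
  classical
  by_contra! hcon
  have hn : ∀ z ∈ near B T Q, ∀ z' ∈ near B T Q, z ≠ z' → B.Adj z z' := by
    intro z hz z' hz' hzz'
    obtain ⟨x, hx, y, hy, h1, h2, h3, h4, h5⟩ := exists_two_others rfl hz hz' hzz' hcon
    obtain ⟨t, ht⟩ := Finset.card_pos.1 (by rw [J.cardT]; omega : 0 < #T)
    exact J.blue_of_two_near h ht hx hy h5 (mem_near.1 hz).1 (mem_near.1 hz').1 hzz'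
      (J.near_red h hz ht).symm (J.near_red h hz' ht).symm h1.symm h3.symm h2.symm h4.symm
  have h1 : near B T Q ⊆ Q.biUnion fun q => {z ∈ near B T Q | B.Adj z q} := by
    intro z hz
    obtain ⟨-, q, hq, hzq⟩ := mem_near.1 hz
    exact Finset.mem_biUnion.2 ⟨q, hq, Finset.mem_filter.2 ⟨hz, hzq⟩⟩
  have h2 := (Finset.card_le_card h1).trans
    (Finset.card_biUnion_le_card_mul _ _ 1 fun q hq => J.card_blue_near_le_one h hn hq)
  rw [J.cardQ] at h2
  omega

/-- Seven far vertices are `R`-joined to any `q`, and none is `R`-isolated among them by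
`false_of_six`; this contradicts `false_of_seven`. -/
theorem card_near_ne_one (hV : Fintype.card V = 14) (h : FanFreePair B R) (J : Join B R T Q) :
    #(near B T Q) ≠ 1 := by
  classical
  intro h1
  have h7 : #(far R T Q) = 7 := by have := J.card_near_add_card_far hV h; omega
  obtain ⟨q, hq⟩ := Finset.card_pos.1 (by rw [J.cardQ]; omega : 0 < #Q)
  refine h.false_of_seven (v := q) h7 (J.far_maxDegTwo h)
    (fun w hw => ((mem_far.1 hw).2 q hq).symm) fun w hw => ?_
  by_contra! hcon
  refine h.false_of_six (v := w) (s := (far R T Q).erase w)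
    (by rw [Finset.card_erase_of_mem hw, h7]) ((J.far_maxDegTwo h).mono (Finset.erase_subset _ _))
    fun u hu => ?_
  rw [Finset.mem_erase] at hu
  exact (h.total hu.1.symm).resolve_right (hcon u hu.2)

end Join

/-- An `R`-clique `s` on five vertices, completely `B`-joined to a `B`-triangle `Q`, such that the
six remaining vertices `F` are completely `R`-joined to `Q`. -/
structure CliqueJoin (B R : SimpleGraph V) (s Q F : Finset V) : Prop where
  clique : R.IsNClique 5 s
  cardQ : #Q = 3
  blueQ : ∀ x ∈ Q, ∀ y ∈ Q, x ≠ y → B.Adj x y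
  join : ∀ x ∈ s, ∀ y ∈ Q, B.Adj x y
  cardF : #F = 6
  disjF : Disjoint s F
  redF : ∀ w ∈ F, ∀ q ∈ Q, R.Adj w q
  cover : ∀ x, x ∈ s ∨ x ∈ Q ∨ x ∈ F
  maxDeg : MaxDegTwo R F

namespace CliqueJoin

variable {s Q F : Finset V}

theorem ne_far (C : CliqueJoin B R s Q F) {x w : V} (hx : x ∈ s) (hw : w ∈ F) : x ≠ w := by
  rintro rfl
  exact Finset.disjoint_left.1 C.disjF hx hw

open scoped Classical in
theorem card_split [Fintype V] (C : CliqueJoin B R s Q F) (p : V → Prop) :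
    #{x | p x} = #{x ∈ s | p x} + #{x ∈ Q | p x} + #{x ∈ F | p x} := by
  have h1 : Disjoint s Q := Finset.disjoint_left.2 fun x hx hx' => (C.join x hx x hx').ne rfl
  have h2 : Disjoint Q F := Finset.disjoint_left.2 fun x hx hx' => (C.redF x hx' x hx).ne rfl
  rw [← Finset.card_union_of_disjoint, ← Finset.card_union_of_disjoint, ← Finset.filter_union,
    ← Finset.filter_union]
  · congr 1
    ext x
    have := C.cover x
    simp only [Finset.mem_filter, Finset.mem_univ, true_and, Finset.mem_union]
    tauto
  · rw [← Finset.filter_union]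
    exact Finset.disjoint_filter_filter (Finset.disjoint_union_left.2 ⟨C.disjF, h2⟩)
  · exact Finset.disjoint_filter_filter h1

open scoped Classical in
theorem card_red [Fintype V] (hV : Fintype.card V = 14) (h : FanFreePair B R) (C : CliqueJoin B R s Q F)
    {x : V} (hx : x ∈ s) : 2 ≤ #{w ∈ F | R.Adj x w} ∧ #{w ∈ F | R.Adj x w} ≤ 3 := by
  have h1 := h.card_blue_add_card_red hV x
  have h2 := h.card_blue_le_seven hV x
  have h3 := h.card_red_le_seven hV x
  have h4 := C.card_split (R.Adj x)
  have h5 : {y ∈ s | R.Adj x y} = s.erase x := by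
    ext y
    simp only [Finset.mem_filter, Finset.mem_erase]
    exact ⟨fun hy => ⟨hy.2.ne', hy.1⟩, fun hy => ⟨hy.2, C.clique.1 hx hy.2 hy.1.symm⟩⟩
  have h6 : #{y ∈ Q | R.Adj x y} = 0 := by
    rw [Finset.card_eq_zero, Finset.filter_eq_empty_iff]
    exact fun y hy hR => h.disj (C.join x hx y hy) hR
  rw [h5, Finset.card_erase_of_mem hx, C.clique.2, h6] at h4
  omega

open scoped Classical in
/-- If `x` has only two `R`-neighbours outside, its four outer `B`-neighbours contain an
`R`-triangle. -/
theorem exists_triangle (h : FanFreePair B R) (C : CliqueJoin B R s Q F) {x : V}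
    (hx : x ∈ s) (h2 : #{w ∈ F | R.Adj x w} = 2) :
    ∃ a ∈ F, ∃ b ∈ F, ∃ c ∈ F, R.Adj a b ∧ R.Adj a c ∧ R.Adj b c ∧
      B.Adj x a ∧ B.Adj x b ∧ B.Adj x c := by
  have h1 := h.card_add_card (s := F) (v := x) fun hxF => C.ne_far hx hxF rfl
  rw [h2, C.cardF] at h1
  obtain ⟨a, ha, b, hb, c, hc, d, hd, hab, hac, hbc, had, hbd, hcd⟩ :=
    exists_four (s := {w ∈ F | B.Adj x w}) (by omega)
  rw [Finset.mem_filter] at ha hb hc hd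
  have hdeg : ∀ w ∈ F, ∀ x ∈ F, ∀ y ∈ F, ∀ z ∈ F, x ≠ y → x ≠ z → y ≠ z →
      ¬ (R.Adj w x ∧ R.Adj w y ∧ R.Adj w z) :=
    fun w hw x hx y hy z hz h1 h2 h3 h4 =>
      C.maxDeg w hw x hx y hy z hz h1 h2 h3 h4.1 h4.2.1 h4.2.2
  obtain ⟨q₁, hq₁, q₂, hq₂, hq⟩ := Finset.one_lt_card.1 (by rw [C.cardQ]; omega : 1 < #Q)
  have hne : ∀ w ∈ F, ∀ q ∈ Q, q ≠ w := fun w hw q hq => (C.redF w hw q hq).ne'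
  -- An edge of `Q` is always available as a third blade at `x`.
  have hfan : ∀ a ∈ F, ∀ b ∈ F, ∀ c ∈ F, ∀ d ∈ F, B.Adj x a → B.Adj x b → B.Adj x c →
      B.Adj x d → a ≠ c → a ≠ d → b ≠ c → b ≠ d → ¬ (B.Adj a b ∧ B.Adj c d) := by
    intro a ha b hb c hc d hd h1 h2 h3 h4 h5 h6 h7 h8 h9
    exact h.fanB x q₁ q₂ a b c d ⟨⟨C.join x hx q₁ hq₁, C.join x hx q₂ hq₂, h1, h2, h3, h4⟩,
      ⟨C.blueQ q₁ hq₁ q₂ hq₂ hq, h9.1, h9.2⟩,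
      ⟨hne a ha q₁ hq₁, hne b hb q₁ hq₁, hne a ha q₂ hq₂, hne b hb q₂ hq₂⟩,
      ⟨hne c hc q₁ hq₁, hne d hd q₁ hq₁, hne c hc q₂ hq₂, hne d hd q₂ hq₂⟩, ⟨h5, h6, h7, h8⟩⟩
  rcases h.matching_four (w := a) (x := b) (y := c) (z := d)
    (by simp only [List.nodup_cons, List.mem_cons, List.not_mem_nil, or_false, not_or,
          not_false_eq_true, List.nodup_nil, and_true]; exact ⟨⟨hab, hac, had⟩, ⟨hbc, hbd⟩, hcd⟩)
    (hdeg a ha.1 b hb.1 c hc.1 d hd.1 hbc hbd hcd) (hdeg b hb.1 a ha.1 c hc.1 d hd.1 hac had hcd)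
    (hdeg c hc.1 a ha.1 b hb.1 d hd.1 hab had hbd) (hdeg d hd.1 a ha.1 b hb.1 c hc.1 hab hac hbc)
    with h3 | h3 | h3 | h3 | h3 | h3 | h3
  · exact (hfan a ha.1 b hb.1 c hc.1 d hd.1 ha.2 hb.2 hc.2 hd.2 hac had hbc hbd h3).elim
  · exact (hfan a ha.1 c hc.1 b hb.1 d hd.1 ha.2 hc.2 hb.2 hd.2 hab had hbc.symm hcd h3).elim
  · exact (hfan a ha.1 d hd.1 b hb.1 c hc.1 ha.2 hd.2 hb.2 hc.2 hab hac hbd.symm hcd.symm h3).elim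
  · exact ⟨a, ha.1, b, hb.1, c, hc.1, h3.1, h3.2.1, h3.2.2, ha.2, hb.2, hc.2⟩
  · exact ⟨a, ha.1, b, hb.1, d, hd.1, h3.1, h3.2.1, h3.2.2, ha.2, hb.2, hd.2⟩
  · exact ⟨a, ha.1, c, hc.1, d, hd.1, h3.1, h3.2.1, h3.2.2, ha.2, hc.2, hd.2⟩
  · exact ⟨b, hb.1, c, hc.1, d, hd.1, h3.1, h3.2.1, h3.2.2, hb.2, hc.2, hd.2⟩

open scoped Classical in
/-- An outer vertex outside an `R`-triangle with an outer `B`-neighbour `d'` joined to the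
triangle has at least four `R`-neighbours in the clique. -/
theorem four_le_card_red (h : FanFreePair B R) (C : CliqueJoin B R s Q F) {a b c d d' : V}
    (ha : a ∈ F) (hb : b ∈ F) (hc : c ∈ F) (hd : d ∈ F) (hd' : d' ∈ F) (hab : R.Adj a b)
    (hac : R.Adj a c) (hbc : R.Adj b c) (hdd' : B.Adj d d')
    (hda : d ≠ a) (hdb : d ≠ b) (hdc : d ≠ c) (hda' : d' ≠ a) (hdb' : d' ≠ b) (hdc' : d' ≠ c) :
    4 ≤ #{x ∈ s | R.Adj d x} := by
  by_contra! hcon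
  have h1 := h.card_add_card (s := s) (v := d) fun hds => C.ne_far hds hd rfl
  rw [C.clique.2] at h1
  obtain ⟨x, hx, y, hy, hxy⟩ := Finset.one_lt_card.1 (by omega : 1 < #{x ∈ s | B.Adj d x})
  rw [Finset.mem_filter] at hx hy
  have hB : ∀ p ∈ F, ∀ q ∈ F, ∀ r ∈ F, ∀ u ∈ F, R.Adj p q → R.Adj p r → q ≠ r → u ≠ p → u ≠ q →
      u ≠ r → B.Adj u p := fun p hp q hq r hr u hu h1 h2 h3 h4 h5 h6 =>
    (h.total h4).resolve_right fun hR =>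
      C.maxDeg p hp q hq r hr u hu h3 h5.symm h6.symm h1 h2 hR.symm
  have hBa : ∀ u ∈ F, u ≠ a → u ≠ b → u ≠ c → B.Adj u a := fun u hu h1 h2 h3 =>
    hB a ha b hb c hc u hu hab hac hbc.ne h1 h2 h3
  have hBb : ∀ u ∈ F, u ≠ a → u ≠ b → u ≠ c → B.Adj u b := fun u hu h1 h2 h3 =>
    hB b hb a ha c hc u hu hab.symm hbc hac.ne h2 h1 h3
  have hBc : ∀ u ∈ F, u ≠ a → u ≠ b → u ≠ c → B.Adj u c := fun u hu h1 h2 h3 =>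
    hB c hc a ha b hb u hu hac.symm hbc.symm hab.ne h3 h1 h2
  have hBt : ∀ r ∈ ({a, b, c} : Finset V), r ∈ F ∧ B.Adj d r ∧ B.Adj d' r := by
    intro r hr
    simp only [Finset.mem_insert, Finset.mem_singleton] at hr
    rcases hr with rfl | rfl | rfl
    exacts [⟨ha, hBa d hd hda hdb hdc, hBa d' hd' hda' hdb' hdc'⟩,
      ⟨hb, hBb d hd hda hdb hdc, hBb d' hd' hda' hdb' hdc'⟩,
      ⟨hc, hBc d hd hda hdb hdc, hBc d' hd' hda' hdb' hdc'⟩]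
  have htc : #({a, b, c} : Finset V) = 3 := by
    rw [Finset.card_insert_of_notMem, Finset.card_pair hbc.ne]
    simp only [Finset.mem_insert, Finset.mem_singleton, not_or]
    exact ⟨hab.ne, hac.ne⟩
  have htri : ∀ p ∈ ({a, b, c} : Finset V), ∀ q ∈ ({a, b, c} : Finset V), p ≠ q → R.Adj p q := by
    intro p hp q hq hpq
    simp only [Finset.mem_insert, Finset.mem_singleton] at hp hq
    rcases hp with rfl | rfl | rfl <;> rcases hq with rfl | rfl | rfl <;>
      first | exact absurd rfl hpq | assumption | (apply SimpleGraph.Adj.symm; assumption)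
  have hout : ∀ w ∈ F, w ∉ s := fun w hw hws => C.ne_far hws hw rfl
  have htwo : ∀ x ∈ s, 2 ≤ #{r ∈ ({a, b, c} : Finset V) | B.Adj x r} := by
    intro x hx
    have h1 := h.card_add_card (s := {a, b, c}) (v := x)
      fun hxt => C.ne_far hx (hBt x hxt).1 rfl
    have h2 : #{r ∈ ({a, b, c} : Finset V) | R.Adj x r} ≤ 1 :=
      card_filter_le_one fun p hp q hq hpq h3 h4 =>
        h.clique_five_outside_edge C.clique hx (hout p (hBt p hp).1) (hout q (hBt q hq).1) h3 h4
          (htri p hp q hq hpq)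
    omega
  have h2x := htwo x hx.1
  have h2y := htwo y hy.1
  -- `x` and `y` each have at least two `B`-neighbours in the triangle and `d'` has all three, so
  -- the three can be matched into it to form blades at `d`.
  obtain ⟨r₁, hr₁, r₂, hr₂, r₃, hr₃, h12, h13, h23⟩ := exists_distinct_representatives
    (s₁ := {r ∈ ({a, b, c} : Finset V) | B.Adj x r})
    (s₂ := {r ∈ ({a, b, c} : Finset V) | B.Adj y r}) (s₃ := {a, b, c})
    (by omega) h2y (by omega)
  rw [Finset.mem_filter] at hr₁ hr₂
  have k1 := hBt r₁ hr₁.1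
  have k2 := hBt r₂ hr₂.1
  have k3 := hBt r₃ hr₃
  exact h.fanB d x r₁ y r₂ d' r₃ ⟨⟨hx.2, k1.2.1, hy.2, k2.2.1, hdd', k3.2.1⟩,
    ⟨hr₁.2, hr₂.2, k3.2.2⟩,
    ⟨hxy, C.ne_far hx.1 k2.1, (C.ne_far hy.1 k1.1).symm, h12⟩,
    ⟨C.ne_far hx.1 hd', C.ne_far hx.1 k3.1, k1.2.2.ne', h13⟩,
    ⟨C.ne_far hy.1 hd', C.ne_far hy.1 k3.1, k2.2.2.ne', h23⟩⟩

open scoped Classical in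
-- The two outer `R`-neighbours `d`, `d'` of `x` are `B`-adjacent and lie off the triangle of
-- `exists_triangle`, so both have four `R`-neighbours in the clique. That is enough for
-- `clique_five_two_paths`.
theorem card_red_ne_two (h : FanFreePair B R) (C : CliqueJoin B R s Q F) {x : V}
    (hx : x ∈ s) : #{w ∈ F | R.Adj x w} ≠ 2 := by
  intro h2
  obtain ⟨a, ha, b, hb, c, hc, hab, hac, hbc, hxa, hxb, hxc⟩ := C.exists_triangle h hx h2
  obtain ⟨d, hd, d', hd', hdd'⟩ := Finset.one_lt_card.1 (by rw [h2]; omega :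
    1 < #{w ∈ F | R.Adj x w})
  rw [Finset.mem_filter] at hd hd'
  have hout : ∀ w ∈ F, w ∉ s := fun w hw hws => C.ne_far hws hw rfl
  have hne : ∀ {u v : V}, R.Adj x u → B.Adj x v → u ≠ v := by
    rintro u v h1 h2 rfl
    exact h.disj h2 h1
  have hB : B.Adj d d' := (h.total hdd').resolve_right
    (h.clique_five_outside_edge C.clique hx (hout d hd.1) (hout d' hd'.1) hd.2 hd'.2)
  have k1 := C.four_le_card_red h ha hb hc hd.1 hd'.1 hab hac hbc hB (hne hd.2 hxa) (hne hd.2 hxb)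
    (hne hd.2 hxc) (hne hd'.2 hxa) (hne hd'.2 hxb) (hne hd'.2 hxc)
  have k2 := C.four_le_card_red h ha hb hc hd'.1 hd.1 hab hac hbc hB.symm (hne hd'.2 hxa)
    (hne hd'.2 hxb) (hne hd'.2 hxc) (hne hd.2 hxa) (hne hd.2 hxb) (hne hd.2 hxc)
  obtain ⟨y, hy, hyx⟩ := Finset.exists_mem_notMem_of_card_lt_card (s := {x})
    (t := {y ∈ s | R.Adj d y}) (by rw [Finset.card_singleton]; omega)
  obtain ⟨z, hz, hz'⟩ := Finset.exists_mem_notMem_of_card_lt_card (s := {x, y})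
    (t := {y ∈ s | R.Adj d' y}) (lt_of_le_of_lt Finset.card_le_two (by omega))
  simp only [Finset.mem_filter, Finset.mem_insert, Finset.mem_singleton, not_or,
    ← ne_eq] at hy hyx hz hz'
  exact h.clique_five_two_paths C.clique hx hy.1 hz.1 hyx.symm hz'.1.symm hz'.2.symm
    (hout d hd.1) (hout d' hd'.1) hdd' hd.2 hd'.2 hy.2.symm hz.2.symm

/-- All five outer `R`-neighbourhoods are triples, three of them disjoint; they do not fit into the
six vertices of `F`. -/
theorem elim [Fintype V] (hV : Fintype.card V = 14) (h : FanFreePair B R) (C : CliqueJoin B R s Q F) :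
    False := by
  classical
  obtain ⟨i, hi, j, hj, l, hl, hij, hil, hjl, d1, d2, d3⟩ :=
    (h.clique_five_starLike C.clique C.disjF).exists_disjoint C.clique.2
    (fun x hx => by
      have h1 := C.card_red hV h hx
      have h2 := C.card_red_ne_two h hx
      show #{w ∈ F | R.Adj x w} = 3
      omega) (o := F) (by rw [C.cardF]; omega) (fun x _ => Finset.filter_subset _ _)
  have h1 : ∀ x ∈ s, #{w ∈ F | R.Adj x w} = 3 := fun x hx => by
    have h1 := C.card_red hV h hx
    have h2 := C.card_red_ne_two h hx
    omega
  have h2 := Finset.card_le_card (Finset.union_subset (Finset.union_subset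
    (Finset.filter_subset (fun w => R.Adj i w) F) (Finset.filter_subset (fun w => R.Adj j w) F))
    (Finset.filter_subset (fun w => R.Adj l w) F))
  rw [Finset.card_union_of_disjoint (Finset.disjoint_union_left.2 ⟨d2, d3⟩),
    Finset.card_union_of_disjoint d1, h1 i hi, h1 j hj, h1 l hl, C.cardF] at h2
  omega

end CliqueJoin

end FanFreePair

/-! ### Joins with two near vertices. -/

namespace FanFreePair

variable {V : Type*} {B R : SimpleGraph V}

namespace Join

variable [Fintype V] {T Q : Finset V}

theorem near_blue_far (h : FanFreePair B R) (J : Join B R T Q) {z z' q : V}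
    (hz : z ∈ near B T Q) (hz' : z' ∈ near B T Q) (hq : q ∈ Q) (hzz' : R.Adj z z')
    (hzq : R.Adj z q) : ∀ w ∈ far R T Q, B.Adj z w := fun _ hw =>
  (h.total (ne_near_far h hz hw)).resolve_right fun hR =>
    J.near_red_far h hz hz' hw hq hzz' hR hzq

theorem not_mem_Q_of_near {z : V} (hz : z ∈ near B T Q) : z ∉ Q :=
  (mem_rest.1 (mem_near.1 hz).1).2

open scoped Classical in
-- Two `R`-neighbours of `z` in `Q` leave it at most one far `R`-neighbour, hence five far
-- `B`-neighbours. Then `false_of_five_add_one` applies at `z` with extra vertex `z'`, which has a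
-- `B`-neighbour among the five since its `R`-degree is at most seven.
theorem blue_pair_false (hV : Fintype.card V = 14) (h : FanFreePair B R) (J : Join B R T Q)
    {z z' : V} (hz : z ∈ near B T Q) (hz' : z' ∈ near B T Q) (hfar : #(far R T Q) = 6)
    (hzz' : B.Adj z z') (hcard : 2 ≤ #{q ∈ Q | R.Adj z q}) : False := by
  have hred : ∀ q ∈ Q, B.Adj z q → R.Adj z' q := fun q hq hB =>
    (h.total (by rintro rfl; exact not_mem_Q_of_near hz' hq)).resolve_left fun hB' =>
      h.disj hzz' (J.near_pair_red h (mem_near.1 hz).1 (mem_near.1 hz').1 hq hzz'.ne hB hB')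
  obtain ⟨q₀, hq₀, hzq₀⟩ := (mem_near.1 hz).2
  have hone : #{w ∈ far R T Q | R.Adj z w} ≤ 1 := by
    refine card_filter_le_one fun u hu w hw huw hzu hzw => ?_
    obtain ⟨q₁, hq₁, q₂, hq₂, h12⟩ := Finset.one_lt_card.1 hcard
    rw [Finset.mem_filter] at hq₁ hq₂
    obtain ⟨t₁, ht₁, t₂, ht₂, h3⟩ := Finset.one_lt_card.1 (by rw [J.cardT]; omega : 1 < #T)
    have hu' := mem_far.1 hu
    have hw' := mem_far.1 hw
    rw [mem_rest] at hu' hw'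
    have hne : ∀ s : Finset V, ∀ x ∉ s, ∀ y ∈ s, y ≠ x := by rintro s x hx y hy rfl; exact hx hy
    exact h.fanR z t₁ t₂ q₁ u q₂ w ⟨⟨J.near_red h hz ht₁, J.near_red h hz ht₂, hq₁.2, hzu, hq₂.2,
      hzw⟩, ⟨J.redT t₁ ht₁ t₂ ht₂ h3, (hu'.2 q₁ hq₁.1).symm, (hw'.2 q₂ hq₂.1).symm⟩,
      ⟨(J.join t₁ ht₁ q₁ hq₁.1).ne, hne T u hu'.1.1 t₁ ht₁, (J.join t₂ ht₂ q₁ hq₁.1).ne,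
        hne T u hu'.1.1 t₂ ht₂⟩,
      ⟨(J.join t₁ ht₁ q₂ hq₂.1).ne, hne T w hw'.1.1 t₁ ht₁, (J.join t₂ ht₂ q₂ hq₂.1).ne,
        hne T w hw'.1.1 t₂ ht₂⟩,
      ⟨h12, hne Q w hw'.1.2 q₁ hq₁.1, (hne Q u hu'.1.2 q₂ hq₂.1).symm, huw⟩⟩
  have hsplit := h.card_add_card (s := far R T Q) (v := z) fun hzf => ne_near_far h hz hzf rfl
  obtain ⟨s, hs, hs5⟩ := Finset.exists_subset_card_eq
    (s := {w ∈ far R T Q | B.Adj z w}) (n := 5) (by omega)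
  have hsf : s ⊆ far R T Q := hs.trans (Finset.filter_subset _ _)
  refine h.false_of_five_add_one (v := z) (a := z') hs5 ((J.far_maxDegTwo h).mono hsf)
    (fun w hw => (Finset.mem_filter.1 (hs hw)).2) hzz'
    (fun hz's => ne_near_far h hz' (hsf hz's) rfl) ?_ ?_
  · by_contra! hcon
    have h1 := (J.card_red_bounds hV h z').2
    rw [Finset.filter_true_of_mem fun x hx => J.near_red h hz' hx, J.cardT] at h1
    have h2 : s ⊆ {x ∈ rest T Q | R.Adj z' x} := fun w hw => Finset.mem_filter.2
      ⟨(mem_far.1 (hsf hw)).1, (h.total (ne_near_far h hz' (hsf hw))).resolve_left (hcon w hw)⟩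
    have h3 := Finset.card_le_card h2
    omega
  · intro x hx y hy w hw hxy hxw hyw hzx _ _
    exact J.far_red_near h (hsf hx) (hsf hy) (hsf hw) hz' hq₀ hyw.ne hxy hxw hzx.symm
      (hred q₀ hq₀ hzq₀)

/-- If the near vertices are `B`-adjacent, they share no `B`-neighbour in `Q`, so one of them has
two `R`-neighbours there. If they are `R`-adjacent, both are completely `B`-joined to `Q`, and with
`T` they form a `CliqueJoin`. -/
theorem card_near_ne_two (hV : Fintype.card V = 14) (h : FanFreePair B R) (J : Join B R T Q) :
    #(near B T Q) ≠ 2 := by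
  classical
  intro h2
  have h6 : #(far R T Q) = 6 := by have := J.card_near_add_card_far hV h; omega
  obtain ⟨z, z', hzz', hn⟩ := Finset.card_eq_two.1 h2
  have hz : z ∈ near B T Q := by rw [hn]; simp
  have hz' : z' ∈ near B T Q := by rw [hn]; simp
  rcases h.total hzz' with hB | hR
  · have hlt : 3 ≤ #{q ∈ Q | R.Adj z q} + #{q ∈ Q | R.Adj z' q} := by
      rw [← J.cardQ]
      refine (Finset.card_le_card fun q hq => ?_).trans (Finset.card_union_le _ _)
      rw [Finset.mem_union, Finset.mem_filter, Finset.mem_filter]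
      by_contra! hcon
      have k1 := (h.total (by rintro rfl; exact not_mem_Q_of_near hz hq)).resolve_right
        (hcon.1 hq)
      have k2 := (h.total (by rintro rfl; exact not_mem_Q_of_near hz' hq)).resolve_right
        (hcon.2 hq)
      exact h.disj hB (J.near_pair_red h (mem_near.1 hz).1 (mem_near.1 hz').1 hq hzz' k1 k2)
    rcases (by omega : 2 ≤ #{q ∈ Q | R.Adj z q} ∨ 2 ≤ #{q ∈ Q | R.Adj z' q}) with k | k
    · exact J.blue_pair_false hV h hz hz' h6 hB k
    · exact J.blue_pair_false hV h hz' hz h6 hB.symm k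
  · have key : ∀ {z z'}, z ∈ near B T Q → z' ∈ near B T Q → R.Adj z z' → ∀ q ∈ Q, B.Adj z q := by
      intro z z' hz hz' hR q hq
      refine (h.total (by rintro rfl; exact not_mem_Q_of_near hz hq)).resolve_right fun hzq => ?_
      exact h.false_of_six (by omega) (J.far_maxDegTwo h) (J.near_blue_far h hz hz' hq hR hzq)
    have C : CliqueJoin B R (insert z (insert z' T)) Q (far R T Q) := by
      refine ⟨?_, J.cardQ, J.blueQ, ?_, h6, ?_, fun w hw q hq => (mem_far.1 hw).2 q hq, ?_,
        J.far_maxDegTwo h⟩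
      · refine SimpleGraph.IsNClique.insert (SimpleGraph.IsNClique.insert
          ⟨fun x hx y hy hxy => J.redT x hx y hy hxy, J.cardT⟩ fun t ht => J.near_red h hz' ht) ?_
        intro t ht
        rw [Finset.mem_insert] at ht
        rcases ht with rfl | ht
        exacts [hR, J.near_red h hz ht]
      · intro x hx q hq
        rw [Finset.mem_insert, Finset.mem_insert] at hx
        rcases hx with rfl | rfl | hx
        exacts [key hz hz' hR q hq, key hz' hz hR.symm q hq, J.join x hx q hq]
      · rw [Finset.disjoint_left]
        intro x hx hxf
        rw [Finset.mem_insert, Finset.mem_insert] at hx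
        rcases hx with rfl | rfl | hx
        exacts [ne_near_far h hz hxf rfl, ne_near_far h hz' hxf rfl,
          (mem_rest.1 (mem_far.1 hxf).1).1 hx]
      · intro x
        by_cases hxr : x ∈ rest T Q
        · rcases near_or_far h hxr with hx | hx
          · rw [hn, Finset.mem_insert, Finset.mem_singleton] at hx
            left
            rw [Finset.mem_insert, Finset.mem_insert]
            tauto
          · exact Or.inr (Or.inr hx)
        · rw [mem_rest] at hxr
          rw [Finset.mem_insert, Finset.mem_insert]
          tauto
    exact C.elim hV h

open scoped Classical in
/-- No vertex of `Q` has three outer `B`-neighbours. -/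
theorem not_three_blue (hV : Fintype.card V = 14) (h : FanFreePair B R) (J : Join B R T Q)
    {x y z q : V} (hx : x ∈ near B T Q) (hy : y ∈ near B T Q) (hz : z ∈ near B T Q) (hq : q ∈ Q)
    (hxy : x ≠ y) (hxz : x ≠ z) (hyz : y ≠ z) (h₁ : B.Adj x q) (h₂ : B.Adj y q) : R.Adj z q := by
  refine (h.total (by rintro rfl; exact not_mem_Q_of_near hz hq)).resolve_left fun h₃ => ?_
  have h1 := (J.card_blue_near hV h hq).2
  have h2 : ({x, y, z} : Finset V) ⊆ {z ∈ near B T Q | B.Adj z q} := by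
    simp only [Finset.insert_subset_iff, Finset.singleton_subset_iff, Finset.mem_filter]
    exact ⟨⟨hx, h₁⟩, ⟨hy, h₂⟩, ⟨hz, h₃⟩⟩
  have h3 := Finset.card_le_card h2
  rw [Finset.card_insert_of_notMem, Finset.card_pair hyz] at h3
  · omega
  · simp only [Finset.mem_insert, Finset.mem_singleton, not_or]
    exact ⟨hxy, hxz⟩

/-- Among three near vertices, none is completely `B`-joined to `Q`. -/
theorem exists_red_of_three_near (hV : Fintype.card V = 14) (h : FanFreePair B R)
    (J : Join B R T Q) {x y z : V} (hx : x ∈ near B T Q) (hy : y ∈ near B T Q)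
    (hz : z ∈ near B T Q) (hxy : x ≠ y) (hxz : x ≠ z) (hyz : y ≠ z)
    (hfar : #(far R T Q) = 5) : ∃ q ∈ Q, R.Adj x q := by
  classical
  by_contra! hcon
  replace hcon : ∀ q ∈ Q, B.Adj x q := fun q hq =>
    (h.total (by rintro rfl; exact not_mem_Q_of_near hx hq)).resolve_right (hcon q hq)
  -- A `B`-neighbour of `z` in `Q` is already one of `x`, so it is an `R`-neighbour of `y`.
  have aux : ∀ y z, y ∈ near B T Q → z ∈ near B T Q → x ≠ y → x ≠ z → y ≠ z →
      R.Adj y x ∧ ∀ w ∈ far R T Q, B.Adj y w := by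
    intro y z hy hz hxy hxz hyz
    obtain ⟨q, hq, hyq⟩ := (mem_near.1 hy).2
    have hyx := J.near_pair_red h (mem_near.1 hy).1 (mem_near.1 hx).1 hq hxy.symm hyq (hcon q hq)
    refine ⟨hyx, ?_⟩
    obtain ⟨q', hq', hzq'⟩ := (mem_near.1 hz).2
    exact J.near_blue_far h hy hx hq' hyx
      (J.not_three_blue hV h hx hz hy hq' hxz hxy hyz.symm (hcon q' hq') hzq')
  obtain ⟨hyx, hyw⟩ := aux y z hy hz hxy hxz hyz
  obtain ⟨hzx, hzw⟩ := aux z y hz hy hxz hxy hyz.symm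
  rcases h.total hyz with hB | hR
  · obtain ⟨w, hw⟩ := Finset.card_pos.1 (by omega : 0 < #(far R T Q))
    exact h.false_of_five_add_one hfar (J.far_maxDegTwo h) hyw hB
      (fun hzf => ne_near_far h hz hzf rfl) ⟨w, hw, hzw w hw⟩
      fun u hu _ _ _ _ _ _ _ hR _ _ => h.disj (hzw u hu) hR
  · refine h.swap.cliqueFree_six hV (insert x (insert y (insert z T))) ?_
    refine SimpleGraph.IsNClique.insert (SimpleGraph.IsNClique.insert (SimpleGraph.IsNClique.insert
      ⟨fun x hx y hy hxy => J.redT x hx y hy hxy, J.cardT⟩ fun t ht => J.near_red h hz ht) ?_) ?_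
    · intro t ht
      rw [Finset.mem_insert] at ht
      rcases ht with rfl | ht
      exacts [hR, J.near_red h hy ht]
    · intro t ht
      rw [Finset.mem_insert, Finset.mem_insert] at ht
      rcases ht with rfl | rfl | ht
      exacts [hyx.symm, hzx.symm, J.near_red h hx ht]

end Join

end FanFreePair

/-! ### Joins with three near vertices. -/

namespace FanFreePair

variable {V : Type*} {B R : SimpleGraph V}

namespace Join

variable [Fintype V] {T Q : Finset V}

open scoped Classical in
theorem card_red_rest (h : FanFreePair B R) (w : V) :
    #{x ∈ rest T Q | R.Adj w x} ≤ #{x ∈ near B T Q | R.Adj w x} + #{x ∈ far R T Q | R.Adj w x} := by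
  refine (Finset.card_le_card fun x hx => ?_).trans (Finset.card_union_le _ _)
  rw [Finset.mem_filter] at hx
  rw [Finset.mem_union, Finset.mem_filter, Finset.mem_filter]
  exact (near_or_far h hx.1).imp (fun hn => ⟨hn, hx.2⟩) fun hf => ⟨hf, hx.2⟩

open scoped Classical in
/-- If there are three near vertices, each with an `R`-neighbour in `Q`, then near and far vertices
are completely `B`-joined. -/
theorem near_blue_far_of_three (hV : Fintype.card V = 14) (h : FanFreePair B R)
    (J : Join B R T Q) (hnear : #(near B T Q) = 3)
    (hred : ∀ z ∈ near B T Q, ∃ q ∈ Q, R.Adj z q) {w z : V} (hw : w ∈ far R T Q)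
    (hz : z ∈ near B T Q) : B.Adj w z := by
  refine (h.total (ne_near_far h hz hw).symm).resolve_right fun hwz => ?_
  have hblue : ∀ u ∈ near B T Q, R.Adj w u → ∀ x ∈ near B T Q, x ≠ u → B.Adj u x := by
    intro u hu hwu x hx hxu
    obtain ⟨q, hq, huq⟩ := hred u hu
    exact (h.total hxu.symm).resolve_right fun hR =>
      J.near_red_far h hu hx hw hq hR hwu.symm huq
  have hT : #{x ∈ T | R.Adj w x} = 0 := by
    rw [Finset.card_eq_zero, Finset.filter_eq_empty_iff]
    intro t ht hR
    obtain ⟨x, hx, y, hy, hxz, hyz, hxy⟩ := exists_other_two hnear hz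
    exact h.disj (J.blue_of_two_near h ht hx hy hxy (mem_near.1 hz).1 (mem_far.1 hw).1
      (ne_near_far h hz hw) (J.near_red h hz ht).symm hR.symm hxz.symm hyz.symm
      (ne_near_far h hx hw).symm (ne_near_far h hy hw).symm) hwz.symm
  have hfar : #{x ∈ far R T Q | R.Adj w x} ≤ 1 := by
    obtain ⟨q, hq, hzq⟩ := hred z hz
    exact card_filter_le_one fun a ha b hb hab hwa hwb =>
      J.far_red_near h hw ha hb hz hq hab hwa hwb hwz hzq
  -- Of the at least six `R`-neighbours of `w`, three are in `Q`, none in `T` and at most one is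
  -- far; so at least two are near.
  have hbound := (J.card_red_bounds hV h w).1
  rw [hT, Finset.filter_true_of_mem (mem_far.1 hw).2, J.cardQ] at hbound
  have hle := card_red_rest (T := T) (Q := Q) h w
  have hall : ∀ x ∈ near B T Q, ∀ y ∈ near B T Q, x ≠ y → B.Adj x y := by
    intro x hx y hy hxy
    by_cases hwx : R.Adj w x
    · exact hblue x hx hwx y hy hxy.symm
    by_cases hwy : R.Adj w y
    · exact (hblue y hy hwy x hx hxy).symm
    have h1 : {x ∈ near B T Q | R.Adj w x} ⊆ ((near B T Q).erase x).erase y := by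
      intro u hu
      rw [Finset.mem_filter] at hu
      rw [Finset.mem_erase, Finset.mem_erase]
      exact ⟨by rintro rfl; exact hwy hu.2, by rintro rfl; exact hwx hu.2, hu.1⟩
    have h2 := Finset.card_le_card h1
    rw [Finset.card_erase_of_mem (Finset.mem_erase.2 ⟨hxy.symm, hy⟩), Finset.card_erase_of_mem hx,
      hnear] at h2
    omega
  have huniq : ∀ x ∈ near B T Q, ∀ y ∈ near B T Q, x ≠ y → ∀ q ∈ Q, B.Adj x q → R.Adj y q :=
    fun x hx y hy hxy q hq hxq =>
      (h.total (by rintro rfl; exact not_mem_Q_of_near hy hq)).resolve_left fun hyq =>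
        h.disj (hall x hx y hy hxy)
          (J.near_pair_red h (mem_near.1 hx).1 (mem_near.1 hy).1 hq hxy hxq hyq)
  have hneq : ∀ {x y q q'}, x ∈ near B T Q → y ∈ near B T Q → x ≠ y → q ∈ Q →
      B.Adj x q → B.Adj y q' → q ≠ q' := by
    rintro x y q _ hx hy hxy hq h1 h2 rfl
    exact h.disj h2 (huniq x hx y hy hxy q hq h1)
  have hwQ := (mem_far.1 hw).2
  have hnQ : ∀ x ∈ near B T Q, ∀ q ∈ Q, x ≠ q := by
    rintro x hx q hq rfl
    exact not_mem_Q_of_near hx hq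
  by_cases hN : #{x ∈ near B T Q | R.Adj w x} = 3
  · obtain ⟨x, hx, y, hy, u, hu, hxy, hxu, hyu⟩ := exists_three hN.ge
    rw [Finset.mem_filter] at hx hy hu
    obtain ⟨qx, hqx, hxq⟩ := (mem_near.1 hx.1).2
    obtain ⟨qy, hqy, hyq⟩ := (mem_near.1 hy.1).2
    obtain ⟨qu, hqu, huq⟩ := (mem_near.1 hu.1).2
    -- Each near vertex is matched cyclically to the private `B`-neighbour of the next one.
    exact h.fanR w x qy y qu u qx ⟨⟨hx.2, hwQ qy hqy, hy.2, hwQ qu hqu, hu.2, hwQ qx hqx⟩,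
      ⟨huniq y hy.1 x hx.1 hxy.symm qy hqy hyq, huniq u hu.1 y hy.1 hyu.symm qu hqu huq,
        huniq x hx.1 u hu.1 hxu qx hqx hxq⟩,
      ⟨hxy, hnQ x hx.1 qu hqu, (hnQ y hy.1 qy hqy).symm, hneq hy.1 hu.1 hyu hqy hyq huq⟩,
      ⟨hxu, hnQ x hx.1 qx hqx, (hnQ u hu.1 qy hqy).symm, hneq hy.1 hx.1 hxy.symm hqy hyq hxq⟩,
      ⟨hyu, hnQ y hy.1 qx hqx, (hnQ u hu.1 qu hqu).symm, hneq hu.1 hx.1 hxu.symm hqu huq hxq⟩⟩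
  have hN' : #{x ∈ near B T Q | R.Adj w x} ≤ 3 :=
    (Finset.card_filter_le _ _).trans hnear.le
  obtain ⟨x, hx, y, hy, hxy⟩ := Finset.one_lt_card.1
    (by omega : 1 < #{x ∈ near B T Q | R.Adj w x})
  obtain ⟨a, ha⟩ := Finset.card_pos.1 (by omega : 0 < #{x ∈ far R T Q | R.Adj w x})
  rw [Finset.mem_filter] at hx hy ha
  have htwo : ∀ x ∈ near B T Q, 2 ≤ #{q ∈ Q | R.Adj x q} := by
    intro x hx
    obtain ⟨y, hy, u, hu, hyx, hux, hyu⟩ := exists_other_two hnear hx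
    obtain ⟨qy, hqy, hyq⟩ := (mem_near.1 hy).2
    obtain ⟨qu, hqu, huq⟩ := (mem_near.1 hu).2
    rw [← Finset.card_pair (hneq hy hu hyu hqy hyq huq)]
    refine Finset.card_le_card ?_
    simp only [Finset.insert_subset_iff, Finset.singleton_subset_iff, Finset.mem_filter]
    exact ⟨⟨hqy, huniq y hy x hx hyx qy hqy hyq⟩, ⟨hqu, huniq u hu x hx hux qu hqu huq⟩⟩
  have ha' := mem_far.1 ha.1
  rw [mem_rest] at ha'
  have haQ : ∀ q ∈ Q, q ≠ a := by rintro q hq rfl; exact ha'.1.2 hq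
  have hx2 := htwo x hx.1
  have hy2 := htwo y hy.1
  refine h.false_of_matching_into hx.2 hy.2 ha.2 hxy (ne_near_far h hx.1 ha.1)
    (ne_near_far h hy.1 ha.1) (s₁ := {q ∈ Q | R.Adj x q}) (s₂ := {q ∈ Q | R.Adj y q}) (s₃ := Q)
    ?_ ?_ ?_ (by omega) hy2 (by rw [J.cardQ])
  · intro q hq
    rw [Finset.mem_filter] at hq
    exact ⟨hwQ q hq.1, hq.2, (hnQ y hy.1 q hq.1).symm, haQ q hq.1⟩
  · intro q hq
    rw [Finset.mem_filter] at hq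
    exact ⟨hwQ q hq.1, hq.2, (hnQ x hx.1 q hq.1).symm, haQ q hq.1⟩
  · exact fun q hq => ⟨hwQ q hq, ha'.2 q hq, (hnQ x hx.1 q hq).symm, (hnQ y hy.1 q hq).symm⟩

/-- The five far vertices are completely `B`-joined to the near ones. Matching into the near set
bounds their `B`-degrees among themselves by two, so they induce an `R`-cycle, and each has exactly
one `R`-neighbour in `T`. A vertex of `T` with four far `B`-neighbours then centres a `B`-fan with
one blade in `Q`. -/
theorem card_near_ne_three (hV : Fintype.card V = 14) (h : FanFreePair B R) (J : Join B R T Q) :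
    #(near B T Q) ≠ 3 := by
  classical
  intro h3
  have h5 : #(far R T Q) = 5 := by have := J.card_near_add_card_far hV h; omega
  have hred : ∀ z ∈ near B T Q, ∃ q ∈ Q, R.Adj z q := by
    intro z hz
    obtain ⟨x, hx, y, hy, hxz, hyz, hxy⟩ := exists_other_two h3 hz
    exact J.exists_red_of_three_near hV h hz hx hy hxz.symm hyz.symm hxy h5
  have hB : ∀ w ∈ far R T Q, ∀ z ∈ near B T Q, B.Adj w z := fun w hw z hz =>
    J.near_blue_far_of_three hV h h3 hred hw hz
  have hfr : ∀ w ∈ far R T Q, #{x ∈ far R T Q | R.Adj w x} = 2 := by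
    intro w hw
    have hle : #{x ∈ far R T Q | R.Adj w x} ≤ 2 := card_filter_le_two
      fun a ha b hb c hc h1 h2 h3 h4 h5 h6 => J.far_maxDegTwo h w hw a ha b hb c hc h1 h2 h3 h4 h5 h6
    have hsplit := h.card_add_card (s := (far R T Q).erase w) (v := w) (by simp)
    rw [Finset.card_erase_of_mem hw] at hsplit
    have hsub : #{x ∈ (far R T Q).erase w | R.Adj w x} ≤ #{x ∈ far R T Q | R.Adj w x} :=
      Finset.card_le_card (Finset.filter_subset_filter _ (Finset.erase_subset _ _))
    have hb : #{x ∈ (far R T Q).erase w | B.Adj w x} ≤ 2 := by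
      refine card_filter_le_two fun a ha b hb c hc hab hac hbc h1 h2 h3' => ?_
      have ha := Finset.mem_of_mem_erase ha
      have hb := Finset.mem_of_mem_erase hb
      have hc := Finset.mem_of_mem_erase hc
      refine h.swap.false_of_matching_into h1 h2 h3' hab hac hbc (s₁ := near B T Q)
        (s₂ := near B T Q) (s₃ := near B T Q) ?_ ?_ ?_ (by omega) (by omega) (by omega)
      · exact fun x hx => ⟨hB w hw x hx, hB a ha x hx, ne_near_far h hx hb, ne_near_far h hx hc⟩
      · exact fun x hx => ⟨hB w hw x hx, hB b hb x hx, ne_near_far h hx ha, ne_near_far h hx hc⟩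
      · exact fun x hx => ⟨hB w hw x hx, hB c hc x hx, ne_near_far h hx ha, ne_near_far h hx hb⟩
    omega
  have hone : ∀ w ∈ far R T Q, #{t ∈ T | R.Adj w t} = 1 := by
    intro w hw
    have hbound := (J.card_red_bounds hV h w).1
    rw [Finset.filter_true_of_mem (mem_far.1 hw).2, J.cardQ] at hbound
    have hle := card_red_rest (T := T) (Q := Q) h w
    have hzero : #{x ∈ near B T Q | R.Adj w x} = 0 := by
      rw [Finset.card_eq_zero, Finset.filter_eq_empty_iff]
      exact fun z hz hR => h.disj (hB w hw z hz) hR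
    rw [hzero, hfr w hw] at hle
    have hT : #{t ∈ T | R.Adj w t} ≤ 1 := by
      refine card_filter_le_one fun t ht t' ht' htt' h1 h2 => ?_
      obtain ⟨a, ha, b, hb, hab⟩ := Finset.one_lt_card.1
        (by rw [hfr w hw]; omega : 1 < #{x ∈ far R T Q | R.Adj w x})
      rw [Finset.mem_filter] at ha hb
      have hne : ∀ s : Finset V, ∀ x ∉ s, ∀ y ∈ s, y ≠ x := by rintro s x hx y hy rfl; exact hx hy
      have haT := (mem_rest.1 (mem_far.1 ha.1).1).1
      have hbT := (mem_rest.1 (mem_far.1 hb.1).1).1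
      exact J.far_red_edge h hw ha.1 hb.1 hab ha.2 hb.2 h1 h2 (hne T a haT t ht) (hne T b hbT t ht)
        (hne T a haT t' ht') (hne T b hbT t' ht') (Finset.disjoint_left.1 J.disjoint ht)
        (Finset.disjoint_left.1 J.disjoint ht') (J.redT t ht t' ht' htt')
    omega
  -- Otherwise each vertex of `T` has exactly two far `R`-neighbours, giving six `R`-edges between
  -- `T` and the far vertices instead of five.
  obtain ⟨t, ht, ht4⟩ : ∃ t ∈ T, #{w ∈ far R T Q | B.Adj t w} = 4 := by
    by_contra! hcon
    have h1 := Finset.sum_card_bipartiteAbove_eq_sum_card_bipartiteBelow (s := T)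
      (t := far R T Q) R.Adj
    rw [Finset.sum_congr rfl fun t ht => (show #(Finset.bipartiteAbove R.Adj (far R T Q) t) = 2 by
      have k1 := J.card_blue_far hV h ht
      have k2 := hcon t ht
      have k3 := h.card_add_card (s := far R T Q) (v := t)
        fun htf => (mem_rest.1 (mem_far.1 htf).1).1 ht
      change #{w ∈ far R T Q | R.Adj t w} = 2
      omega),
      Finset.sum_congr rfl fun w hw => (show #(Finset.bipartiteBelow R.Adj T w) = 1 by
        rw [← hone w hw]
        simp only [Finset.bipartiteBelow, R.adj_comm _ w]), Finset.sum_const, Finset.sum_const,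
      J.cardT, h5] at h1
    simp at h1
  obtain ⟨q₁, hq₁, q₂, hq₂, hq⟩ := Finset.one_lt_card.1 (by rw [J.cardQ]; omega : 1 < #Q)
  obtain ⟨a, ha, b, hb, c, hc, d, hd, hab, hac, hbc, had, hbd, hcd⟩ := exists_four ht4.ge
  rw [Finset.mem_filter] at ha hb hc hd
  have hne : ∀ w ∈ far R T Q, ∀ q ∈ Q, q ≠ w := by
    rintro w hw q hq rfl
    exact (mem_rest.1 (mem_far.1 hw).1).2 hq
  have hfan : ∀ a ∈ far R T Q, ∀ b ∈ far R T Q, ∀ c ∈ far R T Q, ∀ d ∈ far R T Q, B.Adj t a →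
      B.Adj t b → B.Adj t c → B.Adj t d → a ≠ c → a ≠ d → b ≠ c → b ≠ d →
      ¬ (B.Adj a b ∧ B.Adj c d) := by
    intro a ha b hb c hc d hd h1 h2 h3 h4 h5 h6 h7 h8 h9
    exact h.fanB t q₁ q₂ a b c d ⟨⟨J.join t ht q₁ hq₁, J.join t ht q₂ hq₂, h1, h2, h3, h4⟩,
      ⟨J.blueQ q₁ hq₁ q₂ hq₂ hq, h9.1, h9.2⟩,
      ⟨hne a ha q₁ hq₁, hne b hb q₁ hq₁, hne a ha q₂ hq₂, hne b hb q₂ hq₂⟩,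
      ⟨hne c hc q₁ hq₁, hne d hd q₁ hq₁, hne c hc q₂ hq₂, hne d hd q₂ hq₂⟩, ⟨h5, h6, h7, h8⟩⟩
  have hdeg := J.far_maxDegTwo h
  -- A triangle in a 2-regular graph on five vertices would leave two vertices that cannot have
  -- degree two.
  have htri : ∀ a ∈ far R T Q, ∀ b ∈ far R T Q, ∀ c ∈ far R T Q, ∀ d ∈ far R T Q, a ≠ d → b ≠ d →
      c ≠ d → ¬ (R.Adj a b ∧ R.Adj a c ∧ R.Adj b c) := by
    intro a ha b hb c hc d hd h1 h2 h3 ⟨hab, hac, hbc⟩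
    have hsub : {x ∈ far R T Q | R.Adj d x} ⊆ ((((far R T Q).erase a).erase b).erase c).erase d := by
      intro x hx
      rw [Finset.mem_filter] at hx
      simp only [Finset.mem_erase]
      refine ⟨hx.2.ne', ?_, ?_, ?_, hx.1⟩
      · rintro rfl
        exact hdeg x hc a ha b hb d hd hab.ne h1 h2 hac.symm hbc.symm hx.2.symm
      · rintro rfl
        exact hdeg x hb a ha c hc d hd hac.ne h1 h3 hab.symm hbc hx.2.symm
      · rintro rfl
        exact hdeg x ha b hb c hc d hd hbc.ne h2 h3 hab hac hx.2.symm
    have hcard := Finset.card_le_card hsub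
    rw [hfr d hd, Finset.card_erase_of_mem, Finset.card_erase_of_mem, Finset.card_erase_of_mem,
      Finset.card_erase_of_mem ha, h5] at hcard
    · omega
    all_goals simp only [Finset.mem_erase]
    · exact ⟨hab.ne', hb⟩
    · exact ⟨hbc.ne', hac.ne', hc⟩
    · exact ⟨h3.symm, h2.symm, h1.symm, hd⟩
  have hdeg' : ∀ w ∈ far R T Q, ∀ x ∈ far R T Q, ∀ y ∈ far R T Q, ∀ z ∈ far R T Q, x ≠ y → x ≠ z →
      y ≠ z → ¬ (R.Adj w x ∧ R.Adj w y ∧ R.Adj w z) :=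
    fun w hw x hx y hy z hz h1 h2 h3 h4 => hdeg w hw x hx y hy z hz h1 h2 h3 h4.1 h4.2.1 h4.2.2
  rcases h.matching_four (w := a) (x := b) (y := c) (z := d)
    (by simp only [List.nodup_cons, List.mem_cons, List.not_mem_nil, or_false, not_or,
          not_false_eq_true, List.nodup_nil, and_true]; exact ⟨⟨hab, hac, had⟩, ⟨hbc, hbd⟩, hcd⟩)
    (hdeg' a ha.1 b hb.1 c hc.1 d hd.1 hbc hbd hcd) (hdeg' b hb.1 a ha.1 c hc.1 d hd.1 hac had hcd)
    (hdeg' c hc.1 a ha.1 b hb.1 d hd.1 hab had hbd) (hdeg' d hd.1 a ha.1 b hb.1 c hc.1 hab hac hbc)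
    with k | k | k | k | k | k | k
  · exact hfan a ha.1 b hb.1 c hc.1 d hd.1 ha.2 hb.2 hc.2 hd.2 hac had hbc hbd k
  · exact hfan a ha.1 c hc.1 b hb.1 d hd.1 ha.2 hc.2 hb.2 hd.2 hab had hbc.symm hcd k
  · exact hfan a ha.1 d hd.1 b hb.1 c hc.1 ha.2 hd.2 hb.2 hc.2 hab hac hbd.symm hcd.symm k
  · exact htri a ha.1 b hb.1 c hc.1 d hd.1 had hbd hcd k
  · exact htri a ha.1 b hb.1 d hd.1 c hc.1 hac hbc hcd.symm k
  · exact htri a ha.1 c hc.1 d hd.1 b hb.1 hab hbc.symm hbd.symm k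
  · exact htri b hb.1 c hc.1 d hd.1 a ha.1 hab.symm hac.symm had.symm k

theorem elim (hV : Fintype.card V = 14) (h : FanFreePair B R) (J : Join B R T Q) : False := by
  classical
  have h1 := J.card_near_le_three h
  have h2 := J.card_near_ne_one hV h
  have h3 := J.card_near_ne_two hV h
  have h4 := J.card_near_ne_three hV h
  obtain ⟨q, hq⟩ := Finset.card_pos.1 (by rw [J.cardQ]; omega : 0 < #Q)
  have h5 := (J.card_blue_near hV h hq).1
  have h6 := Finset.card_filter_le (near B T Q) fun z => B.Adj z q
  omega

end Join

end FanFreePair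

/-! ### No monochromatic clique of order five. -/

namespace FanFreePair

variable {V : Type*} {B R : SimpleGraph V}

open scoped Classical in
theorem TriangleJoin.elim [Fintype V] (hV : Fintype.card V = 14) (h : FanFreePair B R)
    {t₁ t₂ t₃ q₁ q₂ q₃ : V} (J : TriangleJoin B R t₁ t₂ t₃ q₁ q₂ q₃) : False := by
  refine Join.elim (T := {t₁, t₂, t₃}) (Q := {q₁, q₂, q₃}) hV h ⟨?_, ?_, ?_, ?_, ?_⟩
  · exact Finset.card_eq_three.2 ⟨_, _, _, J.t₁₂.ne, J.t₁₃.ne, J.t₂₃.ne, rfl⟩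
  · exact Finset.card_eq_three.2 ⟨_, _, _, J.q₁₂.ne, J.q₁₃.ne, J.q₂₃.ne, rfl⟩
  · have := (SimpleGraph.is3Clique_triple_iff.2 ⟨J.t₁₂, J.t₁₃, J.t₂₃⟩).1
    exact fun x hx y hy hxy => this hx hy hxy
  · have := (SimpleGraph.is3Clique_triple_iff.2 ⟨J.q₁₂, J.q₁₃, J.q₂₃⟩).1
    exact fun x hx y hy hxy => this hx hy hxy
  · simp only [Finset.mem_insert, Finset.mem_singleton, forall_eq_or_imp, forall_eq]
    exact ⟨⟨J.t₁q₁, J.t₁q₂, J.t₁q₃⟩, ⟨J.t₂q₁, J.t₂q₂, J.t₂q₃⟩, J.t₃q₁, J.t₃q₂, J.t₃q₃⟩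

open scoped Classical in
-- By counting, `u` and `w` have a common neighbour in `Y`; the remaining neighbours provide the
-- ends for `clique_five_two_paths`.
theorem clique_five_two_of_three (h : FanFreePair B R) {s Y : Finset V} (hs : R.IsNClique 5 s)
    (hY : Y ⊆ s) {u w : V} (hu : u ∉ s) (hw : w ∉ s) (huw : u ≠ w)
    (h3 : 3 ≤ #{x ∈ Y | R.Adj u x}) (h2 : 2 ≤ #{x ∈ Y | R.Adj w x})
    (h4 : #Y + 1 ≤ #{x ∈ Y | R.Adj u x} + #{x ∈ Y | R.Adj w x}) : False := by
  obtain ⟨x, hx⟩ : ({x ∈ Y | R.Adj u x} ∩ {x ∈ Y | R.Adj w x}).Nonempty := by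
    rw [← Finset.card_pos]
    have h5 := Finset.card_union_add_card_inter {x ∈ Y | R.Adj u x} {x ∈ Y | R.Adj w x}
    have h6 : #({x ∈ Y | R.Adj u x} ∪ {x ∈ Y | R.Adj w x}) ≤ #Y := Finset.card_le_card
      (Finset.union_subset (Finset.filter_subset _ _) (Finset.filter_subset _ _))
    omega
  simp only [Finset.mem_inter, Finset.mem_filter] at hx
  obtain ⟨z, hz, hzx⟩ := Finset.exists_mem_ne (by omega : 1 < #{x ∈ Y | R.Adj w x}) x
  obtain ⟨y, hy, hyx, hyz⟩ := exists_other_one h3 x z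
  rw [Finset.mem_filter] at hy hz
  exact h.clique_five_two_paths hs (hY hx.1.1) (hY hy.1) (hY hz.1) hyx.symm hzx.symm hyz hu hw huw
    hx.1.2.symm hx.2.2.symm hy.2.symm hz.2.symm

open scoped Classical in
-- The `R`-edges between the cliques form a matching. A vertex outside both with three
-- `B`-neighbours in each would centre a `B`-fan, since `K_{3,3}` minus a matching has a perfect
-- matching. So each outer vertex has three `R`-neighbours in one of the cliques, but a clique
-- admits only one such vertex, and three outer vertices are too many.
theorem false_of_disjoint_clique_five [Fintype V] (hV : Fintype.card V = 14)
    (h : FanFreePair B R) {s s' : Finset V} (hs : R.IsNClique 5 s) (hs' : R.IsNClique 5 s')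
    (hd : Disjoint s s') : False := by
  have hm : ∀ {s s' : Finset V}, R.IsNClique 5 s → R.IsNClique 5 s' → Disjoint s s' →
      ∀ x ∈ s, ∀ y ∈ s', ∀ z ∈ s', y ≠ z → R.Adj x y → R.Adj x z → False :=
    fun hs hs' hd x hx y hy z hz hyz hxy hxz => h.clique_five_outside_edge hs hx
      (Finset.disjoint_right.1 hd hy) (Finset.disjoint_right.1 hd hz) hxy hxz (hs'.1 hy hz hyz)
  have hout : ∀ w ∉ s, w ∉ s' → 3 ≤ #{x ∈ s | R.Adj w x} ∨ 3 ≤ #{x ∈ s' | R.Adj w x} := by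
    intro w hw hw'
    by_contra! hcon
    have k1 := h.card_add_card hw
    have k2 := h.card_add_card hw'
    rw [hs.2] at k1
    rw [hs'.2] at k2
    obtain ⟨x₁, hx₁, x₂, hx₂, x₃, hx₃, hx₁₂, hx₁₃, hx₂₃⟩ :=
      exists_three (s := {x ∈ s | B.Adj w x}) (by omega)
    obtain ⟨y₁, hy₁, y₂, hy₂, y₃, hy₃, hy₁₂, hy₁₃, hy₂₃⟩ :=
      exists_three (s := {x ∈ s' | B.Adj w x}) (by omega)
    rw [Finset.mem_filter] at hx₁ hx₂ hx₃ hy₁ hy₂ hy₃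
    have hne : ∀ x ∈ s, ∀ y ∈ s', x ≠ y := fun x hx y hy hxy =>
      Finset.disjoint_left.1 hd hx (hxy ▸ hy)
    have hf : ∀ a b c, (a ∈ s' ∧ B.Adj w a) → (b ∈ s' ∧ B.Adj w b) → (c ∈ s' ∧ B.Adj w c) →
        a ≠ b → a ≠ c → b ≠ c → B.Adj x₁ a → B.Adj x₂ b → B.Adj x₃ c → False := by
      intro a b c ha hb hc n1 n2 n3 h1 h2 h3
      exact h.fanB w x₁ a x₂ b x₃ c ⟨⟨hx₁.2, ha.2, hx₂.2, hb.2, hx₃.2, hc.2⟩, ⟨h1, h2, h3⟩,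
        ⟨hx₁₂, hne _ hx₁.1 _ hb.1, (hne _ hx₂.1 _ ha.1).symm, n1⟩,
        ⟨hx₁₃, hne _ hx₁.1 _ hc.1, (hne _ hx₃.1 _ ha.1).symm, n2⟩,
        ⟨hx₂₃, hne _ hx₂.1 _ hc.1, (hne _ hx₃.1 _ hb.1).symm, n3⟩⟩
    have hrow : ∀ x, (x ∈ s ∧ B.Adj w x) → ∀ y, (y ∈ s' ∧ B.Adj w y) → ∀ z,
        (z ∈ s' ∧ B.Adj w z) → y ≠ z → R.Adj x y → B.Adj x z := fun x hx y hy z hz hyz hxy =>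
      (h.total (hne x hx.1 z hz.1)).resolve_right (hm hs hs' hd x hx.1 y hy.1 z hz.1 hyz hxy)
    have hcol : ∀ x, (x ∈ s ∧ B.Adj w x) → ∀ x', (x' ∈ s ∧ B.Adj w x') → ∀ y,
        (y ∈ s' ∧ B.Adj w y) → x ≠ x' → R.Adj x y → B.Adj x' y := fun x hx x' hx' y hy hxx hxy =>
      (h.total (hne x' hx'.1 y hy.1)).resolve_right fun hr =>
        hm hs' hs hd.symm y hy.1 x hx.1 x' hx'.1 hxx hxy.symm hr.symm
    have htot : ∀ x, (x ∈ s ∧ B.Adj w x) → ∀ y, (y ∈ s' ∧ B.Adj w y) → B.Adj x y ∨ R.Adj x y :=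
      fun x hx y hy => h.total (hne x hx.1 y hy.1)
    have key : ∀ a b c, (a ∈ s' ∧ B.Adj w a) → (b ∈ s' ∧ B.Adj w b) → (c ∈ s' ∧ B.Adj w c) →
        a ≠ b → a ≠ c → b ≠ c → R.Adj x₁ a → False := by
      intro a b c ha hb hc n1 n2 n3 h1
      have e1 := hrow x₁ hx₁ a ha b hb n1 h1
      have e2 := hrow x₁ hx₁ a ha c hc n2 h1
      have e3 := hcol x₁ hx₁ x₂ hx₂ a ha hx₁₂ h1
      have e4 := hcol x₁ hx₁ x₃ hx₃ a ha hx₁₃ h1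
      rcases htot x₃ hx₃ c hc with e5 | e5
      · exact hf b a c hb ha hc n1.symm n3 n2 e1 e3 e5
      rcases htot x₂ hx₂ c hc with e6 | e6
      · exact hf b c a hb hc ha n3 n1.symm n2.symm e1 e6 e4
      exact h.disj (hcol x₃ hx₃ x₂ hx₂ c hc hx₂₃.symm e5) e6
    have f1 := fun hr => key y₁ y₂ y₃ hy₁ hy₂ hy₃ hy₁₂ hy₁₃ hy₂₃ hr
    have f2 := fun hr => key y₂ y₁ y₃ hy₂ hy₁ hy₃ hy₁₂.symm hy₂₃ hy₁₃ hr
    have f3 := fun hr => key y₃ y₁ y₂ hy₃ hy₁ hy₂ hy₁₃.symm hy₂₃.symm hy₁₂ hr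
    have g1 := (htot x₁ hx₁ y₁ hy₁).resolve_right f1
    have g2 := (htot x₁ hx₁ y₂ hy₂).resolve_right f2
    rcases htot x₂ hx₂ y₂ hy₂ with e | e
    · rcases htot x₃ hx₃ y₃ hy₃ with e' | e'
      · exact hf y₁ y₂ y₃ hy₁ hy₂ hy₃ hy₁₂ hy₁₃ hy₂₃ g1 e e'
      · exact hf y₁ y₃ y₂ hy₁ hy₃ hy₂ hy₁₃ hy₁₂ hy₂₃.symm g1
          (hcol x₃ hx₃ x₂ hx₂ y₃ hy₃ hx₂₃.symm e') (hrow x₃ hx₃ y₃ hy₃ y₂ hy₂ hy₂₃.symm e')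
    · exact hf y₁ y₃ y₂ hy₁ hy₃ hy₂ hy₁₃ hy₁₂ hy₂₃.symm g1
        (hrow x₂ hx₂ y₂ hy₂ y₃ hy₃ hy₂₃ e) (hcol x₂ hx₂ x₃ hx₃ y₂ hy₂ hx₂₃ e)
  have huniq : ∀ {s : Finset V}, R.IsNClique 5 s → ∀ u ∉ s, ∀ w ∉ s, u ≠ w →
      3 ≤ #{x ∈ s | R.Adj u x} → 3 ≤ #{x ∈ s | R.Adj w x} → False :=
    fun {s} hs u hu w hw huw h1 h2 =>
      h.clique_five_two_of_three hs subset_rfl hu hw huw h1 (by omega) (by rw [hs.2]; omega)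
  obtain ⟨a, ha, b, hb, c, hc, hab, hac, hbc⟩ := exists_three (s := (s ∪ s')ᶜ) (by
    rw [Finset.card_compl, Finset.card_union_of_disjoint hd, hs.2, hs'.2, hV]; omega)
  simp only [Finset.mem_compl, Finset.mem_union, not_or] at ha hb hc
  have hab' := huniq hs a ha.1 b hb.1 hab
  have hac' := huniq hs a ha.1 c hc.1 hac
  have hbc' := huniq hs b hb.1 c hc.1 hbc
  have hab'' := huniq hs' a ha.2 b hb.2 hab
  have hac'' := huniq hs' a ha.2 c hc.2 hac
  have hbc'' := huniq hs' b hb.2 c hc.2 hbc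
  rcases hout a ha.1 ha.2 with k1 | k1 <;> rcases hout b hb.1 hb.2 with k2 | k2 <;>
    rcases hout c hc.1 hc.2 with k3 | k3
  exacts [hab' k1 k2, hab' k1 k2, hac' k1 k3, hbc'' k2 k3, hbc' k2 k3, hac'' k1 k3, hab'' k1 k2,
    hab'' k1 k2]

open scoped Classical in
theorem clique_five_card_outside [Fintype V] (hV : Fintype.card V = 14) (h : FanFreePair B R)
    {s : Finset V} (hs : R.IsNClique 5 s) {x : V} (hx : x ∈ s) :
    2 ≤ #{w ∈ sᶜ | R.Adj x w} ∧ #{w ∈ sᶜ | R.Adj x w} ≤ 3 := by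
  have h1 := h.card_red_le_seven hV x
  have h2 := h.card_blue_le_seven hV x
  have h3 := h.card_blue_add_card_red hV x
  have h4 : #{w | R.Adj x w} = #(s.erase x) + #{w ∈ sᶜ | R.Adj x w} := by
    rw [← Finset.card_union_of_disjoint]
    · congr 1
      ext w
      simp only [Finset.mem_filter, Finset.mem_univ, true_and, Finset.mem_union, Finset.mem_erase,
        Finset.mem_compl]
      constructor
      · intro hw
        by_cases hws : w ∈ s
        · exact Or.inl ⟨hw.ne', hws⟩
        · exact Or.inr ⟨hws, hw⟩
      · rintro (hw | hw)
        · exact hs.1 hx hw.2 hw.1.symm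
        · exact hw.2
    · rw [Finset.disjoint_left]
      intro w hw hw'
      exact Finset.mem_compl.1 (Finset.mem_filter.1 hw').1 (Finset.mem_of_mem_erase hw)
  rw [Finset.card_erase_of_mem hx, hs.2] at h4
  omega

open scoped Classical in
-- A `B`-edge between two of the triangles leaves an edge in each, giving three blades at the vertex
-- joined to both. So the triples are completely `R`-joined, and a vertex of one centres an `R`-fan
-- matching the other two.
theorem false_of_three_disjoint (h : FanFreePair B R) {i j l : V} {a b c : Finset V}
    (ha : #a = 3) (hb : #b = 3) (hc : #c = 3) (haB : ∀ x ∈ a, ∀ y ∈ a, x ≠ y → B.Adj x y)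
    (hbB : ∀ x ∈ b, ∀ y ∈ b, x ≠ y → B.Adj x y) (hcB : ∀ x ∈ c, ∀ y ∈ c, x ≠ y → B.Adj x y)
    (hab : Disjoint a b) (hac : Disjoint a c) (hbc : Disjoint b c)
    (hi : ∀ x ∈ b ∪ c, B.Adj i x) (hj : ∀ x ∈ a ∪ c, B.Adj j x) (hl : ∀ x ∈ a ∪ b, B.Adj l x) :
    False := by
  have key : ∀ {i : V} {b c : Finset V}, #b = 3 → #c = 3 →
      (∀ x ∈ b, ∀ y ∈ b, x ≠ y → B.Adj x y) → (∀ x ∈ c, ∀ y ∈ c, x ≠ y → B.Adj x y) →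
      Disjoint b c → (∀ x ∈ b ∪ c, B.Adj i x) → ∀ x ∈ b, ∀ y ∈ c, R.Adj x y := by
    intro i b c hb hc hbB hcB hbc hi x hx y hy
    have hne : ∀ x ∈ b, ∀ y ∈ c, x ≠ y := fun x hx y hy hxy =>
      Finset.disjoint_left.1 hbc hx (hxy ▸ hy)
    refine (h.total (hne x hx y hy)).resolve_left fun hxy => ?_
    obtain ⟨x₁, hx₁, x₂, hx₂, n1, n2, n3⟩ := exists_other_two hb hx
    obtain ⟨y₁, hy₁, y₂, hy₂, m1, m2, m3⟩ := exists_other_two hc hy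
    have hib := fun x hx => hi x (Finset.mem_union_left c hx)
    have hic := fun x hx => hi x (Finset.mem_union_right b hx)
    exact h.fanB i x y x₁ x₂ y₁ y₂ ⟨⟨hib x hx, hic y hy, hib _ hx₁, hib _ hx₂, hic _ hy₁,
      hic _ hy₂⟩, ⟨hxy, hbB _ hx₁ _ hx₂ n3, hcB _ hy₁ _ hy₂ m3⟩,
      ⟨n1.symm, n2.symm, (hne _ hx₁ _ hy).symm, (hne _ hx₂ _ hy).symm⟩,
      ⟨hne _ hx _ hy₁, hne _ hx _ hy₂, m1.symm, m2.symm⟩,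
      ⟨hne _ hx₁ _ hy₁, hne _ hx₁ _ hy₂, hne _ hx₂ _ hy₁, hne _ hx₂ _ hy₂⟩⟩
  have hab' := key ha hb haB hbB hab hl
  have hac' := key ha hc haB hcB hac hj
  have hbc' := key hb hc hbB hcB hbc hi
  obtain ⟨x, hx⟩ := Finset.card_pos.1 (by omega : 0 < #a)
  obtain ⟨y₁, hy₁, y₂, hy₂, y₃, hy₃, n1, n2, n3⟩ := exists_three hb.ge
  obtain ⟨z₁, hz₁, z₂, hz₂, z₃, hz₃, m1, m2, m3⟩ := exists_three hc.ge
  exact h.fanR x y₁ z₁ y₂ z₂ y₃ z₃ ⟨⟨hab' x hx _ hy₁, hac' x hx _ hz₁, hab' x hx _ hy₂,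
    hac' x hx _ hz₂, hab' x hx _ hy₃, hac' x hx _ hz₃⟩,
    ⟨hbc' _ hy₁ _ hz₁, hbc' _ hy₂ _ hz₂, hbc' _ hy₃ _ hz₃⟩,
    ⟨n1, (hbc' _ hy₁ _ hz₂).ne, (hbc' _ hy₂ _ hz₁).ne', m1⟩,
    ⟨n2, (hbc' _ hy₁ _ hz₃).ne, (hbc' _ hy₃ _ hz₁).ne', m2⟩,
    ⟨n3, (hbc' _ hy₂ _ hz₃).ne, (hbc' _ hy₃ _ hz₂).ne', m3⟩⟩

open scoped Classical in
theorem clique_five_card_le_two_or_sum_le (h : FanFreePair B R) {s Y t : Finset V}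
    (hs : R.IsNClique 5 s) (hY : Y ⊆ s) (hYc : #Y = 4) (ht : #t = 4) (hst : Disjoint s t) :
    (∀ b ∈ t, #{y ∈ Y | R.Adj b y} ≤ 2) ∨ ∑ b ∈ t, #{y ∈ Y | R.Adj b y} ≤ 7 := by
  refine or_iff_not_imp_left.2 fun hcon => ?_
  push Not at hcon
  obtain ⟨b, hb, hb3⟩ := hcon
  have h1 : ∑ b ∈ t.erase b, #{y ∈ Y | R.Adj b y} ≤ #(t.erase b) * 1 := by
    refine Finset.sum_le_card_nsmul _ _ _ fun c hc => ?_
    rw [Finset.mem_erase] at hc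
    by_contra! hc2
    exact h.clique_five_two_of_three hs hY (Finset.disjoint_right.1 hst hb)
      (Finset.disjoint_right.1 hst hc.2) hc.1.symm hb3 hc2 (by omega)
  have h2 : #{y ∈ Y | R.Adj b y} ≤ #Y := Finset.card_filter_le _ _
  rw [← Finset.add_sum_erase _ _ hb]
  rw [Finset.card_erase_of_mem hb] at h1
  omega

open scoped Classical in
-- Of the 16 pairs between `t` and `s.erase x`, at most eight are in `R`, and exchanging the roles
-- of the cliques at most eight are in `B`. Equality holds throughout.
theorem crossing_cliques_card (h : FanFreePair B R) {s t : Finset V} {x : V}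
    (hs : R.IsNClique 5 s) (hx : x ∈ s) (ht : B.IsNClique 4 t) (hst : Disjoint s t)
    (hxt : ∀ b ∈ t, B.Adj x b) :
    (∀ b ∈ t, #{y ∈ s.erase x | R.Adj b y} = 2) ∧ ∀ y ∈ s.erase x, #{b ∈ t | B.Adj y b} = 2 := by
  have hY : #(s.erase x) = 4 := by rw [Finset.card_erase_of_mem hx, hs.2]
  have hxt' : x ∉ t := Finset.disjoint_left.1 hst hx
  have ht' : B.IsNClique 5 (insert x t) := ht.insert hxt
  have h1 := h.clique_five_card_le_two_or_sum_le hs (Finset.erase_subset x s) hY ht.2 hst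
  have h2 := h.swap.clique_five_card_le_two_or_sum_le ht' (Finset.subset_insert x t) ht.2 hY (by
    rw [Finset.disjoint_insert_left]
    exact ⟨Finset.notMem_erase x s, (hst.mono_left (Finset.erase_subset x s)).symm⟩)
  have h3 : ∑ b ∈ t, #{y ∈ s.erase x | R.Adj b y} = ∑ y ∈ s.erase x, #{b ∈ t | R.Adj y b} := by
    have := Finset.sum_card_bipartiteAbove_eq_sum_card_bipartiteBelow (s := t) (t := s.erase x)
      R.Adj
    simpa only [Finset.bipartiteAbove, Finset.bipartiteBelow, R.adj_comm] using this
  have h4 : ∑ y ∈ s.erase x, #{b ∈ t | B.Adj y b} + ∑ y ∈ s.erase x, #{b ∈ t | R.Adj y b} = 16 := by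
    rw [← Finset.sum_add_distrib, Finset.sum_congr rfl fun y hy =>
      h.card_add_card (Finset.disjoint_left.1 hst (Finset.mem_of_mem_erase hy)), Finset.sum_const,
      hY, ht.2]
    rfl
  have h5 : ∀ {u : Finset V} {f : V → ℕ}, #u = 4 → (∀ b ∈ u, f b ≤ 2) → ∑ b ∈ u, f b ≤ 8 :=
    fun {u f} hu hf => (Finset.sum_le_card_nsmul u f 2 hf).trans (by rw [hu]; rfl)
  have h6 : ∀ {u : Finset V} {f : V → ℕ}, #u = 4 → (∀ b ∈ u, f b ≤ 2) → 8 ≤ ∑ b ∈ u, f b →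
      ∀ b ∈ u, f b = 2 := by
    intro u f hu hf h8
    have := (Finset.sum_eq_sum_iff_of_le (g := fun _ => 2) hf).1
      (le_antisymm (Finset.sum_le_sum hf) (by simpa [hu] using h8))
    exact this
  rcases h1 with h1 | h1 <;> rcases h2 with h2 | h2
  · have := h5 ht.2 h1
    have := h5 hY h2
    exact ⟨h6 ht.2 h1 (by omega), h6 hY h2 (by omega)⟩
  · have := h5 ht.2 h1
    omega
  · have := h5 hY h2
    omega
  · omega

end FanFreePair

namespace FanFreePair

variable {V : Type*} {B R : SimpleGraph V}

open scoped Classical in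
-- The balanced crossing makes `u, u', p, q` completely `B`-joined to `s.erase x` and completely
-- `R`-joined to `t`. Only the four pairs between `{u, u'}` and `{p, q}` remain free, and every
-- colouring of them yields a fan.
theorem false_of_crossing_cliques (h : FanFreePair B R) {s t : Finset V} {x u u' p q : V}
    (hs : R.IsNClique 5 s) (hx : x ∈ s) (ht : B.IsNClique 4 t) (hst : Disjoint s t)
    (hxt : ∀ b ∈ t, B.Adj x b) (hu : u ∉ s) (hu' : u' ∉ s) (huu : u ≠ u') (hxu : R.Adj x u)
    (hxu' : R.Adj x u') (hp : p ∉ s) (hq : q ∉ s) (hxp : B.Adj x p) (hxq : B.Adj x q)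
    (hpq : R.Adj p q) (hpt : ∀ b ∈ t, R.Adj p b) (hqt : ∀ b ∈ t, R.Adj q b) : False := by
  obtain ⟨hcR, hcB⟩ := h.crossing_cliques_card hs hx ht hst hxt
  have hxt' : x ∉ t := Finset.disjoint_left.1 hst hx
  have ht' : B.IsNClique 5 (insert x t) := ht.insert hxt
  have hts : ∀ b ∈ t, b ∉ s := fun b hb => Finset.disjoint_right.1 hst hb
  have hYR : ∀ y ∈ s.erase x, ∃ b ∈ t, R.Adj y b := by
    intro y hy
    have h1 := h.card_add_card (Finset.disjoint_left.1 hst (Finset.mem_of_mem_erase hy))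
    rw [hcB y hy, ht.2] at h1
    obtain ⟨b, hb⟩ := Finset.card_pos.1 (by omega : 0 < #{b ∈ t | R.Adj y b})
    exact ⟨b, (Finset.mem_filter.1 hb).1, (Finset.mem_filter.1 hb).2⟩
  have htB : ∀ b ∈ t, ∃ y ∈ s.erase x, B.Adj b y := by
    intro b hb
    have h1 := h.card_add_card (s := s.erase x) (v := b) fun hbs =>
      hts b hb (Finset.mem_of_mem_erase hbs)
    rw [hcR b hb, Finset.card_erase_of_mem hx, hs.2] at h1
    obtain ⟨y, hy⟩ := Finset.card_pos.1 (by omega : 0 < #{y ∈ s.erase x | B.Adj b y})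
    exact ⟨y, (Finset.mem_filter.1 hy).1, (Finset.mem_filter.1 hy).2⟩
  have hYfree : ∀ w ∉ s, (∀ b ∈ t, R.Adj w b) → ∀ y ∈ s.erase x, B.Adj w y := by
    intro w hw hwt y hy
    have hys := Finset.mem_of_mem_erase hy
    refine (h.total (ne_of_mem_of_not_mem hys hw).symm).resolve_right fun hwy => ?_
    obtain ⟨b, hb, hyb⟩ := hYR y hy
    exact h.clique_five_outside_edge hs hys hw (hts b hb) hwy.symm hyb (hwt b hb)
  have hYu : ∀ w ∉ s, R.Adj x w → ∀ y ∈ s.erase x, B.Adj w y := by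
    intro w hw hxw y hy
    have hys := Finset.mem_of_mem_erase hy
    refine (h.total (ne_of_mem_of_not_mem hys hw).symm).resolve_right fun hwy => ?_
    obtain ⟨b, hb, hyb⟩ := hYR y hy
    obtain ⟨z, hz, hzy⟩ := Finset.exists_mem_ne
      (by rw [hcR b hb]; omega : 1 < #{y ∈ s.erase x | R.Adj b y}) y
    rw [Finset.mem_filter, Finset.mem_erase] at hz
    exact h.clique_five_two_paths hs hys hx hz.1.2 (Finset.ne_of_mem_erase hy) hzy.symm
      hz.1.1.symm hw (hts b hb) (by rintro rfl; exact h.disj (hxt w hb) hxw) hwy.symm hyb hxw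
      hz.2.symm
  have htu : ∀ w ∉ s, R.Adj x w → ∀ b ∈ t, R.Adj w b := by
    intro w hw hxw b hb
    have hwt : w ∉ t := fun hwt => h.disj (hxt w hwt) hxw
    refine (h.total (ne_of_mem_of_not_mem hb hwt).symm).resolve_left fun hwb => ?_
    obtain ⟨y, hy, hby⟩ := htB b hb
    refine h.swap.clique_five_outside_edge ht' (Finset.mem_insert_of_mem hb) (u := w) (w := y)
      ?_ ?_ hwb.symm hby (hYu w hw hxw y hy)
    · rw [Finset.mem_insert, not_or]
      exact ⟨hxw.ne', hwt⟩
    · rw [Finset.mem_insert, not_or]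
      exact ⟨Finset.ne_of_mem_erase hy, Finset.disjoint_left.1 hst (Finset.mem_of_mem_erase hy)⟩
  have hne : ∀ w, R.Adj x w → ∀ r, B.Adj x r → w ≠ r := by
    rintro w hw _ hr rfl
    exact h.disj hr hw
  have huuB : B.Adj u u' :=
    (h.total huu).resolve_right (h.clique_five_outside_edge hs hx hu hu' hxu hxu')
  have hsne : ∀ w ∉ s, ∀ y ∈ s.erase x, w ≠ y := by
    rintro w hw _ hy rfl
    exact hw (Finset.mem_of_mem_erase hy)
  obtain ⟨y₁, hy₁, y₂, hy₂, y₃, hy₃, n1, n2, n3⟩ := exists_three (s := s.erase x)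
    (by rw [Finset.card_erase_of_mem hx, hs.2]; omega)
  obtain ⟨b₁, hb₁, b₂, hb₂, b₃, hb₃, m1, m2, m3⟩ := exists_three (s := t) (by rw [ht.2]; omega)
  have hBcross : ¬ (B.Adj u p ∧ B.Adj u' q) := by
    intro ⟨h1, h2⟩
    obtain ⟨b, hb, c, hc, hbc⟩ := Finset.one_lt_card.1
      (by rw [hcB y₁ hy₁]; omega : 1 < #{b ∈ t | B.Adj y₁ b})
    rw [Finset.mem_filter] at hb hc
    exact h.fanB y₁ b c u p u' q ⟨⟨hb.2, hc.2, (hYu u hu hxu _ hy₁).symm,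
      (hYfree p hp hpt _ hy₁).symm, (hYu u' hu' hxu' _ hy₁).symm, (hYfree q hq hqt _ hy₁).symm⟩,
      ⟨ht.1 hb.1 hc.1 hbc, h1, h2⟩,
      ⟨(hne u hxu b (hxt b hb.1)).symm, (hpt b hb.1).ne', (hne u hxu c (hxt c hc.1)).symm,
        (hpt c hc.1).ne'⟩,
      ⟨(hne u' hxu' b (hxt b hb.1)).symm, (hqt b hb.1).ne', (hne u' hxu' c (hxt c hc.1)).symm,
        (hqt c hc.1).ne'⟩,
      ⟨huu, hne u hxu q hxq, (hne u' hxu' p hxp).symm, hpq.ne⟩⟩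
  have hRcross : ¬ (R.Adj u p ∧ R.Adj u' q) := by
    intro ⟨h1, h2⟩
    obtain ⟨y, hy, z, hz, hyz⟩ := Finset.one_lt_card.1
      (by rw [hcR b₁ hb₁]; omega : 1 < #{y ∈ s.erase x | R.Adj b₁ y})
    rw [Finset.mem_filter] at hy hz
    exact h.fanR b₁ y z u p u' q ⟨⟨hy.2, hz.2, (htu u hu hxu _ hb₁).symm, (hpt _ hb₁).symm,
      (htu u' hu' hxu' _ hb₁).symm, (hqt _ hb₁).symm⟩,
      ⟨hs.1 (Finset.mem_of_mem_erase hy.1) (Finset.mem_of_mem_erase hz.1) hyz, h1, h2⟩,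
      ⟨(hsne u hu y hy.1).symm, (hsne p hp y hy.1).symm, (hsne u hu z hz.1).symm,
        (hsne p hp z hz.1).symm⟩,
      ⟨(hsne u' hu' y hy.1).symm, (hsne q hq y hy.1).symm, (hsne u' hu' z hz.1).symm,
        (hsne q hq z hz.1).symm⟩,
      ⟨huu, hne u hxu q hxq, (hne u' hxu' p hxp).symm, hpq.ne⟩⟩
  have hBboth : ∀ u u', u ∉ s → u' ∉ s → R.Adj x u → R.Adj x u' → B.Adj u u' →
      ¬ (B.Adj u p ∧ B.Adj u q) := by
    intro u u' hu hu' hxu hxu' huu ⟨h1, h2⟩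
    exact h.fanB u u' y₁ p y₂ q y₃ ⟨⟨huu, hYu u hu hxu _ hy₁, h1, hYu u hu hxu _ hy₂, h2,
      hYu u hu hxu _ hy₃⟩, ⟨hYu u' hu' hxu' _ hy₁, hYfree p hp hpt _ hy₂, hYfree q hq hqt _ hy₃⟩,
      ⟨hne u' hxu' p hxp, hsne u' hu' _ hy₂, (hsne p hp _ hy₁).symm, n1⟩,
      ⟨hne u' hxu' q hxq, hsne u' hu' _ hy₃, (hsne q hq _ hy₁).symm, n2⟩,
      ⟨hpq.ne, hsne p hp _ hy₃, (hsne q hq _ hy₂).symm, n3⟩⟩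
  have hRboth : ∀ p q, B.Adj x p → B.Adj x q → R.Adj p q → (∀ b ∈ t, R.Adj p b) →
      (∀ b ∈ t, R.Adj q b) → ¬ (R.Adj u p ∧ R.Adj u' p) := by
    intro p q hxp hxq hpq hpt hqt ⟨h1, h2⟩
    exact h.fanR p u b₁ u' b₂ q b₃ ⟨⟨h1.symm, hpt _ hb₁, h2.symm, hpt _ hb₂, hpq, hpt _ hb₃⟩,
      ⟨htu u hu hxu _ hb₁, htu u' hu' hxu' _ hb₂, hqt _ hb₃⟩,
      ⟨huu, hne u hxu _ (hxt _ hb₂), (hne u' hxu' _ (hxt _ hb₁)).symm, m1⟩,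
      ⟨hne u hxu q hxq, hne u hxu _ (hxt _ hb₃), (hqt _ hb₁).ne', m2⟩,
      ⟨hne u' hxu' q hxq, hne u' hxu' _ (hxt _ hb₃), (hqt _ hb₂).ne', m3⟩⟩
  -- In the 2 by 2 colour matrix no row is all `B`, no column is all `R`, and the diagonal `up`,
  -- `u'q` is not monochromatic.
  rcases h.total (hne u hxu p hxp) with hup | hup
  · have h1 := (h.total (hne u hxu q hxq)).resolve_left fun huq =>
      hBboth u u' hu hu' hxu hxu' huuB ⟨hup, huq⟩
    have h2 := (h.total (hne u' hxu' q hxq)).resolve_left fun huq => hBcross ⟨hup, huq⟩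
    exact hRboth q p hxq hxp hpq.symm hqt hpt ⟨h1, h2⟩
  · have h1 := (h.total (hne u' hxu' p hxp)).resolve_right fun hup' =>
      hRboth p q hxp hxq hpq hpt hqt ⟨hup, hup'⟩
    have h2 := (h.total (hne u' hxu' q hxq)).resolve_right fun huq => hRcross ⟨hup, huq⟩
    exact hBboth u' u hu' hu hxu' hxu huuB.symm ⟨h1, h2⟩

open scoped Classical in
theorem cliqueFree_five [Fintype V] (hV : Fintype.card V = 14) (h : FanFreePair B R) :
    R.CliqueFree 5 := by
  intro s hs
  have hcard : #sᶜ = 9 := by rw [Finset.card_compl, hs.2, hV]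
  have hdeg := fun x hx => h.clique_five_card_outside hV hs (x := x) hx
  have hsplit : ∀ x ∈ s, #{w ∈ sᶜ | B.Adj x w} + #{w ∈ sᶜ | R.Adj x w} = 9 := fun x hx => by
    rw [h.card_add_card (by simpa using hx), hcard]
  by_cases htwo : ∃ x ∈ s, #{w ∈ sᶜ | R.Adj x w} = 2
  · obtain ⟨x, hx, hx2⟩ := htwo
    obtain ⟨u, hu, u', hu', huu⟩ :=
      Finset.one_lt_card.1 (by omega : 1 < #{w ∈ sᶜ | R.Adj x w})
    have h7 := hsplit x hx
    have hout : ∀ {G : SimpleGraph V} {w : V}, w ∈ {w ∈ sᶜ | G.Adj x w} → w ∉ s ∧ G.Adj x w :=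
      fun hw => by simpa only [Finset.mem_filter, Finset.mem_compl] using hw
    rcases h.swap.large_red_neighborhood (A := {w ∈ sᶜ | B.Adj x w}) (v := x)
      (fun w hw => (hout hw).2) (by omega) with ⟨s', hs', hc⟩ | ⟨t, ht, htc, p, hp, q, hq, hpq, hpqt⟩ |
      ⟨_, _, _, _, _, _, J⟩
    · exact h.false_of_disjoint_clique_five hV hs hc
        (Finset.disjoint_right.2 fun w hw => (hout (hs' hw)).1)
    · exact h.false_of_crossing_cliques hs hx htc
        (Finset.disjoint_right.2 fun w hw => (hout (ht hw)).1) (fun b hb => (hout (ht hb)).2)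
        (hout hu).1 (hout hu').1 huu (hout hu).2 (hout hu').2 (hout hp).1 (hout hq).1 (hout hp).2
        (hout hq).2 hpq (fun b hb => (hpqt b hb).1) fun b hb => (hpqt b hb).2
    · exact J.elim hV h.swap
  · push Not at htwo
    have hthree : ∀ x ∈ s, #{w ∈ sᶜ | R.Adj x w} = 3 := fun x hx => by
      have := hdeg x hx
      have := htwo x hx
      omega
    obtain ⟨i, hi, j, hj, l, hl, -, -, -, hij, hil, hjl⟩ := StarLike.exists_disjoint
      (h.clique_five_starLike hs disjoint_compl_right) hs.2 hthree hcard.le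
      fun i _ => Finset.filter_subset _ _
    have hblue : ∀ i ∈ s, ∀ x ∈ {w ∈ sᶜ | R.Adj i w}, ∀ y ∈ {w ∈ sᶜ | R.Adj i w}, x ≠ y →
        B.Adj x y := by
      intro i hi x hx y hy hxy
      rw [Finset.mem_filter, Finset.mem_compl] at hx hy
      exact (h.total hxy).resolve_right (h.clique_five_outside_edge hs hi hx.1 hy.1 hx.2 hy.2)
    have hopp : ∀ i ∈ s, ∀ j, Disjoint {w ∈ sᶜ | R.Adj i w} {w ∈ sᶜ | R.Adj j w} →
        ∀ x ∈ {w ∈ sᶜ | R.Adj j w}, B.Adj i x := by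
      intro i hi j hd x hx
      have hx' := Finset.disjoint_right.1 hd hx
      rw [Finset.mem_filter] at hx hx'
      refine (h.total ?_).resolve_right fun hix => hx' ⟨hx.1, hix⟩
      rintro rfl
      exact Finset.mem_compl.1 hx.1 hi
    have hunion : ∀ i ∈ s, ∀ j l, Disjoint {w ∈ sᶜ | R.Adj i w} {w ∈ sᶜ | R.Adj j w} →
        Disjoint {w ∈ sᶜ | R.Adj i w} {w ∈ sᶜ | R.Adj l w} →
        ∀ x ∈ {w ∈ sᶜ | R.Adj j w} ∪ {w ∈ sᶜ | R.Adj l w}, B.Adj i x := by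
      intro i hi j l h1 h2 x hx
      rcases Finset.mem_union.1 hx with hx | hx
      exacts [hopp i hi j h1 x hx, hopp i hi l h2 x hx]
    exact h.false_of_three_disjoint (hthree i hi) (hthree j hj) (hthree l hl) (hblue i hi)
      (hblue j hj) (hblue l hl) hij hil hjl (hunion i hi j l hij hil)
      (hunion j hj i l hij.symm hjl) (hunion l hl i j hil.symm hjl.symm)

/-! ### The upper bound. -/

open scoped Classical in
theorem card_red_lt_seven [Fintype V] (hV : Fintype.card V = 14) (h : FanFreePair B R) (v : V) :
    #{w | R.Adj v w} < 7 := by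
  by_contra! hcon
  have hA : ∀ w ∈ ({w | R.Adj v w} : Finset V), R.Adj v w := fun w hw => (Finset.mem_filter.1 hw).2
  rcases h.large_red_neighborhood hA hcon with ⟨s, -, hs⟩ | ⟨t, ht, htc, -⟩ |
    ⟨_, _, _, _, _, _, J⟩
  · exact h.swap.cliqueFree_five hV s hs
  · exact h.cliqueFree_five hV _ (htc.insert fun w hw => hA w (ht hw))
  · exact J.elim hV h

/-- No red-blue colouring of the complete graph on 14 vertices avoids monochromatic fans with
three blades. -/
theorem card_ne_fourteen [Fintype V] (h : FanFreePair B R) : Fintype.card V ≠ 14 := by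
  classical
  intro hV
  have v : V := (Fintype.card_pos_iff.1 (by omega)).some
  have h1 := h.card_red_lt_seven hV v
  have h2 := h.swap.card_red_lt_seven hV v
  have h3 := h.card_blue_add_card_red hV v
  omega

end FanFreePair

/-! ### Translation between `IsFan` and copies of `fanGraph 3`. -/

namespace SimpleGraph

variable {V : Type*} {G : SimpleGraph V}

theorem IsFan.fanGraph_isContained {v a a' b b' c c' : V} (h : G.IsFan v a a' b b' c c') :
    fanGraph 3 ⊑ G := by
  obtain ⟨⟨h1, h2, h3, h4, h5, h6⟩, ⟨e1, e2, e3⟩, ⟨n1, n2, n3, n4⟩, ⟨n5, n6, n7, n8⟩,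
    n9, n10, n11, n12⟩ := h
  let f : Fin 1 ⊕ (Fin 3 × Fin 2) → V :=
    Sum.elim (fun _ => v) fun p => (![![a, a'], ![b, b'], ![c, c']] : Fin 3 → Fin 2 → V) p.1 p.2
  have hadj : ∀ p, G.Adj v (f (Sum.inr p)) := by
    rintro ⟨i, j⟩
    fin_cases i <;> fin_cases j <;> assumption
  have hblade : ∀ i j k, j ≠ k → G.Adj (f (Sum.inr (i, j))) (f (Sum.inr (i, k))) := by
    intro i j k hjk
    fin_cases i <;> fin_cases j <;> fin_cases k <;>
      first | exact absurd rfl hjk | assumption | exact SimpleGraph.Adj.symm ‹_›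
  have hinj : ∀ i j k l, i ≠ k → f (Sum.inr (i, j)) ≠ f (Sum.inr (k, l)) := by
    intro i j k l hik
    fin_cases i <;> fin_cases k <;> first | exact absurd rfl hik | skip
    all_goals fin_cases j <;> fin_cases l <;> first | assumption | exact Ne.symm ‹_›
  refine ⟨⟨⟨f, ?_⟩, ?_⟩⟩
  · rintro (x | ⟨i, j⟩) (y | ⟨k, l⟩) hxy
    · simp [fanGraph, graphJoin, Subsingleton.elim x y] at hxy
    · exact hadj _
    · exact (hadj _).symm
    · simp [fanGraph, graphJoin, disjointCopies] at hxy
      obtain ⟨rfl, hjl⟩ := hxy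
      exact hblade _ _ _ hjl
  · rintro (x | ⟨i, j⟩) (y | ⟨k, l⟩) hxy
    · rw [Subsingleton.elim x y]
    · exact ((hadj (k, l)).ne hxy).elim
    · exact ((hadj (i, j)).ne hxy.symm).elim
    · by_cases hik : i = k
      · subst hik
        by_cases hjl : j = l
        · rw [hjl]
        · exact ((hblade i j l hjl).ne hxy).elim
      · exact (hinj i j k l hik hxy).elim

theorem exists_isFan_of_fanGraph_isContained (h : fanGraph 3 ⊑ G) :
    ∃ v a a' b b' c c', G.IsFan v a a' b b' c c' := by
  obtain ⟨f⟩ := h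
  have hadj : ∀ p, G.Adj (f (Sum.inl 0)) (f (Sum.inr p)) := fun p =>
    f.toHom.map_adj (by simp [fanGraph, graphJoin])
  have hblade : ∀ i, G.Adj (f (Sum.inr (i, 0))) (f (Sum.inr (i, 1))) := fun i =>
    f.toHom.map_adj (by simp [fanGraph, graphJoin, disjointCopies])
  have hne : ∀ i j k l, i ≠ k → f (Sum.inr (i, j)) ≠ f (Sum.inr (k, l)) := fun i j k l hik hf =>
    hik (congrArg Prod.fst (Sum.inr_injective (f.injective hf)))
  have h01 : (0 : Fin 3) ≠ 1 := by decide
  have h02 : (0 : Fin 3) ≠ 2 := by decide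
  have h12 : (1 : Fin 3) ≠ 2 := by decide
  exact ⟨f (Sum.inl 0), f (Sum.inr (0, 0)), f (Sum.inr (0, 1)), f (Sum.inr (1, 0)),
    f (Sum.inr (1, 1)), f (Sum.inr (2, 0)), f (Sum.inr (2, 1)),
    ⟨hadj _, hadj _, hadj _, hadj _, hadj _, hadj _⟩, ⟨hblade 0, hblade 1, hblade 2⟩,
    ⟨hne _ _ _ _ h01, hne _ _ _ _ h01, hne _ _ _ _ h01, hne _ _ _ _ h01⟩,
    ⟨hne _ _ _ _ h02, hne _ _ _ _ h02, hne _ _ _ _ h02, hne _ _ _ _ h02⟩,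
    ⟨hne _ _ _ _ h12, hne _ _ _ _ h12, hne _ _ _ _ h12, hne _ _ _ _ h12⟩⟩

end SimpleGraph

theorem ramseyArrows_fourteen : RamseyArrows 14 (fanGraph 3) (fanGraph 3) := by
  intro C
  by_contra hcon
  rw [not_or] at hcon
  refine FanFreePair.card_ne_fourteen (B := C.labelGraph 0) (R := C.labelGraph 1)
    ⟨fun {x y} hxy => ?_, fun {x y} hx hy => ?_, fun v a a' b b' c c' hf => ?_,
      fun v a a' b b' c c' hf => ?_⟩ (Fintype.card_fin 14)
  · simp only [SimpleGraph.TopEdgeLabeling.labelGraph_adj]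
    have h2 : ∀ k : Fin 2, k = 0 ∨ k = 1 := by decide
    exact (h2 (C.get x y hxy)).imp (fun h => ⟨hxy, h⟩) fun h => ⟨hxy, h⟩
  · rw [SimpleGraph.TopEdgeLabeling.labelGraph_adj] at hx hy
    obtain ⟨_, hx⟩ := hx
    obtain ⟨_, hy⟩ := hy
    exact absurd (hx.symm.trans hy) (by decide)
  · exact hcon.1 hf.fanGraph_isContained
  · exact hcon.2 hf.fanGraph_isContained

/-! ### The lower bound: a colouring on 13 vertices. -/

/-- A graph on 13 vertices, given by the bit masks of its neighbourhoods. -/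
def thirteenAdj (i j : Fin 13) : Bool :=
  ([2858, 925, 7266, 3843, 7266, 5269, 5780, 5218, 6667, 2379, 252, 797, 500].getD i 0).testBit j

/-- The graph of the edges with the second colour in a colouring of the complete graph on 13
vertices without monochromatic fans with three blades. -/
def thirteenGraph : SimpleGraph (Fin 13) where
  Adj i j := thirteenAdj i j
  symm := ⟨by decide⟩
  loopless := ⟨by decide⟩

instance : DecidableRel thirteenGraph.Adj := fun i j =>
  inferInstanceAs (Decidable (thirteenAdj i j = true))

set_option synthInstance.maxHeartbeats 400000 in
set_option synthInstance.maxSize 2000 in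
set_option maxRecDepth 4000 in
-- Each vertex is tested before the next is quantified, and each blade is ordered, so that the
-- evaluation prunes early. The inequalities with `v` matter for `k = false`, where the diagonal
-- also has value `k`.
theorem thirteenAdj_no_fan : ∀ k : Bool, ∀ v a : Fin 13, v ≠ a → thirteenAdj v a = k →
    ∀ a', a < a' → v ≠ a' → thirteenAdj v a' = k → thirteenAdj a a' = k →
    ∀ b, v ≠ b → thirteenAdj v b = k → a ≠ b → a' ≠ b →
    ∀ b', b < b' → v ≠ b' → thirteenAdj v b' = k → a ≠ b' → a' ≠ b' → thirteenAdj b b' = k →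
    ∀ c, v ≠ c → thirteenAdj v c = k → a ≠ c → a' ≠ c → b ≠ c → b' ≠ c →
    ∀ c', c < c' → v ≠ c' → thirteenAdj v c' = k → a ≠ c' → a' ≠ c' → b ≠ c' → b' ≠ c' →
      thirteenAdj c c' ≠ k := by
  decide +kernel

/-- The symmetries `IsFan.swap` and `IsFan.rotate` order the ends of every blade. -/
theorem not_isFan_of_adj {G : SimpleGraph (Fin 13)} {k : Bool}
    (hG : ∀ x y, G.Adj x y → thirteenAdj x y = k) (v a a' b b' c c' : Fin 13) :
    ¬ G.IsFan v a a' b b' c c' := by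
  have key : ∀ a a' b b' c c', G.IsFan v a a' b b' c c' → a < a' → b < b' → c < c' → False := by
    rintro a a' b b' c c' ⟨⟨h1, h2, h3, h4, h5, h6⟩, ⟨e1, e2, e3⟩, ⟨n1, n2, n3, n4⟩,
      ⟨n5, n6, n7, n8⟩, n9, n10, n11, n12⟩ ha hb hc
    exact thirteenAdj_no_fan k v a h1.ne (hG _ _ h1) a' ha h2.ne (hG _ _ h2) (hG _ _ e1)
      b h3.ne (hG _ _ h3) n1 n3 b' hb h4.ne (hG _ _ h4) n2 n4 (hG _ _ e2)
      c h5.ne (hG _ _ h5) n5 n7 n9 n11 c' hc h6.ne (hG _ _ h6) n6 n8 n10 n12 (hG _ _ e3)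
  have key₁ : ∀ a a' b b' c c', G.IsFan v a a' b b' c c' → b < b' → c < c' → False :=
    fun a a' b b' c c' h => h.2.1.1.ne.lt_or_gt.elim (key _ _ _ _ _ _ h) (key _ _ _ _ _ _ h.swap)
  have key₂ : ∀ a a' b b' c c', G.IsFan v a a' b b' c c' → c < c' → False :=
    fun a a' b b' c c' h => h.2.1.1.ne.lt_or_gt.elim
      (fun ha hc => key₁ _ _ _ _ _ _ h.rotate hc ha)
      fun ha hc => key₁ _ _ _ _ _ _ h.swap.rotate hc ha
  exact fun h => h.2.1.1.ne.lt_or_gt.elim (key₂ _ _ _ _ _ _ h.rotate)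
    (key₂ _ _ _ _ _ _ h.swap.rotate)

theorem not_ramseyArrows_of_le_thirteen {N : ℕ} (hN : N ≤ 13) :
    ¬ RamseyArrows N (fanGraph 3) (fanGraph 3) := by
  intro h
  let e : Fin N ↪ Fin 13 := Fin.castLEEmb hN
  have hpull : ∀ k, (thirteenGraph.toTopEdgeLabeling.pullback e).labelGraph k ⊑
      thirteenGraph.toTopEdgeLabeling.labelGraph k := fun k => by
    refine ⟨⟨⟨e, fun {x y} hxy => ?_⟩, e.injective⟩⟩
    rw [SimpleGraph.TopEdgeLabeling.labelGraph_adj] at hxy ⊢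
    obtain ⟨hne, hxy⟩ := hxy
    exact ⟨e.injective.ne hne, hxy⟩
  rcases h (thirteenGraph.toTopEdgeLabeling.pullback e) with h | h
  · replace h := h.trans (hpull 0)
    -- Colour 0 is the complement of `thirteenGraph`, that is, the value `false` of `thirteenAdj`.
    rw [SimpleGraph.toTopEdgeLabeling_labelGraph_compl] at h
    obtain ⟨_, _, _, _, _, _, _, hf⟩ := SimpleGraph.exists_isFan_of_fanGraph_isContained h
    exact not_isFan_of_adj (k := false) (fun x y hxy => by
      simpa [thirteenGraph] using hxy.2) _ _ _ _ _ _ _ hf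
  · replace h := h.trans (hpull 1)
    rw [SimpleGraph.toTopEdgeLabeling_labelGraph] at h
    obtain ⟨_, _, _, _, _, _, _, hf⟩ := SimpleGraph.exists_isFan_of_fanGraph_isContained h
    exact not_isFan_of_adj (k := true) (fun x y hxy => hxy) _ _ _ _ _ _ _ hf

theorem theorem1p3 : diagonalRamseyNumber (fanGraph 3) = 14 := by
  refine le_antisymm (Nat.sInf_le ramseyArrows_fourteen)
    (le_csInf ⟨14, ramseyArrows_fourteen⟩ fun N hN => ?_)
  by_contra! hlt
  exact not_ramseyArrows_of_le_thirteen (by omega) hN
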